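/- Let $R$ be a finite (reduced, crystallographic) irreducible root system not of type $A_n$, with a fixed basis of simple roots, Weyl group $W$, root lattice $Q$ and height function $\mathrm{ht}$. **Definitions.** A weight $\lambda\in Q$ is *small* if the convex hull of $W\lambda$ contains no element $2\alpha$ with $\alpha\in R$. A *minimal expression* of $\lambda\in Q$ is a way of writing $\lambda$ as a sum of roots with the fewest possible terms (up to order). For $\lambda$ small, the relation $(\beta,\beta')>0$ is an equivalence relation on the set of roots of a minimal expression; its classes are the *blocks* of the expression, and a *$\lambda$-block* is a block of some minimal expression of $\lambda$. A block also denotes the sum of its roots. A *canonical block decomposition* of a small dominant weight $\lambda$ is defined inductively: that of $0$ is empty; for $\lambda\ne0$ it is a block decomposition $\lambda=B_1+\dots+B_k$ of a minimal expression such that $B_k$ has the smallest height among all $\lambda$-blocks and $\lambda-B_k=B_1+\dots+B_{k-1}$ is a canonical block decomposition of $\lambda-B_k$. A parabolic subsystem $\Gamma$ is one spanned by a set of simple roots of $R$. The *symbol* of $\lambda$ is $[a_1^{X_1},\dots,a_k^{X_k}]$, obtained from the canonical block decomposition $\lambda=B_1+\dots+B_k$ as follows. Put $\Gamma_0=R$.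 For $i\ge1$, $X_i$ is the Dynkin type of the irreducible component of $\Gamma_{i-1}$ that contains $B_i$, and $\Gamma_i$ is the parabolic subsystem spanned by the simple roots of this component that are orthogonal to all roots of $B_i$. The mark $a_i$ is $2$ if $B_i$ has two roots. If $B_i$ has one root, $a_i$ is $1$ if $R$ is simply laced, and otherwise $1_s$ or $1_\ell$ according to whether this root is short or long in $R$. Dynkin types are isomorphism classes of connected diagrams, so that $B_1=C_1=A_1$, $C_2=B_2$ and $D_3=A_3$; moreover $D_2=A_1+A_1$, and $1^{D_2}$ stands for $1^{A_1}$. **Theorem.** Every small dominant weight has exactly one canonical block decomposition and exactly one symbol. The symbols of the non-zero small dominant weights of $R$ are exactly the following. - $B_n$ ($n\ge2$): $[1_s^{B_n}]$; $[1_\ell^{B_n},1_\ell^{B_{n-2}},\dots,1_\ell^{B_{n-2k}}]$ for $0\le k\le (n-2)/2$; $[1_\ell^{B_n},1_\ell^{B_{n-2}},\dots,1_\ell^{B_{n-2k}},1_s^{B_{n-2k-2}}]$ for $0\le k\le (n-3)/2$. - $C_n$ ($n\ge3$): $[1_\ell^{C_n}]$; $[1_s^{C_n},1_s^{C_{n-2}},\dots,1_s^{C_{n-2k}}]$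 for $0\le k\le (n-2)/2$; $[1_\ell^{C_n},1_s^{C_{n-1}},1_s^{C_{n-3}},\dots,1_s^{C_{n-2k-1}}]$ for $0\le k\le (n-3)/2$. - $D_n$ ($n\ge4$): $[1^{D_n},1^{A_1}]$; $[2^{D_n}]$; $[1^{D_n},1^{D_{n-2}},\dots,1^{D_{n-2k}}]$ for $0\le k\le (n-2)/2$; $[2^{D_n},1^{D_{n-3}},1^{D_{n-5}},\dots,1^{D_{n-2k-3}}]$ for $0\le k\le (n-5)/2$. - $E_6$: $[1^{E_6}]$, $[1^{E_6},1^{A_5}]$, $[2^{E_6}]$, $[2^{E_6},1^{A_2}]$, $[2^{E_6},2^{A_2}]$. - $E_7$: $[1^{E_7}]$, $[1^{E_7},1^{D_6}]$, $[1^{E_7},1^{D_6},1^{A_1}]$, $[2^{E_7}]$, $[2^{E_7},1^{A_5}]$. - $E_8$: $[1^{E_8}]$, $[1^{E_8},1^{E_7}]$, $[2^{E_8}]$, $[2^{E_8},1^{E_6}]$. - $F_4$: $[1_s^{F_4}]$, $[1_\ell^{F_4}]$, $[1_\ell^{F_4},1_s^{C_3}]$. - $G_2$: $[1_s^{G_2}]$,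 $[1_\ell^{G_2}]$. Moreover, if $\lambda$ is a small dominant weight with symbol $[a_1^{X_1},\dots,a_k^{X_k}]$ and canonical block decomposition $\lambda=B_1+\dots+B_k$, and $C_i$ (of type $X_i$) denotes the component of $\Gamma_{i-1}$ containing $B_i$, then the blocks are given by the cascade construction: if $a_i\in\{1,1_s,1_\ell\}$, then $B_i$ consists of a dominant root of $C_i$ of the indicated length in $R$; if $a_i=2$, then $X_i$ is simply laced and $B_i=\{\theta,\theta-\alpha\}$, where $\theta$ is the dominant root of $C_i$ and $\alpha$ is a simple root of $C_i$ not orthogonal to $\theta$. Finally, two small dominant weights with the same symbol are conjugate under the action of an automorphism of the Dynkin diagram of $R$. -/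

import Mathlib

open scoped BigOperators

noncomputable section

namespace SmallWeights

/-! ### Dynkin types -/

/-- Names of connected Dynkin diagrams. -/
inductive DynkinType where
  | A (n : ℕ)
  | B (n : ℕ)
  | C (n : ℕ)
  | D (n : ℕ)
  | E6
  | E7
  | E8
  | F4
  | G2

namespace DynkinType

/-- The range of ranks in which every connected Dynkin diagram has exactly one name. -/
def IsProper : DynkinType → Prop
  | A n => 1 ≤ n
  | B n => 2 ≤ n
  | C n => 3 ≤ n
  | D n => 4 ≤ n
  | _ => True

/-- The number of nodes. -/
def rank : DynkinType → ℕ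
  | A n => n
  | B n => n
  | C n => n
  | D n => n
  | E6 => 6
  | E7 => 7
  | E8 => 8
  | F4 => 4
  | G2 => 2

/-- The Cartan matrix, with entries `⟨α_i, α_j^∨⟩`: the last simple root is short in type `B`
and long in type `C`. -/
def cartan : (X : DynkinType) → Matrix (Fin X.rank) (Fin X.rank) ℤ
  | A n => CartanMatrix.A n
  | B n => CartanMatrix.B n
  | C n => CartanMatrix.C n
  | D n => CartanMatrix.D n
  | E6 => CartanMatrix.E₆
  | E7 => CartanMatrix.E₇
  | E8 => CartanMatrix.E₈
  | F4 => CartanMatrix.F₄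
  | G2 => CartanMatrix.G₂

/-- The diagram `B_m` (`m ≥ 1`) under its unique proper name: `B_1 = A_1`. -/
def typeB (m : ℕ) : DynkinType := if m = 1 then A 1 else B m

/-- The diagram `C_m` (`m ≥ 1`) under its unique proper name: `C_1 = A_1` and `C_2 = B_2`. -/
def typeC (m : ℕ) : DynkinType := if m = 1 then A 1 else if m = 2 then B 2 else C m

/-- The diagram `D_m` (`m ≥ 2`) under its unique proper name: `D_3 = A_3`, and, since
`D_2 = A_1 + A_1`, a component of `D_2` is of type `A_1`. -/
def typeD (m : ℕ) : DynkinType := if m = 2 then A 1 else if m = 3 then A 3 else D m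

end DynkinType

/-! ### Symbols -/

/-- The marks `1` (used if all the roots of `R` have the same length), `1_s`, `1_ℓ` (used if `R`
has two root lengths) and `2`. -/
inductive Mark where
  | one
  | oneShort
  | oneLong
  | two

/-- A symbol `[a₁^{X₁}, …, a_N^{X_N}]`. -/
abbrev Symbol := List (Mark × DynkinType)

/-- The sequence `[a^{T m}, a^{T (m-2)}, …, a^{T (m-2k)}]`, used for `2k ≤ m` only. -/
def chain (a : Mark) (T : ℕ → DynkinType) (m k : ℕ) : Symbol :=
  (List.range (k + 1)).map fun j => (a, T (m - 2 * j))

open DynkinType Mark in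
/-- The list of symbols for each Dynkin type other than `A`. -/
def DynkinType.symbols : DynkinType → Set Symbol
  | A _ => ∅
  | B n => {s | s = [(oneShort, typeB n)]
      ∨ (∃ k, 2 * k + 2 ≤ n ∧ s = chain oneLong typeB n k)
      ∨ (∃ k, 2 * k + 3 ≤ n ∧ s = chain oneLong typeB n k ++ [(oneShort, typeB (n - 2 * k - 2))])}
  | C n => {s | s = [(oneLong, typeC n)]
      ∨ (∃ k, 2 * k + 2 ≤ n ∧ s = chain oneShort typeC n k)
      ∨ (∃ k, 2 * k + 3 ≤ n ∧ s = (oneLong, typeC n) :: chain oneShort typeC (n - 1) k)}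
  | D n => {s | s = [(one, typeD n), (one, A 1)]
      ∨ s = [(two, typeD n)]
      ∨ (∃ k, 2 * k + 2 ≤ n ∧ s = chain one typeD n k)
      ∨ (∃ k, 2 * k + 5 ≤ n ∧ s = (two, typeD n) :: chain one typeD (n - 3) k)}
  | E6 => {[(one, E6)], [(one, E6), (one, A 5)], [(two, E6)], [(two, E6), (one, A 2)],
      [(two, E6), (two, A 2)]}
  | E7 => {[(one, E7)], [(one, E7), (one, D 6)], [(one, E7), (one, D 6), (one, A 1)],
      [(two, E7)], [(two, E7), (one, A 5)]}
  | E8 => {[(one, E8)], [(one, E8), (one, E7)], [(two, E8)], [(two, E8), (one, E6)]}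
  | F4 => {[(oneShort, F4)], [(oneLong, F4)], [(oneLong, F4), (oneShort, C 3)]}
  | G2 => {[(oneShort, G2)], [(oneLong, G2)]}

section RootSystem

variable {ι V N : Type*} [Fintype ι] [AddCommGroup V] [Module ℝ V] [AddCommGroup N] [Module ℝ N]
  (P : RootPairing ι ℝ V N)

/-! ### Small dominant weights -/

/-- `l` is small: it lies in the root lattice and the convex hull of its Weyl group orbit
contains no element `2α` with `α` a root. For dominant `l` this says that twice a root is never a
weight of the irreducible representation with highest weight `l`. -/
def IsSmall (l : V) : Prop :=
  l ∈ P.rootSpan ℤ ∧ ∀ i, (2 : ℝ) • P.root i ∉ convexHull ℝ (MulAction.orbit P.weylGroup l)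

/-- `l` is dominant with respect to the base `b`. -/
def IsDominant {P : RootPairing ι ℝ V N} (b : P.Base) (l : V) : Prop :=
  ∀ i ∈ b.support, 0 ≤ P.coroot' i l

/-! ### Minimal expressions and blocks -/

/-- The multiset of roots `e` is an expression of `l` as a sum of roots. -/
def IsExpression (l : V) (e : Multiset ι) : Prop :=
  (e.map P.root).sum = l

/-- An expression with the smallest possible number of terms. -/
def IsMinimalExpression (l : V) (e : Multiset ι) : Prop :=
  IsExpression P l e ∧ ∀ e', IsExpression P l e' → e.card ≤ e'.card

/-- `B` is a block of the expression `e`: the class of a root of `e` for the relation `(α, β) > 0`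
on the set of roots of `e`. -/
def IsBlockOf (e : Multiset ι) (B : Finset ι) : Prop :=
  ∃ i ∈ e, ∀ j, j ∈ B ↔ j ∈ e ∧ 0 < P.pairing j i

/-- `B` is an `l`-block: a block of some minimal expression of `l`. -/
def IsBlock (l : V) (B : Finset ι) : Prop :=
  ∃ e, IsMinimalExpression P l e ∧ IsBlockOf P e B

/-- `L` enumerates, without repetition, the blocks of some minimal expression of `l`. -/
def IsBlockDecomposition (l : V) (L : List (Finset ι)) : Prop :=
  ∃ e, IsMinimalExpression P l e ∧ L.Nodup ∧ ∀ B, B ∈ L ↔ IsBlockOf P e B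

/-- The sum of the roots in a block. -/
def blockSum (B : Finset ι) : V := ∑ i ∈ B, P.root i

/-- The height of a block. -/
def blockHeight {P : RootPairing ι ℝ V N} (b : P.Base) (B : Finset ι) : ℤ :=
  ∑ i ∈ B, b.height i

/-- `L = [B₁, …, B_k]` is a canonical block decomposition of `l`: the last block has smallest height
among all `l`-blocks, and removing it leaves a canonical block decomposition of `l - B_k`. -/
inductive IsCanonical {P : RootPairing ι ℝ V N} (b : P.Base) : V → List (Finset ι) → Prop
  | zero : IsCanonical b 0 []
  | snoc {l : V} {L : List (Finset ι)} {B : Finset ι} :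
      IsBlockDecomposition P l (L ++ [B]) →
      (∀ B', IsBlock P l B' → blockHeight b B ≤ blockHeight b B') →
      IsCanonical b (l - blockSum P B) L →
      IsCanonical b l (L ++ [B])

/-! ### Components of parabolic subsystems

A parabolic subsystem is given by the set `Γ` of its simple roots; its roots are the roots of `R`
in the linear span of `Γ`. -/

/-- The diagram with node set `C` is of (proper) Dynkin type `X`. -/
def HasType [P.IsCrystallographic] (C : Set ι) (X : DynkinType) : Prop :=
  X.IsProper ∧ ∃ e : Fin X.rank ≃ C, ∀ i j, P.pairingIn ℤ (e i) (e j) = X.cartan i j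

/-- `C` is (the node set of) a connected component of the diagram with node set `Γ`. -/
def IsComponent (Γ C : Set ι) : Prop :=
  C ⊆ Γ ∧ C.Nonempty ∧ (∀ i ∈ C, ∀ j ∈ Γ \ C, P.pairing i j = 0) ∧
    ∀ T ⊆ C, T.Nonempty → (∀ i ∈ T, ∀ j ∈ C \ T, P.pairing i j = 0) → T = C

/-- The root `i` belongs to the parabolic subsystem spanned by `C`. -/
def InParabolic (C : Set ι) (i : ι) : Prop :=
  P.root i ∈ Submodule.span ℝ (P.root '' C)

/-- The nodes of `C` orthogonal to all roots of `B`. -/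
def orthogonalNodes (C : Set ι) (B : Finset ι) : Set ι :=
  {j ∈ C | ∀ i ∈ B, P.pairing j i = 0}

/-- All the roots have the same length. -/
def OneLength : Prop :=
  ∀ i j, P.RootForm (P.root i) (P.root i) = P.RootForm (P.root j) (P.root j)

/-- The root `i` is of smallest length in `R`. -/
def IsShort (i : ι) : Prop :=
  ∀ j, P.RootForm (P.root i) (P.root i) ≤ P.RootForm (P.root j) (P.root j)

/-- The root `i` is of largest length in `R`. -/
def IsLong (i : ι) : Prop :=
  ∀ j, P.RootForm (P.root j) (P.root j) ≤ P.RootForm (P.root i) (P.root i)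

/-- The mark `a` is an admissible length specification for the root `i` (in a block of size one). -/
def Mark.LengthMark : Mark → ι → Prop
  | .one, _ => OneLength P
  | .oneShort, i => ¬ OneLength P ∧ IsShort P i
  | .oneLong, i => ¬ OneLength P ∧ IsLong P i
  | .two, _ => False

/-- The mark of the block `B`: its size, and the length of its root if the size is one. -/
def Mark.Records (a : Mark) (B : Finset ι) : Prop :=
  (∃ i, B = {i} ∧ a.LengthMark P i) ∨ (B.card = 2 ∧ a = .two)

/-- `s = [a₁^{X₁}, …, a_N^{X_N}]` is the symbol, relative to the parabolic subsystem `Γ`, of the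
sequence of blocks `L = [B₁, …, B_N]`: `a₁` is the mark of `B₁`, `X₁` is the Dynkin type of the
irreducible component of `Γ` which contains `B₁`, and `[a₂^{X₂}, …]` is the symbol of `[B₂, …]`
relative to the part of this component spanned by the simple roots orthogonal to `B₁`. -/
inductive IsSymbol [P.IsCrystallographic] : Set ι → List (Finset ι) → Symbol → Prop
  | nil {Γ : Set ι} : IsSymbol Γ [] []
  | cons {Γ C : Set ι} {a : Mark} {X : DynkinType} {B : Finset ι} {L : List (Finset ι)}
      {s : Symbol} :
      IsComponent P Γ C → HasType P C X → (∀ i ∈ B, InParabolic P C i) → a.Records P B →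
      IsSymbol (orthogonalNodes P C B) L s →
      IsSymbol Γ (B :: L) ((a, X) :: s)

/-- `s` is the symbol of (a canonical block decomposition of) the weight `l`. -/
def HasSymbol {P : RootPairing ι ℝ V N} [P.IsCrystallographic] (b : P.Base) (l : V)
    (s : Symbol) : Prop :=
  ∃ L, IsCanonical b l L ∧ IsSymbol P b.support L s

/-! ### The weights denoted by a symbol -/

/-- `i` is a dominant root of the parabolic subsystem spanned by `C`. -/
def IsDominantRoot (C : Set ι) (i : ι) : Prop :=
  InParabolic P C i ∧ ∀ j ∈ C, 0 ≤ P.pairing i j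

/-- `B` is the set of roots whose sum is `[a^X]`, for a component `C` of type `X`: a dominant root
of `C` (with the length in `R` specified by `a`), or, if `a = 2` and `X` is simply laced, the pair
`θ, θ - α` with `θ` the dominant root of `C` and `α` a simple root of `C` not orthogonal to `θ`. -/
def IsDominantBlock (C : Set ι) (X : DynkinType) (a : Mark) (B : Finset ι) : Prop :=
  (∃ t, IsDominantRoot P C t ∧ a.LengthMark P t ∧ B = {t}) ∨
  (a = .two ∧ X.cartan.IsSimplyLaced ∧ ∃ t t', IsDominantRoot P C t ∧
    (∃ j ∈ C, P.pairing t j ≠ 0 ∧ P.root t' = P.root t - P.root j) ∧ (B : Set ι) = {t, t'})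

/-- The blocks `L = [B₁, …, B_N]` are obtained from the symbol `s = [a₁^{X₁}, …, a_N^{X_N}]` and the
parabolic subsystem `Γ = Γ₀` by the cascade construction: `B_i` sums to `[a_i^{X_i}]` in a component
of type `X_i` of `Γ_{i-1}`, and `Γ_i` is spanned by the simple roots of this component that are
orthogonal to `B_i`. -/
inductive IsCascade [P.IsCrystallographic] : Set ι → List (Finset ι) → Symbol → Prop
  | nil {Γ : Set ι} : IsCascade Γ [] []
  | cons {Γ C : Set ι} {a : Mark} {X : DynkinType} {B : Finset ι} {L : List (Finset ι)}
      {s : Symbol} :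
      IsComponent P Γ C → HasType P C X → IsDominantBlock P C X a B →
      IsCascade (orthogonalNodes P C B) L s →
      IsCascade Γ (B :: L) ((a, X) :: s)

/-! ### Diagram automorphisms -/

/-- Some automorphism `τ` of the Dynkin diagram maps `l` to `m`, acting by `α_i ↦ α_{τ i}`. -/
def DiagramConjugate {P : RootPairing ι ℝ V N} [P.IsCrystallographic] (b : P.Base)
    (l m : V) : Prop :=
  ∃ τ : Equiv.Perm b.support, (∀ i j, b.cartanMatrix (τ i) (τ j) = b.cartanMatrix i j) ∧
    ∃ f : V ≃ₗ[ℝ] V, (∀ i : b.support, f (P.root i) = P.root (τ i)) ∧ f l = m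

end RootSystem

end SmallWeights

end

/-!
# Small dominant weights and the cascade construction

Two elementary estimates carry the whole classification. The first concerns smallness. A weight of
the root lattice which pairs to at most `3` with all coroots is small, because the pairing with
`α^∨` is bounded on the convex hull of the orbit and takes the value `4` at `2α`
(`isSmall_of_coroot_le`). Conversely, let `t` be a root orthogonal to all simple roots but one.
Averaging a weight over the stabilizer of `t` projects it to the line spanned by `t`, hence a weight
pairing to `4` or more with `t^∨` has `2t` in the hull of its orbit, and is not small
(`not_isSmall_of_four_le`, `IsSmall.coroot_le_three`). Such a root exists unless the type is `A_n`
with `n ≥ 2`, and the single inequality it gives, together with dominance and membership in the root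
lattice, leaves a short list of candidates.

The second estimate is a lower bound for the number of roots in an expression, by a linear
functional which is bounded on roots (`hasLength_of_functional`). If the bound is attained, all
roots in all minimal expressions attain it too, which determines them almost completely. This is
what the criteria `isCanonical_snoc_singleton_iff` and `isCanonical_snoc_pair_iff` need: if a block
`B` is orthogonal to `λ - B`, if the lengths of `B` and `λ - B` add up, and if all other roots in
minimal expressions of `λ` which could form a block are higher than `B`, then the canonical block
decompositions of `λ` are those of `λ - B` followed by `B`. So existence and uniqueness follow by
induction.

Symbols are unique because diagrams of different types are not isomorphic: a type is determined by
its rank and a few features of the diagram (`IsSymbol.unique`). Moreover a cascade, in which every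
block is built from a dominant root of the current component, determines the symbol. Hence it
suffices to exhibit a family of weights with a unique canonical block decomposition which is a
cascade, to show that every small dominant weight belongs to the family up to a renumbering of the
diagram, and to compare the symbols (`classification_of_family`).

For the exceptional types, the roots are encoded as numbers and the conditions become finitely many
integer identities and inequalities (`classification_of_certificate`). For `B_n`, `C_n` and `D_n`
the usual coordinates are available (`classification_of_coord`). There the small dominant weights
are `e_0 + ⋯ + e_m` and, in types `C` and `D`, `2 e_0 + e_1 + ⋯ + e_m`, subject to the parity
condition of the root lattice and up to the sign of the last coordinate in type `D`. The length is
half of the sum of the coordinates, rounded up, except for `2 e_0` in type `D`, where the first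
coordinate gives the length. Rounding occurs only in type `B`; then the bound is not attained, and
it suffices that the roots of a minimal expression of `λ` have coroots pairing to at least `2` with
`λ`. Two weights of the family have the same symbol in one case only: in `D_4` the weights `2 e_0`
and `e_0 + e_1 + e_2 + e_3`, which triality exchanges.
-/

namespace SmallWeights

variable {ι V N : Type*} [AddCommGroup V] [Module ℝ V] [AddCommGroup N] [Module ℝ N]
  {P : RootPairing ι ℝ V N}

/-! ### Small weights and pairings with coroots -/

/-- A weight of the root lattice all of whose pairings with coroots are at most `3` is small: this
bound is preserved by the Weyl group and by convex combinations, while `2α` pairs to `4` with the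
coroot of `α`. -/
theorem isSmall_of_coroot_le {l : V} (hl : l ∈ P.rootSpan ℤ) (h : ∀ i, P.coroot' i l ≤ 3) :
    IsSmall P l := by
  refine ⟨hl, fun i hi => ?_⟩
  have hconv : Convex ℝ {x : V | ∀ i, P.coroot' i x ≤ 3} := by
    intro x hx y hy a b ha hb hab i
    have := mul_le_mul_of_nonneg_left (hx i) ha
    have := mul_le_mul_of_nonneg_left (hy i) hb
    simp only [map_add, map_smul, smul_eq_mul]
    linarith [show a * 3 + b * 3 = 3 by rw [← add_mul, hab, one_mul]]
  have hinv : ∀ g : P.Aut, g ∈ P.weylGroup → ∀ x : V, (∀ i, P.coroot' i x ≤ 3) →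
      ∀ i, P.coroot' i (g • x) ≤ 3 := by
    intro g hg
    induction hg using RootPairing.weylGroup.induction with
    | mem j =>
      intro x hx i
      rw [RootPairing.Equiv.reflection_smul, RootPairing.coroot'_reflection]
      exact hx _
    | one => intro x hx i; simpa using hx i
    | mul g₁ g₂ _ _ h₁ h₂ =>
      intro x hx i
      rw [mul_smul]
      exact h₁ _ (h₂ x hx) i
  have hsub : MulAction.orbit P.weylGroup l ⊆ {x : V | ∀ i, P.coroot' i x ≤ 3} := by
    rintro _ ⟨g, rfl⟩
    exact hinv g g.2 l h
  have := convexHull_min hsub hconv hi i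
  rw [map_smul, RootPairing.root_coroot'_eq_pairing, RootPairing.pairing_same] at this
  norm_num at this

/-- The Weyl group acts faithfully on the finitely many roots, as these span `V`. -/
instance finite_weylGroup [Finite ι] [P.IsRootSystem] : Finite P.weylGroup := by
  refine Finite.of_injective (fun g : P.weylGroup => P.weylGroupToPerm g) fun g h hgh => ?_
  apply Subtype.ext
  apply RootPairing.Equiv.weightHom_injective P
  have key : ∀ x : V, g • x = h • x := by
    intro x
    have hx : x ∈ P.rootSpan ℝ := by
      rw [RootPairing.rootSpan, RootPairing.IsRootSystem.span_root_eq_top]; trivial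
    induction hx using Submodule.span_induction with
    | mem x hx =>
      obtain ⟨i, rfl⟩ := hx
      simp only at hgh
      rw [RootPairing.weylGroup_apply_root, RootPairing.weylGroup_apply_root, hgh]
    | zero => simp
    | add x y _ _ hx hy => rw [smul_add, smul_add, hx, hy]
    | smul a x _ hx =>
      change (RootPairing.Equiv.weightEquiv P P g.1) (a • x) =
        (RootPairing.Equiv.weightEquiv P P h.1) (a • x)
      rw [map_smul, map_smul]
      exact congrArg (a • ·) hx
  ext x
  exact key x

/-- `(α, α) (x, α^∨) = 2 (α, x)` for the invariant form. -/
theorem rootForm_self_mul_coroot [Fintype ι] (i : ι) (x : V) :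
    P.RootForm (P.root i) (P.root i) * P.coroot' i x = 2 * P.RootForm (P.root i) x := by
  have h := congrArg (fun z => P.toLinearMap x z) (P.rootForm_self_smul_coroot i)
  simp only [map_smul, map_nsmul, smul_eq_mul, nsmul_eq_mul, Nat.cast_ofNat] at h
  rw [RootPairing.toLinearMap_apply_apply_Polarization] at h
  exact h

theorem rootForm_self_pos [Fintype ι] [P.IsRootSystem] (i : ι) :
    0 < P.RootForm (P.root i) (P.root i) :=
  P.rootForm_pos_of_ne_zero (Submodule.subset_span ⟨i, rfl⟩) (P.ne_zero i)

theorem eq_of_forall_coroot_eq [P.IsRootSystem] (b : P.Base) {x y : V}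
    (h : ∀ j ∈ b.support, P.coroot' j x = P.coroot' j y) : x = y := by
  rw [← sub_eq_zero, P.eq_zero_iff_forall_coroot'_eq_zero]
  intro i
  have hi := b.coroot_mem_span_int i
  have : ∀ z ∈ Submodule.span ℤ (P.coroot '' b.support), P.toLinearMap (x - y) z = 0 := by
    intro z hz
    induction hz using Submodule.span_induction with
    | mem z hz =>
      obtain ⟨j, hj, rfl⟩ := hz
      have := h j hj
      rw [map_sub, LinearMap.sub_apply]
      exact sub_eq_zero.2 this
    | zero => simp
    | add u v _ _ hu hv => rw [map_add, hu, hv, add_zero]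
    | smul a u _ hu => rw [map_zsmul, hu, smul_zero]
  exact this _ hi

/-- If the root `t` is a multiple of a fundamental weight, then a weight `l` with `(l, t^∨) ≥ 4` is
not small: averaging the orbit of `l` over the stabilizer of `t` projects `l` onto the line through
`t`, since this stabilizer contains the reflections in all simple roots but one, and the projection
is `c t` with `c ≥ 2`. -/
theorem not_isSmall_of_four_le [Fintype ι] [P.IsRootSystem] (b : P.Base) {t j₀ : ι}
    (hj₀ : ∀ j ∈ b.support, j ≠ j₀ → P.pairing t j = 0) {l : V} (h : 4 ≤ P.coroot' t l) :
    ¬ IsSmall P l := by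
  classical
  rintro ⟨-, hs⟩
  apply hs t
  set H := convexHull ℝ (MulAction.orbit P.weylGroup l)
  let G := MulAction.stabilizer P.weylGroup (P.root t)
  have : Fintype G := Fintype.ofFinite _
  have hadd : ∀ (g : P.weylGroup) (x y : V), g • (x + y) = g • x + g • y :=
    fun g x y => smul_add g x y
  -- `S / |G|` is the average of the orbit of `l` under the stabilizer `G` of `t`.
  set S : V := ∑ g : G, (g : P.weylGroup) • l with hS
  have hcard : (0 : ℝ) < Fintype.card G := by exact_mod_cast Fintype.card_pos
  set y : V := (Fintype.card G : ℝ)⁻¹ • S with hy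
  have hform : ∀ g : G, P.coroot' t ((g : P.weylGroup) • l) = P.coroot' t l := by
    intro g
    have h1 := rootForm_self_mul_coroot (P := P) t ((g : P.weylGroup) • l)
    have h2 := rootForm_self_mul_coroot (P := P) t l
    have h3 : P.RootForm (P.root t) ((g : P.weylGroup) • l) = P.RootForm (P.root t) l := by
      have hg : (g : P.weylGroup) • P.root t = P.root t := g.2
      conv_lhs => rw [← hg]
      exact RootPairing.InvariantForm.apply_weylGroup_smul P (B := P.toInvariantForm) _ _ _
    rw [h3, ← h2] at h1
    exact mul_left_cancel₀ (rootForm_self_pos t).ne' h1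
  have hSinv : ∀ g : G, (g : P.weylGroup) • S = S := by
    intro g
    rw [hS, Finset.smul_sum]
    refine Fintype.sum_equiv (Equiv.mulLeft g) _ _ fun x => ?_
    simp [mul_smul]
  have hyt : P.coroot' t y = P.coroot' t l := by
    rw [hy, map_smul, hS, map_sum, Finset.sum_congr rfl fun g _ => hform g]
    simp [hcard.ne']
  have hyH : y ∈ H := by
    rw [hy, hS, Finset.smul_sum]
    refine (convex_convexHull ℝ _).sum_mem (fun _ _ => by positivity) (by simp [hcard.ne'])
      fun g _ => subset_convexHull ℝ _ ⟨_, rfl⟩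
  have hyj : ∀ j ∈ b.support, j ≠ j₀ → P.coroot' j y = 0 := by
    intro j hj hne
    have hst : RootPairing.weylGroup.ofIdx P j • P.root t = P.root t := by
      rw [RootPairing.weylGroup.ofIdx_smul, RootPairing.Equiv.reflection_smul,
        RootPairing.reflection_apply, RootPairing.root_coroot'_eq_pairing, hj₀ j hj hne]
      simp
    have h1 := hSinv ⟨RootPairing.weylGroup.ofIdx P j, hst⟩
    simp only [RootPairing.weylGroup.ofIdx_smul, RootPairing.Equiv.reflection_smul,
        RootPairing.reflection_apply] at h1
    rw [sub_eq_self, smul_eq_zero] at h1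
    rw [hy, map_smul, h1.resolve_right (P.ne_zero j), smul_zero]
  have ht₀ : P.pairing t j₀ ≠ 0 := by
    intro h0
    apply P.ne_zero t
    apply eq_of_forall_coroot_eq b
    intro j hj
    rw [RootPairing.root_coroot'_eq_pairing, map_zero]
    by_cases hne : j = j₀
    · rw [hne, h0]
    · exact hj₀ j hj hne
  -- Being orthogonal to the same simple roots, `y` and `t` are proportional.
  set c : ℝ := P.coroot' j₀ y / P.pairing t j₀ with hc
  have hyc : y = c • P.root t := by
    apply eq_of_forall_coroot_eq b
    intro j hj
    rw [map_smul (P.coroot' j) c, RootPairing.root_coroot'_eq_pairing, smul_eq_mul]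
    by_cases hne : j = j₀
    · rw [hne, hc, div_mul_cancel₀ _ ht₀]
    · rw [hj₀ j hj hne, hyj j hj hne, mul_zero]
  have hc2 : 2 ≤ c := by
    have := hyt
    rw [hyc, map_smul, RootPairing.root_coroot'_eq_pairing, RootPairing.pairing_same,
      smul_eq_mul] at this
    linarith
  have hinvH : ∀ x ∈ H, RootPairing.weylGroup.ofIdx P t • x ∈ H := by
    intro x hx
    have : H ⊆ (P.reflection t : V →ₗ[ℝ] V) ⁻¹' H := by
      refine convexHull_min ?_ ((convex_convexHull ℝ _).linear_preimage _)
      rintro _ ⟨g, rfl⟩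
      refine subset_convexHull ℝ _ ⟨RootPairing.weylGroup.ofIdx P t * g, ?_⟩
      simp [mul_smul]
    have := this hx
    simpa using this
  -- With `y = c t` and `-y` the hull contains all multiples `a t` with `|a| ≤ c`, in particular
  -- `2 t`.
  have hny : -y ∈ H := by
    have := hinvH y hyH
    rw [hyc] at this ⊢
    simp only [RootPairing.weylGroup.ofIdx_smul, RootPairing.Equiv.reflection_smul,
      map_smul, RootPairing.reflection_apply_self] at this
    simpa using this
  have := convex_convexHull ℝ (MulAction.orbit P.weylGroup l) hyH hny
    (a := (1 + 2 / c) / 2) (b := (1 - 2 / c) / 2) (by positivity)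
    (by
      have : 2 / c ≤ 1 := by rw [div_le_one (by linarith)]; exact hc2
      linarith) (by ring)
  have e : ((1 + 2 / c) / 2) • y + ((1 - 2 / c) / 2) • -y = (2 : ℝ) • P.root t := by
    have hc0 : c ≠ 0 := by linarith
    rw [hyc, smul_neg, ← sub_eq_add_neg, ← sub_smul, smul_smul]
    congr 1
    field_simp
    ring
  rwa [e] at this

/-- A small weight pairs to at most `3` with the coroot of a root which is a multiple of a
fundamental weight. -/
theorem IsSmall.coroot_le_three [Fintype ι] [P.IsRootSystem] [P.IsCrystallographic] (b : P.Base)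
    {t j₀ : ι} (hj₀ : ∀ j ∈ b.support, j ≠ j₀ → P.pairing t j = 0) {l : V} (h : IsSmall P l) :
    P.coroot' t l ≤ 3 := by
  by_contra hlt
  push Not at hlt
  refine not_isSmall_of_four_le b hj₀ ?_ h
  obtain ⟨z, hz⟩ := P.coroot'_apply_apply_mem_of_mem_span ℤ h.1 t
  simp only [algebraMap_int_eq, eq_intCast] at hz
  rw [← hz] at hlt ⊢
  have : (3 : ℤ) < z := by exact_mod_cast hlt
  exact_mod_cast this

end SmallWeights

namespace SmallWeights

variable {ι V N : Type*} [AddCommGroup V] [Module ℝ V] [AddCommGroup N] [Module ℝ N]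
  {P : RootPairing ι ℝ V N}

/-! ### Minimal expressions -/

theorem IsExpression.map_sum {l : V} {e : Multiset ι} (he : IsExpression P l e) (f : V →ₗ[ℝ] ℝ) :
    f l = (e.map fun i => f (P.root i)).sum := by
  rw [← he, map_multiset_sum, Multiset.map_map]
  rfl

theorem IsExpression.coroot_eq_sum {l : V} {e : Multiset ι} (he : IsExpression P l e) (i : ι) :
    P.coroot' i l = (e.map fun j => P.pairing j i).sum := by
  simp [he.map_sum (P.coroot' i)]

section

variable [Finite ι] [P.IsCrystallographic]

/-- Two roots with negative pairing sum to a root or to zero, so an expression containing both can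
be shortened. -/
theorem IsMinimalExpression.pairing_nonneg_of_cons {l : V} {e : Multiset ι} {i j : ι}
    (he : IsMinimalExpression P l (i ::ₘ j ::ₘ e)) : 0 ≤ P.pairing i j := by
  by_contra hlt
  push Not at hlt
  have hsum : P.root i + (P.root j + (e.map P.root).sum) = l := by
    simpa [IsExpression] using he.1
  have h' : P.pairingIn ℤ i j < 0 := by
    rw [← P.algebraMap_pairingIn ℤ] at hlt
    simpa using hlt
  by_cases hz : P.root i = -P.root j
  · have := he.2 e (by rw [IsExpression, ← hsum, hz]; abel)
    simp only [Multiset.card_cons] at this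
    omega
  · obtain ⟨k, hk⟩ := P.root_add_root_mem_of_pairingIn_neg h' hz
    have := he.2 (k ::ₘ e) (by
      rw [IsExpression, Multiset.map_cons, Multiset.sum_cons, ← hsum, hk]; abel)
    simp only [Multiset.card_cons] at this
    omega

theorem IsMinimalExpression.pairing_nonneg_of_mem_erase [DecidableEq ι] {l : V} {e : Multiset ι}
    {i j : ι} (he : IsMinimalExpression P l e) (hi : i ∈ e) (hj : j ∈ e.erase i) :
    0 ≤ P.pairing i j := by
  rw [← Multiset.cons_erase hi, ← Multiset.cons_erase hj] at he
  exact he.pairing_nonneg_of_cons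

theorem IsMinimalExpression.pairing_nonneg {l : V} {e : Multiset ι} {i j : ι}
    (he : IsMinimalExpression P l e) (hi : i ∈ e) (hj : j ∈ e) : 0 ≤ P.pairing i j := by
  classical
  by_cases h : i = j
  · rw [h, P.pairing_same]; norm_num
  · exact he.pairing_nonneg_of_mem_erase hi ((Multiset.mem_erase_of_ne (Ne.symm h)).2 hj)

/-- The terms of a minimal expression pair non-negatively with each other, and to `2` with
themselves. -/
theorem IsMinimalExpression.two_le_coroot {l : V} {e : Multiset ι} {i : ι}
    (he : IsMinimalExpression P l e) (hi : i ∈ e) : 2 ≤ P.coroot' i l := by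
  classical
  rw [he.1.coroot_eq_sum, ← Multiset.cons_erase hi, Multiset.map_cons, Multiset.sum_cons,
    P.pairing_same]
  have : 0 ≤ ((e.erase i).map fun j => P.pairing j i).sum := by
    apply Multiset.sum_nonneg
    intro x hx
    obtain ⟨j, hj, rfl⟩ := Multiset.mem_map.1 hx
    exact he.pairing_nonneg (Multiset.mem_of_mem_erase hj) hi
  linarith

theorem pairing_pos_comm {i j : ι} : 0 < P.pairing i j ↔ 0 < P.pairing j i := by
  have := P.zero_lt_pairingIn_iff' ℤ (i := i) (j := j)
  rw [← P.algebraMap_pairingIn ℤ i j, ← P.algebraMap_pairingIn ℤ j i]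
  simpa using this

end

/-- The number of terms of the minimal expressions of `l` is `k`. -/
def HasLength (P : RootPairing ι ℝ V N) (l : V) (k : ℕ) : Prop :=
  ∃ e, IsMinimalExpression P l e ∧ e.card = k

theorem HasLength.card_eq {l : V} {k : ℕ} (h : HasLength P l k) {e : Multiset ι}
    (he : IsMinimalExpression P l e) : e.card = k := by
  obtain ⟨e', he', rfl⟩ := h
  exact le_antisymm (he.2 _ he'.1) (he'.2 _ he.1)

theorem hasLength_zero : HasLength P 0 0 := ⟨0, ⟨by simp [IsExpression], by simp⟩, rfl⟩

theorem IsExpression.apply_le {l : V} {e : Multiset ι} (he : IsExpression P l e)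
    {f : V →ₗ[ℝ] ℝ} {c : ℝ} (hf : ∀ i, f (P.root i) ≤ c) : f l ≤ e.card * c := by
  rw [he.map_sum f, ← nsmul_eq_mul]
  refine (Multiset.sum_le_card_nsmul _ c ?_).trans (by simp)
  intro x hx
  obtain ⟨j, _, rfl⟩ := Multiset.mem_map.1 hx
  exact hf j

/-- A linear functional bounded by `c` on roots bounds the length of a weight from below. -/
theorem hasLength_of_functional {l : V} {e : Multiset ι} (he : IsExpression P l e)
    (f : V →ₗ[ℝ] ℝ) {c : ℝ} (hc : 0 ≤ c) (hf : ∀ i, f (P.root i) ≤ c)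
    (hl : (e.card - 1) * c < f l) : HasLength P l e.card := by
  refine ⟨e, ⟨he, fun e' he' => ?_⟩, rfl⟩
  by_contra hlt
  push Not at hlt
  have h1 := he'.apply_le hf
  have h2 : (e'.card : ℝ) ≤ e.card - 1 := by
    have : (e'.card : ℝ) + 1 ≤ e.card := by exact_mod_cast hlt
    linarith
  have := mul_le_mul_of_nonneg_right h2 hc
  linarith

/-- If the bound of `IsExpression.apply_le` is attained, every term attains it. -/
theorem IsExpression.apply_eq_of_mem {l : V} {e : Multiset ι} (he : IsExpression P l e)
    {f : V →ₗ[ℝ] ℝ} {c : ℝ} (hf : ∀ i, f (P.root i) ≤ c) (hl : f l = e.card * c) {i : ι}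
    (hi : i ∈ e) : f (P.root i) = c := by
  classical
  refine le_antisymm (hf i) ?_
  have h := he.map_sum f
  rw [← Multiset.cons_erase hi, Multiset.map_cons, Multiset.sum_cons] at h
  have h2 : ((e.erase i).map fun i => f (P.root i)).sum ≤ (e.erase i).card * c := by
    rw [← nsmul_eq_mul]
    refine (Multiset.sum_le_card_nsmul _ c ?_).trans (by simp)
    intro x hx
    obtain ⟨j, _, rfl⟩ := Multiset.mem_map.1 hx
    exact hf j
  have h3 : (e.card : ℝ) = (e.erase i).card + 1 := by
    rw [Multiset.card_erase_of_mem hi]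
    have : 0 < e.card := Multiset.card_pos_iff_exists_mem.2 ⟨i, hi⟩
    exact_mod_cast (Nat.succ_pred_eq_of_pos this).symm
  rw [h3] at hl
  linarith

/-! ### Canonical block decompositions -/

variable {b : P.Base}

theorem blockSum_eq (B : Finset ι) : (B.val.map P.root).sum = blockSum P B := rfl

theorem isCanonical_zero_iff (M : List (Finset ι)) : IsCanonical b 0 M ↔ M = [] := by
  constructor
  · intro h
    generalize hl : (0 : V) = l at h
    cases h with
    | zero => rfl
    | @snoc _ L B hd _ _ =>
      subst hl
      obtain ⟨e, he, -, hB⟩ := hd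
      obtain ⟨i, hi, -⟩ := (hB B).1 (by simp)
      have := he.2 0 (by simp [IsExpression])
      simp only [Multiset.card_zero, Nat.le_zero, Multiset.card_eq_zero] at this
      simp [this] at hi
  · rintro rfl
    exact .zero

theorem IsCanonical.eq_sum {l : V} {L : List (Finset ι)} (h : IsCanonical b l L) :
    l = (L.map (blockSum P)).sum := by
  induction h with
  | zero => simp
  | snoc _ _ _ ih =>
    rw [List.map_append, List.sum_append, ← ih]
    simp

theorem IsCanonical.isBlockDecomposition {l : V} {L : List (Finset ι)} (h : IsCanonical b l L) :
    IsBlockDecomposition P l L := by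
  cases h with
  | zero => exact ⟨0, ⟨by simp [IsExpression], by simp⟩, by simp, by simp [IsBlockOf]⟩
  | snoc hd _ _ => exact hd

theorem IsBlockOf.sub {e : Multiset ι} {B : Finset ι} (h : IsBlockOf P e B) {i : ι} (hi : i ∈ B) :
    i ∈ e := by
  obtain ⟨_, _, h⟩ := h
  exact ((h i).1 hi).1

/-- The height condition of `isCanonical_snoc_iff` for a block with one root. -/
theorem eq_or_blockHeight_lt_of_singleton {l : V} {i₀ : ι} (h₀ : 0 < b.height i₀)
    (h : ∀ e, IsMinimalExpression P l e → ∀ i ∈ e, i = i₀ ∨ b.height i₀ < b.height i)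
    (B : Finset ι) (hB : IsBlock P l B) : B = {i₀} ∨ blockHeight b {i₀} < blockHeight b B := by
  classical
  obtain ⟨e, he, hBe⟩ := hB
  have hpos : ∀ i ∈ B, 0 < b.height i := by
    intro i hi
    rcases h e he i (hBe.sub hi) with rfl | h
    · exact h₀
    · omega
  by_cases hs : ∀ i ∈ B, i = i₀
  · left
    obtain ⟨i, hi, hB⟩ := hBe
    have hiB : i ∈ B := (hB i).2 ⟨hi, by rw [P.pairing_same]; norm_num⟩
    exact Finset.eq_singleton_iff_unique_mem.2 ⟨hs i hiB ▸ hiB, hs⟩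
  · right
    push Not at hs
    obtain ⟨i, hi, hne⟩ := hs
    have h1 := (h e he i (hBe.sub hi)).resolve_left hne
    have h2 : b.height i ≤ blockHeight b B :=
      Finset.single_le_sum (f := fun i => b.height i) (fun j hj => (hpos j hj).le) hi
    simp only [blockHeight, Finset.sum_singleton] at h2 ⊢
    omega

variable [Finite ι] [P.IsCrystallographic]

/-- The inductive step in the determination of canonical block decompositions. If removing the set
`B` of roots from `l` lowers the length by `|B|` and leaves a weight orthogonal to `B`, then a
minimal expression of `l` is obtained by adjoining the block `B` to any minimal expression of the
rest; if moreover the height of `B` is smaller than that of all other `l`-blocks, then `B` has to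
be the last block of a canonical block decomposition. -/
theorem isCanonical_snoc_iff {l : V} {B : Finset ι} {k : ℕ} {L : List (Finset ι)}
    (hB : B.Nonempty) (hpos : ∀ i ∈ B, ∀ j ∈ B, 0 < P.pairing i j)
    (horth : ∀ i ∈ B, P.coroot' i (l - blockSum P B) = 0)
    (hk : HasLength P (l - blockSum P B) k) (hl : HasLength P l (k + B.card))
    (hmin : ∀ B', IsBlock P l B' → B' = B ∨ blockHeight b B < blockHeight b B')
    (hL : ∀ M, IsCanonical b (l - blockSum P B) M ↔ M = L) (M : List (Finset ι)) :
    IsCanonical b l M ↔ M = L ++ [B] := by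
  obtain ⟨e', he', hnd, hbl⟩ := ((hL L).2 rfl).isBlockDecomposition
  have he : IsMinimalExpression P l (B.val + e') := by
    refine ⟨?_, fun f hf => ?_⟩
    · rw [IsExpression, Multiset.map_add, Multiset.sum_add, blockSum_eq, he'.1]
      abel
    · obtain ⟨e₀, he₀, hc⟩ := hl
      have := he₀.2 f hf
      rw [Multiset.card_add, hk.card_eq he', Finset.card_val]
      omega
  -- The pairings of the roots of `B` with those of `e'` are non-negative and sum to zero.
  have hzero : ∀ i ∈ B, ∀ j ∈ e', P.pairing j i = 0 := by
    intro i hi j hj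
    have h0 := horth i hi
    rw [he'.1.coroot_eq_sum] at h0
    have hnn : ∀ j ∈ e', 0 ≤ P.pairing j i := fun j hj =>
      he.pairing_nonneg (Multiset.mem_add.2 (.inr hj)) (Multiset.mem_add.2 (.inl hi))
    have := Multiset.all_zero_of_le_zero_le_of_sum_eq_zero
      (s := e'.map fun j => P.pairing j i) (by
        intro x hx
        obtain ⟨j, hj, rfl⟩ := Multiset.mem_map.1 hx
        exact hnn j hj) h0 (P.pairing j i) (Multiset.mem_map.2 ⟨j, hj, rfl⟩)
    exact this
  have hzero' : ∀ i ∈ B, ∀ j ∈ e', P.pairing i j = 0 := fun i hi j hj =>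
    P.pairing_eq_zero_iff.1 (hzero i hi j hj)
  -- Hence the blocks of the enlarged expression are `B` and the blocks of `e'`.
  have hblocks : ∀ B', IsBlockOf P (B.val + e') B' ↔ B' = B ∨ IsBlockOf P e' B' := by
    have hmem : ∀ i, i ∈ B.val + e' ↔ i ∈ B ∨ i ∈ e' := fun i => Multiset.mem_add
    intro B'
    constructor
    · rintro ⟨i, hi, h⟩
      rcases (hmem i).1 hi with hi | hi
      · left
        ext j
        rw [h, hmem]
        constructor
        · rintro ⟨hj | hj, hp⟩
          · exact hj
          · rw [hzero i hi j hj] at hp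
            exact absurd hp (lt_irrefl _)
        · exact fun hj => ⟨.inl hj, hpos j hj i hi⟩
      · right
        refine ⟨i, hi, fun j => ?_⟩
        rw [h, hmem]
        constructor
        · rintro ⟨hj | hj, hp⟩
          · rw [hzero' j hj i hi] at hp
            exact absurd hp (lt_irrefl _)
          · exact ⟨hj, hp⟩
        · exact fun hj => ⟨.inr hj.1, hj.2⟩
    · rintro (rfl | ⟨i, hi, h⟩)
      · obtain ⟨i, hi⟩ := hB
        refine ⟨i, (hmem i).2 (.inl hi), fun j => ?_⟩
        rw [hmem]
        constructor
        · exact fun hj => ⟨.inl hj, hpos j hj i hi⟩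
        · rintro ⟨hj | hj, hp⟩
          · exact hj
          · rw [hzero i hi j hj] at hp
            exact absurd hp (lt_irrefl _)
      · refine ⟨i, (hmem i).2 (.inr hi), fun j => ?_⟩
        rw [h, hmem]
        constructor
        · exact fun hj => ⟨.inr hj.1, hj.2⟩
        · rintro ⟨hj | hj, hp⟩
          · rw [hzero' j hj i hi] at hp
            exact absurd hp (lt_irrefl _)
          · exact ⟨hj, hp⟩
  have hBL : B ∉ L := by
    intro h
    obtain ⟨i, hi⟩ := hB
    have := hzero i hi i (((hbl B).1 h).sub hi)
    rw [P.pairing_same] at this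
    norm_num at this
  have hblock : IsBlock P l B := ⟨_, he, (hblocks B).2 (.inl rfl)⟩
  have hle : ∀ B', IsBlock P l B' → blockHeight b B ≤ blockHeight b B' := by
    intro B' hB'
    rcases hmin B' hB' with rfl | h
    · exact le_rfl
    · exact h.le
  constructor
  · intro h
    cases h with
    | zero =>
      have h0 := hl.card_eq (e := 0) ⟨by simp [IsExpression], by simp⟩
      have := Finset.card_pos.2 hB
      simp only [Multiset.card_zero] at h0
      omega
    | @snoc _ L₁ B₁ hd hm hc =>
      have hb₁ : IsBlock P l B₁ := by
        obtain ⟨e, he, -, h⟩ := hd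
        exact ⟨e, he, (h B₁).1 (by simp)⟩
      have : B₁ = B := (hmin B₁ hb₁).resolve_right (not_lt.2 (hm B hblock))
      subst this
      rw [(hL L₁).1 hc]
  · rintro rfl
    refine .snoc ⟨_, he, ?_, fun B' => ?_⟩ hle ((hL L).2 rfl)
    · rw [List.nodup_append]
      refine ⟨hnd, by simp, ?_⟩
      rintro a ha c hc rfl
      rw [List.mem_singleton] at hc
      exact hBL (hc ▸ ha)
    · rw [hblocks, List.mem_append, List.mem_singleton, hbl, or_comm]

/-- The height condition of `isCanonical_snoc_iff` for a block `{i₁, i₂}`. As each term of a minimal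
expression pairs to `3` with `l`, every block has at least two roots. -/
theorem eq_or_blockHeight_lt_of_pair [DecidableEq ι] {l : V} {i₁ i₂ : ι} (hne : i₁ ≠ i₂)
    (h₁ : 0 < b.height i₁) (h₁₂ : b.height i₁ ≤ b.height i₂)
    (h : ∀ e, IsMinimalExpression P l e → ∀ i ∈ e, P.coroot' i l = 3 ∧
      (i = i₁ ∨ i = i₂ ∨ b.height i₂ < b.height i))
    (B : Finset ι) (hB : IsBlock P l B) :
    B = {i₁, i₂} ∨ blockHeight b {i₁, i₂} < blockHeight b B := by
  obtain ⟨e, he, hBe⟩ := hB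
  have hpos : ∀ i ∈ B, 0 < b.height i := by
    intro i hi
    rcases (h e he i (hBe.sub hi)).2 with rfl | rfl | h <;> omega
  -- A root `i` of the block contributes `2` to its pairing `3` with `l`, so that some other root of
  -- the expression contributes `1`.
  obtain ⟨i, hi, j, hj, hij⟩ : ∃ i ∈ B, ∃ j ∈ B, i ≠ j := by
    obtain ⟨i, hi, hB⟩ := hBe
    have h3 := (h e he i hi).1
    rw [he.1.coroot_eq_sum, ← Multiset.cons_erase hi, Multiset.map_cons, Multiset.sum_cons,
      P.pairing_same] at h3
    have h1 : ((e.erase i).map fun j => P.pairing j i).sum = 1 := by linarith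
    have hnn : ∀ x ∈ (e.erase i).map fun j => P.pairing j i, 0 ≤ x := by
      intro x hx
      obtain ⟨j, hj, rfl⟩ := Multiset.mem_map.1 hx
      exact he.pairing_nonneg (Multiset.mem_of_mem_erase hj) hi
    obtain ⟨j, hj, hjp⟩ : ∃ j ∈ e.erase i, 0 < P.pairing j i := by
      by_contra! hcon
      have : ((e.erase i).map fun j => P.pairing j i).sum ≤ 0 := by
        refine (Multiset.sum_le_card_nsmul _ 0 ?_).trans (by simp)
        intro x hx
        obtain ⟨j, hj, rfl⟩ := Multiset.mem_map.1 hx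
        exact hcon j hj
      linarith
    refine ⟨i, (hB i).2 ⟨hi, by rw [P.pairing_same]; norm_num⟩, j,
      (hB j).2 ⟨Multiset.mem_of_mem_erase hj, hjp⟩, ?_⟩
    rintro rfl
    have : P.pairing i i ≤ 1 := by
      rw [← h1]
      exact Multiset.single_le_sum hnn _ (Multiset.mem_map.2 ⟨i, hj, rfl⟩)
    rw [P.pairing_same] at this
    norm_num at this
  by_cases hs : ∀ i ∈ B, i = i₁ ∨ i = i₂
  · left
    ext x
    simp only [Finset.mem_insert, Finset.mem_singleton]
    refine ⟨hs x, ?_⟩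
    rcases hs i hi with rfl | rfl <;> rcases hs j hj with rfl | rfl
    · exact absurd rfl hij
    · rintro (rfl | rfl) <;> assumption
    · rintro (rfl | rfl) <;> assumption
    · exact absurd rfl hij
  · right
    push Not at hs
    obtain ⟨x, hx, hx₁, hx₂⟩ := hs
    obtain ⟨y, hy, hxy⟩ : ∃ y ∈ B, x ≠ y := by
      by_cases hxi : x = i
      · exact ⟨j, hj, hxi ▸ hij⟩
      · exact ⟨i, hi, hxi⟩
    have h2 : b.height x + b.height y ≤ blockHeight b B := by
      rw [← Finset.sum_pair (f := fun i => b.height i) hxy]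
      refine Finset.sum_le_sum_of_subset_of_nonneg ?_ fun j hj _ => (hpos j hj).le
      simp [Finset.insert_subset_iff, hx, hy]
    have hxe := ((h e he x (hBe.sub hx)).2.resolve_left hx₁).resolve_left hx₂
    have hye := (h e he y (hBe.sub hy)).2
    have : blockHeight b {i₁, i₂} = b.height i₁ + b.height i₂ :=
      Finset.sum_pair (f := fun i => b.height i) hne
    rw [this]
    rcases hye with rfl | rfl | hye <;> omega

end SmallWeights

namespace SmallWeights

/-! ### Connectedness and isomorphisms of Dynkin diagrams -/

namespace DynkinType

/-- Equality of entries is decidable also where the size of the matrix is not a literal. -/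
instance decidableEntryEq {n : ℕ} (M : Matrix (Fin n) (Fin n) ℤ) (i j : Fin n) (z : ℤ) :
    Decidable (M i j = z) :=
  Int.instDecidableEq (M i j) z

/-- A diagram is connected as soon as every node but one (`root`) has a neighbour which is closer to
it, the distance being measured by `depth`. -/
theorem eq_univ_of_parent {n : ℕ} {M : Matrix (Fin n) (Fin n) ℤ} (root : Fin n)
    (depth : Fin n → ℕ)
    (h : ∀ i, i ≠ root → ∃ j, depth j < depth i ∧ M i j ≠ 0 ∧ M j i ≠ 0) (T : Set (Fin n))
    (hT : T.Nonempty) (hc : ∀ i ∈ T, ∀ j ∉ T, M i j = 0) : T = Set.univ := by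
  have hdown : ∀ m, ∀ i ∈ T, depth i = m → root ∈ T := by
    intro m
    induction m using Nat.strong_induction_on with
    | _ m ih =>
      intro i hi hm
      by_cases hir : i = root
      · exact hir ▸ hi
      · obtain ⟨j, hj, hij, -⟩ := h i hir
        have hjT : j ∈ T := by
          by_contra hjT
          exact hij (hc i hi j hjT)
        exact ih _ (hm ▸ hj) j hjT rfl
  obtain ⟨i, hi⟩ := hT
  have hr := hdown _ i hi rfl
  have hup : ∀ m, ∀ i, depth i = m → i ∈ T := by
    intro m
    induction m using Nat.strong_induction_on with
    | _ m ih =>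
      intro i hm
      by_cases hir : i = root
      · exact hir ▸ hr
      · obtain ⟨j, hj, -, hji⟩ := h i hir
        by_contra hiT
        exact hji (hc j (ih _ (hm ▸ hj) j rfl) i hiT)
  exact Set.eq_univ_of_forall fun i => hup _ i rfl

/-- The diagrams of the proper Dynkin types are connected. -/
theorem connected {X : DynkinType} (hX : X.IsProper) (T : Set (Fin X.rank)) (hT : T.Nonempty)
    (hc : ∀ i ∈ T, ∀ j ∉ T, X.cartan i j = 0) : T = Set.univ := by
  match X, hX with
  | A n, hX =>
    refine eq_univ_of_parent (n := n) (M := CartanMatrix.A n) ⟨0, hX⟩ (fun i => i) ?_ T hT hc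
    intro i hi
    have hi0 : (i : ℕ) ≠ 0 := fun h => hi (Fin.ext h)
    refine ⟨⟨i - 1, by omega⟩, by simp; omega, ?_, ?_⟩ <;>
    · simp only [CartanMatrix.A, Matrix.of_apply, Fin.ext_iff]
      split_ifs <;> omega
  | B n, hX =>
    have hn : 2 ≤ n := hX
    refine eq_univ_of_parent (n := n) (M := CartanMatrix.B n) ⟨0, by omega⟩ (fun i => i) ?_ T hT hc
    intro i hi
    have hi0 : (i : ℕ) ≠ 0 := fun h => hi (Fin.ext h)
    refine ⟨⟨i - 1, by omega⟩, by simp; omega, ?_, ?_⟩ <;>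
    · simp only [CartanMatrix.B, Matrix.of_apply, Fin.ext_iff]
      split_ifs <;> omega
  | C n, hX =>
    have hn : 3 ≤ n := hX
    refine eq_univ_of_parent (n := n) (M := CartanMatrix.C n) ⟨0, by omega⟩ (fun i => i) ?_ T hT hc
    intro i hi
    have hi0 : (i : ℕ) ≠ 0 := fun h => hi (Fin.ext h)
    refine ⟨⟨i - 1, by omega⟩, by simp; omega, ?_, ?_⟩ <;>
    · simp only [CartanMatrix.C, Matrix.of_apply, Fin.ext_iff]
      split_ifs <;> omega
  | D n, hX =>
    have hn : 4 ≤ n := hX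
    refine eq_univ_of_parent (n := n) (M := CartanMatrix.D n) ⟨0, by omega⟩ (fun i => i) ?_ T hT hc
    intro i hi
    have hi0 : (i : ℕ) ≠ 0 := fun h => hi (Fin.ext h)
    refine ⟨⟨if (i : ℕ) + 1 = n then i - 2 else i - 1, by split_ifs <;> omega⟩, ?_, ?_, ?_⟩
    · simp only; split_ifs <;> omega
    all_goals
      simp only [CartanMatrix.D, Matrix.of_apply, Fin.ext_iff]
      split_ifs <;> omega
  | E6, _ =>
    have h : ∀ i : Fin 6, i ≠ 5 → ∃ j : Fin 6, 5 - (j : ℕ) < 5 - (i : ℕ) ∧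
        CartanMatrix.E₆ i j ≠ 0 ∧ CartanMatrix.E₆ j i ≠ 0 := by decide
    exact eq_univ_of_parent _ (fun i => 5 - i) h T hT hc
  | E7, _ =>
    have h : ∀ i : Fin 7, i ≠ 6 → ∃ j : Fin 7, 6 - (j : ℕ) < 6 - (i : ℕ) ∧
        CartanMatrix.E₇ i j ≠ 0 ∧ CartanMatrix.E₇ j i ≠ 0 := by decide
    exact eq_univ_of_parent _ (fun i => 6 - i) h T hT hc
  | E8, _ =>
    have h : ∀ i : Fin 8, i ≠ 7 → ∃ j : Fin 8, 7 - (j : ℕ) < 7 - (i : ℕ) ∧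
        CartanMatrix.E₈ i j ≠ 0 ∧ CartanMatrix.E₈ j i ≠ 0 := by decide
    exact eq_univ_of_parent _ (fun i => 7 - i) h T hT hc
  | F4, _ =>
    have h : ∀ i : Fin 4, i ≠ 3 → ∃ j : Fin 4, 3 - (j : ℕ) < 3 - (i : ℕ) ∧
        CartanMatrix.F₄ i j ≠ 0 ∧ CartanMatrix.F₄ j i ≠ 0 := by decide
    exact eq_univ_of_parent _ (fun i => 3 - i) h T hT hc
  | G2, _ =>
    have h : ∀ i : Fin 2, i ≠ 1 → ∃ j : Fin 2, 1 - (j : ℕ) < 1 - (i : ℕ) ∧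
        CartanMatrix.G₂ i j ≠ 0 ∧ CartanMatrix.G₂ j i ≠ 0 := by decide
    exact eq_univ_of_parent _ (fun i => 1 - i) h T hT hc

/-- A node is joined to two nodes by a double arrow ending at an end of the diagram: type `B`. -/
def EndShort {n : ℕ} (M : Matrix (Fin n) (Fin n) ℤ) : Prop :=
  ∃ i j, M i j = -2 ∧ ∀ k, k ≠ i → k ≠ j → M j k = 0

/-- The diagram has a double arrow. -/
def HasDouble {n : ℕ} (M : Matrix (Fin n) (Fin n) ℤ) : Prop := ∃ i j, M i j = -2

/-- The diagram has a double arrow which starts at an end of the diagram. -/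
def EndLong {n : ℕ} (M : Matrix (Fin n) (Fin n) ℤ) : Prop :=
  ∃ i j, M i j = -2 ∧ ∀ k, k ≠ i → k ≠ j → M i k = 0

/-- The diagram has a triple arrow. -/
def HasTriple {n : ℕ} (M : Matrix (Fin n) (Fin n) ℤ) : Prop := ∃ i j, M i j = -3

/-- The diagram has a node with three neighbours. -/
def HasBranch {n : ℕ} (M : Matrix (Fin n) (Fin n) ℤ) : Prop :=
  ∃ i j k l, i ≠ j ∧ i ≠ k ∧ i ≠ l ∧ j ≠ k ∧ j ≠ l ∧ k ≠ l ∧ M i j ≠ 0 ∧ M i k ≠ 0 ∧ M i l ≠ 0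

/-- Two ends of the diagram have a common neighbour, and this neighbour is not an end. -/
def HasFork {n : ℕ} (M : Matrix (Fin n) (Fin n) ℤ) : Prop :=
  ∃ i j k l, i ≠ j ∧ i ≠ k ∧ i ≠ l ∧ j ≠ k ∧ j ≠ l ∧ k ≠ l ∧ M i j ≠ 0 ∧ M i k ≠ 0 ∧ M i l ≠ 0 ∧
    (∀ m, m ≠ i → m ≠ j → M j m = 0) ∧ ∀ m, m ≠ i → m ≠ k → M k m = 0

section Invariance

variable {m n : ℕ} {M : Matrix (Fin m) (Fin m) ℤ} {M' : Matrix (Fin n) (Fin n) ℤ}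
  (e : Fin m ≃ Fin n)

theorem EndShort.of_equiv (he : ∀ i j, M i j = M' (e i) (e j)) (h : EndShort M) : EndShort M' := by
  obtain ⟨i, j, h₁, h₂⟩ := h
  refine ⟨e i, e j, he i j ▸ h₁, fun k hi hj => ?_⟩
  have := h₂ (e.symm k) (fun h => hi (by simp [← h])) (fun h => hj (by simp [← h]))
  rwa [he, e.apply_symm_apply] at this

theorem HasDouble.of_equiv (he : ∀ i j, M i j = M' (e i) (e j)) (h : HasDouble M) :
    HasDouble M' := by
  obtain ⟨i, j, h₁⟩ := h
  exact ⟨e i, e j, he i j ▸ h₁⟩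

theorem HasTriple.of_equiv (he : ∀ i j, M i j = M' (e i) (e j)) (h : HasTriple M) :
    HasTriple M' := by
  obtain ⟨i, j, h₁⟩ := h
  exact ⟨e i, e j, he i j ▸ h₁⟩

theorem EndLong.of_equiv (he : ∀ i j, M i j = M' (e i) (e j)) (h : EndLong M) : EndLong M' := by
  obtain ⟨i, j, h₁, h₂⟩ := h
  refine ⟨e i, e j, he i j ▸ h₁, fun k hi hj => ?_⟩
  have := h₂ (e.symm k) (fun h => hi (by simp [← h])) (fun h => hj (by simp [← h]))
  rwa [he, e.apply_symm_apply] at this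

theorem HasBranch.of_equiv (he : ∀ i j, M i j = M' (e i) (e j)) (h : HasBranch M) :
    HasBranch M' := by
  obtain ⟨i, j, k, l, h₁, h₂, h₃, h₄, h₅, h₆, h₇, h₈, h₉⟩ := h
  exact ⟨e i, e j, e k, e l, e.injective.ne h₁, e.injective.ne h₂, e.injective.ne h₃,
    e.injective.ne h₄, e.injective.ne h₅, e.injective.ne h₆, he _ _ ▸ h₇, he _ _ ▸ h₈,
    he _ _ ▸ h₉⟩

theorem HasFork.of_equiv (he : ∀ i j, M i j = M' (e i) (e j)) (h : HasFork M) : HasFork M' := by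
  obtain ⟨i, j, k, l, h₁, h₂, h₃, h₄, h₅, h₆, h₇, h₈, h₉, h₁₀, h₁₁⟩ := h
  refine ⟨e i, e j, e k, e l, e.injective.ne h₁, e.injective.ne h₂, e.injective.ne h₃,
    e.injective.ne h₄, e.injective.ne h₅, e.injective.ne h₆, he _ _ ▸ h₇, he _ _ ▸ h₈,
    he _ _ ▸ h₉, fun m hi hj => ?_, fun m hi hj => ?_⟩
  · have := h₁₀ (e.symm m) (fun h => hi (by simp [← h])) (fun h => hj (by simp [← h]))
    rwa [he, e.apply_symm_apply] at this
  · have := h₁₁ (e.symm m) (fun h => hi (by simp [← h])) (fun h => hj (by simp [← h]))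
    rwa [he, e.apply_symm_apply] at this

end Invariance

theorem hasDouble_A (n : ℕ) : ¬ HasDouble (CartanMatrix.A n) := by
  rintro ⟨i, j, h⟩
  simp only [CartanMatrix.A, Matrix.of_apply] at h
  grind

theorem hasTriple_A (n : ℕ) : ¬ HasTriple (CartanMatrix.A n) := by
  rintro ⟨i, j, h⟩
  simp only [CartanMatrix.A, Matrix.of_apply] at h
  grind

theorem hasBranch_A (n : ℕ) : ¬ HasBranch (CartanMatrix.A n) := by
  rintro ⟨i, j, k, l, h₁, h₂, h₃, h₄, h₅, h₆, h₇, h₈, h₉⟩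
  simp only [CartanMatrix.A, Matrix.of_apply, if_neg h₁, if_neg h₂, if_neg h₃] at h₇ h₈ h₉
  rw [ne_eq, Fin.ext_iff] at *
  split_ifs at h₇ h₈ h₉ <;> omega

theorem endShort_B {n : ℕ} (hn : 2 ≤ n) : EndShort (CartanMatrix.B n) := by
  refine ⟨⟨n - 2, by omega⟩, ⟨n - 1, by omega⟩, ?_, fun k h₁ h₂ => ?_⟩
  · simp only [CartanMatrix.B, Matrix.of_apply, Fin.ext_iff]
    split_ifs <;> omega
  · have := k.2
    simp only [CartanMatrix.B, Matrix.of_apply, Fin.ext_iff, ne_eq] at *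
    split_ifs <;> omega

theorem hasTriple_B (n : ℕ) : ¬ HasTriple (CartanMatrix.B n) := by
  rintro ⟨i, j, h⟩
  simp only [CartanMatrix.B, Matrix.of_apply] at h
  split_ifs at h <;> omega

theorem endLong_C {n : ℕ} (hn : 3 ≤ n) : EndLong (CartanMatrix.C n) := by
  refine ⟨⟨n - 1, by omega⟩, ⟨n - 2, by omega⟩, ?_, fun k h₁ h₂ => ?_⟩
  · simp only [CartanMatrix.C, Matrix.of_apply, Fin.ext_iff]
    split_ifs <;> omega
  · have := k.2
    simp only [CartanMatrix.C, Matrix.of_apply, Fin.ext_iff, ne_eq] at *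
    split_ifs <;> omega

theorem endShort_C {n : ℕ} (hn : 3 ≤ n) : ¬ EndShort (CartanMatrix.C n) := by
  rintro ⟨i, j, h, h'⟩
  have hi := i.2
  have hij : (j : ℕ) + 1 = i ∧ (i : ℕ) = n - 1 := by
    simp only [CartanMatrix.C, Matrix.of_apply] at h
    split_ifs at h <;> omega
  have := h' ⟨n - 3, by omega⟩ (by rw [ne_eq, Fin.ext_iff]; simp; omega)
    (by rw [ne_eq, Fin.ext_iff]; simp; omega)
  simp only [CartanMatrix.C, Matrix.of_apply, Fin.ext_iff] at this
  split_ifs at this <;> omega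

theorem hasTriple_C (n : ℕ) : ¬ HasTriple (CartanMatrix.C n) := by
  rintro ⟨i, j, h⟩
  simp only [CartanMatrix.C, Matrix.of_apply] at h
  split_ifs at h <;> omega

theorem hasDouble_D (n : ℕ) : ¬ HasDouble (CartanMatrix.D n) := by
  rintro ⟨i, j, h⟩
  simp only [CartanMatrix.D, Matrix.of_apply] at h
  split_ifs at h <;> omega

theorem hasTriple_D (n : ℕ) : ¬ HasTriple (CartanMatrix.D n) := by
  rintro ⟨i, j, h⟩
  simp only [CartanMatrix.D, Matrix.of_apply] at h
  split_ifs at h <;> omega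

theorem hasFork_D {n : ℕ} (hn : 4 ≤ n) : HasFork (CartanMatrix.D n) := by
  refine ⟨⟨n - 3, by omega⟩, ⟨n - 2, by omega⟩, ⟨n - 1, by omega⟩, ⟨n - 4, by omega⟩, ?_, ?_, ?_,
    ?_, ?_, ?_, ?_, ?_, ?_, fun m h₁ h₂ => ?_, fun m h₁ h₂ => ?_⟩
  any_goals
    rw [ne_eq, Fin.ext_iff]
    simp only
    omega
  any_goals
    have := m.2
    simp only [CartanMatrix.D, Matrix.of_apply, Fin.ext_iff, ne_eq] at *
    split_ifs <;> omega
  all_goals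
    simp only [CartanMatrix.D, Matrix.of_apply, Fin.ext_iff]
    split_ifs <;> first | (exfalso; omega) | norm_num

theorem HasFork.hasBranch {n : ℕ} {M : Matrix (Fin n) (Fin n) ℤ} (h : HasFork M) :
    HasBranch M := by
  obtain ⟨i, j, k, l, h₁, h₂, h₃, h₄, h₅, h₆, h₇, h₈, h₉, -⟩ := h
  exact ⟨i, j, k, l, h₁, h₂, h₃, h₄, h₅, h₆, h₇, h₈, h₉⟩

/-- Numerical code of the family of a Dynkin type, which determines it together with the rank. -/
def family : DynkinType → ℕ
  | A _ => 0
  | B _ => 1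
  | C _ => 2
  | D _ => 3
  | F4 => 4
  | G2 => 5
  | _ => 6

open Classical in
/-- The family of a diagram, read off from its Cartan matrix. -/
noncomputable def familyOf {n : ℕ} (M : Matrix (Fin n) (Fin n) ℤ) : ℕ :=
  if HasTriple M then 5
  else if EndShort M then 1
  else if EndLong M then 2
  else if HasDouble M then 4
  else if HasFork M then 3
  else if HasBranch M then 6
  else 0

theorem familyOf_congr {m n : ℕ} {M : Matrix (Fin m) (Fin m) ℤ} {M' : Matrix (Fin n) (Fin n) ℤ}
    (e : Fin m ≃ Fin n) (he : ∀ i j, M i j = M' (e i) (e j)) : familyOf M = familyOf M' := by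
  have he' : ∀ i j, M' i j = M (e.symm i) (e.symm j) := fun i j => by simp [he]
  have h1 : HasTriple M ↔ HasTriple M' := ⟨.of_equiv e he, .of_equiv e.symm he'⟩
  have h2 : EndShort M ↔ EndShort M' := ⟨.of_equiv e he, .of_equiv e.symm he'⟩
  have h3 : EndLong M ↔ EndLong M' := ⟨.of_equiv e he, .of_equiv e.symm he'⟩
  have h4 : HasDouble M ↔ HasDouble M' := ⟨.of_equiv e he, .of_equiv e.symm he'⟩
  have h5 : HasFork M ↔ HasFork M' := ⟨.of_equiv e he, .of_equiv e.symm he'⟩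
  have h6 : HasBranch M ↔ HasBranch M' := ⟨.of_equiv e he, .of_equiv e.symm he'⟩
  rw [familyOf, familyOf, propext h1, propext h2, propext h3, propext h4, propext h5, propext h6]

theorem EndShort.hasDouble {n : ℕ} {M : Matrix (Fin n) (Fin n) ℤ} (h : EndShort M) :
    HasDouble M := by
  obtain ⟨i, j, h, -⟩ := h
  exact ⟨i, j, h⟩

theorem EndLong.hasDouble {n : ℕ} {M : Matrix (Fin n) (Fin n) ℤ} (h : EndLong M) :
    HasDouble M := by
  obtain ⟨i, j, h, -⟩ := h
  exact ⟨i, j, h⟩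

theorem familyOf_simplyLaced {n : ℕ} {M : Matrix (Fin n) (Fin n) ℤ} (h₁ : ¬ HasTriple M)
    (h₂ : ¬ HasDouble M) (b₁ b₂ : Prop) [Decidable b₁] [Decidable b₂]
    (h₃ : HasFork M ↔ b₁) (h₄ : HasBranch M ↔ b₂) :
    familyOf M = if b₁ then 3 else if b₂ then 6 else 0 := by
  have h₅ : ¬ EndShort M := fun h => h₂ h.hasDouble
  have h₆ : ¬ EndLong M := fun h => h₂ h.hasDouble
  simp [familyOf, h₁, h₂, h₃, h₄, h₅, h₆]

theorem familyOf_E₆ : familyOf CartanMatrix.E₆ = 6 := by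
  have h₁ : ¬ HasTriple CartanMatrix.E₆ := by unfold HasTriple; decide
  have h₂ : ¬ HasDouble CartanMatrix.E₆ := by unfold HasDouble; decide
  have h₃ : ¬ HasFork CartanMatrix.E₆ := by unfold HasFork; decide +kernel
  have h₄ : HasBranch CartanMatrix.E₆ := ⟨3, 1, 2, 4, by decide⟩
  simpa using familyOf_simplyLaced h₁ h₂ False True (iff_false_intro h₃) (iff_true_intro h₄)

theorem familyOf_E₇ : familyOf CartanMatrix.E₇ = 6 := by
  have h₁ : ¬ HasTriple CartanMatrix.E₇ := by unfold HasTriple; decide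
  have h₂ : ¬ HasDouble CartanMatrix.E₇ := by unfold HasDouble; decide
  have h₃ : ¬ HasFork CartanMatrix.E₇ := by unfold HasFork; decide +kernel
  have h₄ : HasBranch CartanMatrix.E₇ := ⟨3, 1, 2, 4, by decide⟩
  simpa using familyOf_simplyLaced h₁ h₂ False True (iff_false_intro h₃) (iff_true_intro h₄)

theorem familyOf_E₈ : familyOf CartanMatrix.E₈ = 6 := by
  have h₁ : ¬ HasTriple CartanMatrix.E₈ := by unfold HasTriple; decide
  have h₂ : ¬ HasDouble CartanMatrix.E₈ := by unfold HasDouble; decide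
  have h₃ : ¬ HasFork CartanMatrix.E₈ := by unfold HasFork; decide +kernel
  have h₄ : HasBranch CartanMatrix.E₈ := ⟨3, 1, 2, 4, by decide⟩
  simpa using familyOf_simplyLaced h₁ h₂ False True (iff_false_intro h₃) (iff_true_intro h₄)

theorem familyOf_F₄ : familyOf CartanMatrix.F₄ = 4 := by
  have h₁ : ¬ HasTriple CartanMatrix.F₄ := by unfold HasTriple; decide
  have h₂ : ¬ EndShort CartanMatrix.F₄ := by unfold EndShort; decide
  have h₃ : ¬ EndLong CartanMatrix.F₄ := by unfold EndLong; decide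
  have h₄ : HasDouble CartanMatrix.F₄ := ⟨1, 2, by decide⟩
  simp [familyOf, h₁, h₂, h₃, h₄]

theorem familyOf_G₂ : familyOf CartanMatrix.G₂ = 5 := by
  have h₁ : HasTriple CartanMatrix.G₂ := ⟨0, 1, by decide⟩
  simp [familyOf, h₁]

theorem familyOf_cartan {X : DynkinType} (hX : X.IsProper) : familyOf X.cartan = X.family := by
  match X, hX with
  | A n, _ =>
    exact (familyOf_simplyLaced (hasTriple_A n) (hasDouble_A n) False False
      (iff_false_intro fun h => hasBranch_A n h.hasBranch) (iff_false_intro (hasBranch_A n))).trans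
      (by simp [family])
  | B n, hX =>
    have h := endShort_B (n := n) hX
    have h' := hasTriple_B n
    exact (by simp [familyOf, h, h'] : familyOf (CartanMatrix.B n) = 1)
  | C n, hX =>
    have h := endLong_C (n := n) hX
    have h' := hasTriple_C n
    have h'' := endShort_C (n := n) hX
    exact (by simp [familyOf, h, h', h''] : familyOf (CartanMatrix.C n) = 2)
  | D n, hX =>
    have h := hasFork_D (n := n) hX
    have h' := hasTriple_D n
    exact (familyOf_simplyLaced (hasTriple_D n) (hasDouble_D n) True True
      (iff_true_intro h) (iff_true_intro h.hasBranch)).trans (by simp [family])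
  | E6, _ => exact familyOf_E₆
  | E7, _ => exact familyOf_E₇
  | E8, _ => exact familyOf_E₈
  | F4, _ => exact familyOf_F₄
  | G2, _ => exact familyOf_G₂

/-- The proper Dynkin types have pairwise non-isomorphic diagrams. -/
theorem eq_of_cartan_equiv {X Y : DynkinType} (hX : X.IsProper) (hY : Y.IsProper)
    (e : Fin X.rank ≃ Fin Y.rank) (he : ∀ i j, X.cartan i j = Y.cartan (e i) (e j)) : X = Y := by
  have h₁ : X.rank = Y.rank := by simpa using Fintype.card_congr e
  have h₂ : X.family = Y.family := by
    rw [← familyOf_cartan hX, ← familyOf_cartan hY, familyOf_congr e he]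
  cases X <;> cases Y <;> simp [rank, family] at h₁ h₂ <;> first | rw [h₁] | rfl

end DynkinType

end SmallWeights

namespace SmallWeights

variable {ι V N : Type*} [AddCommGroup V] [Module ℝ V] [AddCommGroup N] [Module ℝ N]
  {P : RootPairing ι ℝ V N}

/-! ### Components and symbols -/

theorem IsComponent.subset_of_inter {Γ C C' : Set ι} (h : IsComponent P Γ C)
    (h' : IsComponent P Γ C') (hne : (C ∩ C').Nonempty) : C ⊆ C' := by
  rw [← Set.inter_eq_left]
  refine h.2.2.2 _ Set.inter_subset_left hne fun i hi j hj => ?_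
  exact h'.2.2.1 i hi.2 j ⟨h.1 hj.1, fun hj' => hj.2 ⟨hj.1, hj'⟩⟩

/-- Parabolic subsystems with disjoint sets of simple roots have no root in common, since the simple
roots are linearly independent. -/
theorem IsComponent.eq_of_inParabolic {b : P.Base} {Γ C C' : Set ι} (hΓ : Γ ⊆ b.support)
    (h : IsComponent P Γ C) (h' : IsComponent P Γ C') {i : ι} (hi : InParabolic P C i)
    (hi' : InParabolic P C' i) : C = C' := by
  by_cases hne : (C ∩ C').Nonempty
  · exact (h.subset_of_inter h' hne).antisymm (h'.subset_of_inter h (Set.inter_comm C C' ▸ hne))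
  · exfalso
    have hd : Disjoint C C' :=
      Set.disjoint_iff_inter_eq_empty.2 (Set.not_nonempty_iff_eq_empty.1 hne)
    have := Submodule.disjoint_def.1 ((linearIndepOn_union_iff hd).1
      (b.linearIndepOn_root.mono (Set.union_subset (h.1.trans hΓ) (h'.1.trans hΓ)))).2.2 _ hi hi'
    exact P.ne_zero i this

theorem HasType.unique [P.IsCrystallographic] {C : Set ι} {X Y : DynkinType} (hX : HasType P C X)
    (hY : HasType P C Y) : X = Y := by
  obtain ⟨hX, e, he⟩ := hX
  obtain ⟨hY, f, hf⟩ := hY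
  refine DynkinType.eq_of_cartan_equiv hX hY (e.trans f.symm) fun i j => ?_
  rw [← he, ← hf]
  simp

theorem HasType.isComponent [P.IsCrystallographic] {Γ C : Set ι} {X : DynkinType}
    (hX : HasType P C X) (hsub : C ⊆ Γ) (hne : C.Nonempty)
    (horth : ∀ i ∈ C, ∀ j ∈ Γ \ C, P.pairing i j = 0) : IsComponent P Γ C := by
  refine ⟨hsub, hne, horth, fun T hT hTne hTc => hT.antisymm fun i hi => ?_⟩
  obtain ⟨hX, e, he⟩ := hX
  have := DynkinType.connected hX {k | (e k : ι) ∈ T} (by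
    obtain ⟨i, hi⟩ := hTne
    exact ⟨e.symm ⟨i, hT hi⟩, by simpa using hi⟩) fun k hk m hm => by
      have := hTc (e k) hk (e m) ⟨(e m).2, hm⟩
      rw [← P.algebraMap_pairingIn ℤ, he] at this
      simpa using this
  have hi' := Set.eq_univ_iff_forall.1 this (e.symm ⟨i, hi⟩)
  simpa using hi'

section

variable [Fintype ι]

theorem oneLength_of_isShort_of_isLong {i : ι} (hs : IsShort P i) (hl : IsLong P i) :
    OneLength P := fun j k =>
  ((hl j).antisymm (hs j)).trans ((hs k).antisymm (hl k))

theorem Mark.LengthMark.unique {a a' : Mark} {i : ι} (h : a.LengthMark P i)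
    (h' : a'.LengthMark P i) : a = a' := by
  cases a <;> cases a' <;> simp only [Mark.LengthMark] at h h'
  · rfl
  · exact absurd h h'.1
  · exact absurd h h'.1
  · exact absurd h' h.1
  · rfl
  · exact absurd (oneLength_of_isShort_of_isLong h.2 h'.2) h.1
  · exact absurd h' h.1
  · exact absurd (oneLength_of_isShort_of_isLong h'.2 h.2) h.1
  · rfl

theorem Mark.Records.unique {a a' : Mark} {B : Finset ι} (h : a.Records P B)
    (h' : a'.Records P B) : a = a' := by
  rcases h with ⟨i, rfl, h⟩ | ⟨h, rfl⟩ <;> rcases h' with ⟨j, hj, h'⟩ | ⟨h', rfl⟩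
  · rw [Finset.singleton_inj] at hj
    exact h.unique (hj ▸ h')
  · simp at h'
  · simp [hj] at h
  · rfl

theorem Mark.Records.nonempty {a : Mark} {B : Finset ι} (h : a.Records P B) : B.Nonempty := by
  rcases h with ⟨i, rfl, -⟩ | ⟨h, -⟩
  · exact Finset.singleton_nonempty i
  · exact Finset.card_pos.1 (by omega)

theorem IsDominantBlock.records {C : Set ι} {X : DynkinType} {a : Mark} {B : Finset ι}
    (h : IsDominantBlock P C X a B) : (∀ i ∈ B, InParabolic P C i) ∧ a.Records P B := by
  classical
  rcases h with ⟨t, ht, ha, rfl⟩ | ⟨rfl, -, t, t', ht, ⟨j, hj, -, hjt⟩, hB⟩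
  · exact ⟨by simpa using ht.1, .inl ⟨t, rfl, ha⟩⟩
  · have hB' : B = {t, t'} := by
      apply Finset.coe_injective
      simpa using hB
    have hne : t ≠ t' := by
      rintro rfl
      exact P.ne_zero j (by rwa [eq_comm, sub_eq_self] at hjt)
    refine ⟨?_, .inr ⟨by rw [hB', Finset.card_pair hne], rfl⟩⟩
    rw [hB']
    intro i hi
    rcases Finset.mem_insert.1 hi with rfl | hi
    · exact ht.1
    · rw [Finset.mem_singleton.1 hi, InParabolic, hjt]
      exact Submodule.sub_mem _ ht.1 (Submodule.subset_span ⟨j, hj, rfl⟩)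

variable [P.IsCrystallographic]

/-- The symbol of a sequence of blocks is unique: a root lies in at most one component, and a
diagram has at most one type. -/
theorem IsSymbol.unique {b : P.Base} {Γ : Set ι} {L : List (Finset ι)} {s s' : Symbol}
    (hΓ : Γ ⊆ b.support) (h : IsSymbol P Γ L s) (h' : IsSymbol P Γ L s') : s = s' := by
  induction h generalizing s' with
  | nil => cases h'; rfl
  | @cons Γ C a X B L s hC hX hB ha _ ih =>
    cases h' with
    | @cons _ C' a' X' _ _ s' hC' hX' hB' ha' h' =>
      obtain ⟨i, hi⟩ := ha.nonempty
      obtain rfl := hC.eq_of_inParabolic hΓ hC' (hB i hi) (hB' i hi)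
      rw [hX.unique hX', ha.unique ha',
        ih (fun j hj => hΓ (hC.1 hj.1)) h']

theorem IsCascade.isSymbol {Γ : Set ι} {L : List (Finset ι)} {s : Symbol}
    (h : IsCascade P Γ L s) : IsSymbol P Γ L s := by
  induction h with
  | nil => exact .nil
  | cons hC hX hB _ ih => exact .cons hC hX hB.records.1 hB.records.2 ih

end

/-! ### Reduction to explicit families of weights -/

/-- A numbering of the simple roots for which the Cartan matrix is that of the type `X`. -/
structure Labelling (b : P.Base) (X : DynkinType) where
  /-- The simple root with the given number. -/
  node : Fin X.rank → ι
  injective : Function.Injective node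
  range_eq : Set.range node = b.support
  pairing : ∀ i j, P.pairing (node i) (node j) = (X.cartan i j : ℝ)

namespace Labelling

variable {b : P.Base} {X : DynkinType} (ν : Labelling b X)

theorem node_mem (k : Fin X.rank) : ν.node k ∈ b.support := by
  have : ν.node k ∈ (b.support : Set ι) := ν.range_eq ▸ ⟨k, rfl⟩
  exact this

theorem exists_node {j : ι} (hj : j ∈ b.support) : ∃ k, ν.node k = j := by
  have : j ∈ Set.range ν.node := ν.range_eq ▸ hj
  exact this

/-- Renumbering of the simple roots by an automorphism of the diagram. -/
def comp (τ : Equiv.Perm (Fin X.rank)) (hτ : ∀ i j, X.cartan (τ i) (τ j) = X.cartan i j) :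
    Labelling b X where
  node := ν.node ∘ τ
  injective := ν.injective.comp τ.injective
  range_eq := by rw [τ.surjective.range_comp, ν.range_eq]
  pairing _ _ := by rw [← hτ]; exact ν.pairing _ _

/-- The bijection between numbers and simple roots. -/
noncomputable def equiv : Fin X.rank ≃ b.support :=
  Equiv.ofBijective (fun k => ⟨ν.node k, ν.node_mem k⟩)
    ⟨fun _ _ h => ν.injective (congrArg Subtype.val h), fun j =>
      let ⟨k, hk⟩ := ν.exists_node j.2
      ⟨k, Subtype.ext hk⟩⟩

@[simp] theorem coe_equiv (k : Fin X.rank) : (ν.equiv k : ι) = ν.node k := rfl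

theorem ext_coroot [P.IsRootSystem] {x y : V}
    (h : ∀ k, P.coroot' (ν.node k) x = P.coroot' (ν.node k) y) : x = y := by
  refine eq_of_forall_coroot_eq b fun j hj => ?_
  obtain ⟨k, rfl⟩ := ν.exists_node hj
  exact h k

theorem linearMap_ext [P.IsRootSystem] {W : Type*} [AddCommGroup W] [Module ℝ W] {f g : V →ₗ[ℝ] W}
    (h : ∀ k, f (P.root (ν.node k)) = g (P.root (ν.node k))) : f = g := by
  refine b.toWeightBasis.ext fun j => ?_
  obtain ⟨k, hk⟩ := ν.exists_node j.2
  rw [RootPairing.Base.toWeightBasis_apply, ← hk]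
  exact h k

/-- Two numberings of the simple roots differ by a diagram automorphism. -/
theorem diagramConjugate [P.IsRootSystem] [P.IsCrystallographic] (ν' : Labelling b X) {l m : V}
    (h : ∀ k, P.coroot' (ν'.node k) m = P.coroot' (ν.node k) l) : DiagramConjugate b l m := by
  set τ : Equiv.Perm b.support := ν.equiv.symm.trans ν'.equiv with hτ
  have hτν : ∀ k, τ (ν.equiv k) = ν'.equiv k := fun k => by simp [hτ]
  refine ⟨τ, fun i j => ?_, b.toWeightBasis.equiv b.toWeightBasis τ, fun i => ?_, ?_⟩
  · obtain ⟨i, rfl⟩ := ν.equiv.surjective i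
    obtain ⟨j, rfl⟩ := ν.equiv.surjective j
    have : ((P.pairingIn ℤ (ν'.node i) (ν'.node j) : ℤ) : ℝ) =
        (P.pairingIn ℤ (ν.node i) (ν.node j) : ℤ) := by
      have h₁ := P.algebraMap_pairingIn ℤ (ν'.node i) (ν'.node j)
      have h₂ := P.algebraMap_pairingIn ℤ (ν.node i) (ν.node j)
      rw [ν'.pairing, ← ν.pairing] at h₁
      exact h₁.trans h₂.symm
    rw [hτν, hτν]
    exact_mod_cast this
  · rw [← RootPairing.Base.toWeightBasis_apply, Module.Basis.equiv_apply,
      RootPairing.Base.toWeightBasis_apply]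
  · refine ν'.ext_coroot fun k => ?_
    rw [h]
    have : P.coroot' (ν'.node k) ∘ₗ (b.toWeightBasis.equiv b.toWeightBasis τ).toLinearMap =
        P.coroot' (ν.node k) := by
      refine ν.linearMap_ext fun i => ?_
      have : P.root (ν.node i) = b.toWeightBasis (ν.equiv i) := by simp
      rw [LinearMap.comp_apply, this, LinearEquiv.coe_coe, Module.Basis.equiv_apply, hτν]
      simp [ν.pairing, ν'.pairing]
    exact LinearMap.congr_fun this l

theorem isDominant_iff {l : V} : IsDominant b l ↔ ∀ k, 0 ≤ P.coroot' (ν.node k) l := by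
  refine ⟨fun h k => h _ (ν.node_mem k), fun h j hj => ?_⟩
  obtain ⟨k, rfl⟩ := ν.exists_node hj
  exact h k

end Labelling

theorem HasType.exists_labelling [P.IsCrystallographic] {b : P.Base} {X : DynkinType}
    (h : HasType P b.support X) : Nonempty (Labelling b X) := by
  obtain ⟨-, e, he⟩ := h
  refine ⟨⟨fun k => e k, fun i j h => e.injective (Subtype.ext h), ?_, fun i j => ?_⟩⟩
  · ext j
    constructor
    · rintro ⟨k, rfl⟩
      exact (e k).2
    · exact fun hj => ⟨e.symm ⟨j, hj⟩, by simp⟩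
  · rw [← he, ← P.algebraMap_pairingIn ℤ]
    rfl

/-- The small dominant weights have unique canonical block decompositions and symbols, these symbols
are those of the type `X`, they determine the weights up to diagram automorphisms, and the blocks
arise by the cascade construction. -/
abbrev IsClassified [Fintype ι] [P.IsCrystallographic] (b : P.Base) (X : DynkinType) : Prop :=
    (∀ l : V, IsDominant b l → IsSmall P l →
      (∃! L, IsCanonical b l L) ∧ (∃! s, HasSymbol b l s)) ∧
    {s | ∃ l : V, l ≠ 0 ∧ IsDominant b l ∧ IsSmall P l ∧ HasSymbol b l s} = X.symbols ∧
    (∀ (l : V) (L : List (Finset ι)) (s : Symbol), IsDominant b l → IsSmall P l →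
      IsCanonical b l L → IsSymbol P b.support L s →
      IsCascade P b.support L s ∧ l = (L.map (blockSum P)).sum) ∧
    (∀ (l m : V) (s : Symbol), IsDominant b l → IsSmall P l → IsDominant b m → IsSmall P m →
      HasSymbol b l s → HasSymbol b m s → DiagramConjugate b l m)

/-- A family of small dominant weights, given by their pairings `lab` with the simple coroots, whose
canonical block decompositions and cascades are known, and which comprises all small dominant
weights up to diagram automorphisms, determines everything. -/
theorem classification_of_family [Fintype ι] [P.IsRootSystem] [P.IsCrystallographic] {b : P.Base}
    {X : DynkinType} {T : Type} (lab : T → Fin X.rank → ℤ) (sym : T → Symbol)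
    (lab_nonneg : ∀ t j, 0 ≤ lab t j) (lab_ne : ∀ t, ∃ j, lab t j ≠ 0)
    (exists_weight : ∀ (ν : Labelling b X) (t : T), ∃ l : V, ∃ L : List (Finset ι),
      (∀ j, P.coroot' (ν.node j) l = lab t j) ∧ l ∈ P.rootSpan ℤ ∧ (∀ i, P.coroot' i l ≤ 3) ∧
      (∀ M, IsCanonical b l M ↔ M = L) ∧ IsCascade P b.support L (sym t))
    (complete : ∀ l : V, IsDominant b l → IsSmall P l → l ≠ 0 →
      ∃ (ν : Labelling b X) (t : T), ∀ j, P.coroot' (ν.node j) l = lab t j)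
    (range_sym : Set.range sym = X.symbols) (ν₀ : Labelling b X)
    (conj : ∀ t t', sym t = sym t' → ∃ τ : Equiv.Perm (Fin X.rank),
      (∀ i j, X.cartan (τ i) (τ j) = X.cartan i j) ∧ ∀ j, lab t' (τ j) = lab t j) :
    IsClassified b X := by
  have key : ∀ l : V, IsDominant b l → IsSmall P l →
      ∃ L s, (∀ M, IsCanonical b l M ↔ M = L) ∧ IsCascade P b.support L s ∧
        ((l = 0 ∧ s = []) ∨ ∃ (ν : Labelling b X) (t : T),
          (∀ j, P.coroot' (ν.node j) l = lab t j) ∧ s = sym t) := by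
    intro l hl hs
    by_cases h0 : l = 0
    · exact ⟨[], [], fun M => h0 ▸ isCanonical_zero_iff M, .nil, .inl ⟨h0, rfl⟩⟩
    · obtain ⟨ν, t, ht⟩ := complete l hl hs h0
      obtain ⟨l', L, h₁, -, -, h₂, h₃⟩ := exists_weight ν t
      obtain rfl : l = l' := ν.ext_coroot fun k => (ht k).trans (h₁ k).symm
      exact ⟨L, sym t, h₂, h₃, .inr ⟨ν, t, ht, rfl⟩⟩
  have hsymbol : ∀ {l : V} {L : List (Finset ι)} {s s' : Symbol},
      (∀ M, IsCanonical b l M ↔ M = L) → IsCascade P b.support L s → HasSymbol b l s' → s' = s := by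
    rintro l L s s' hL hc ⟨M, hM, hs'⟩
    obtain rfl := (hL M).1 hM
    exact hs'.unique subset_rfl hc.isSymbol
  have hne : ∀ {l : V} {ν : Labelling b X} {t : T},
      (∀ j, P.coroot' (ν.node j) l = lab t j) → l ≠ 0 := by
    rintro l ν t h rfl
    obtain ⟨j, hj⟩ := lab_ne t
    have := h j
    rw [map_zero] at this
    exact hj (by exact_mod_cast this.symm)
  have hnil : ∀ t, sym t ≠ [] := by
    intro t h
    obtain ⟨l, L, h₁, -, -, h₂, h₃⟩ := exists_weight ν₀ t
    rw [h] at h₃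
    cases h₃
    have := ((h₂ []).2 rfl).eq_sum
    exact hne h₁ (by simpa using this)
  refine ⟨fun l hl hs => ?_, ?_, fun l L s hl hs hL hsy => ?_, fun l m s hl hsl hm hsm h h' => ?_⟩
  · obtain ⟨L, s, h₁, h₂, -⟩ := key l hl hs
    exact ⟨⟨L, (h₁ L).2 rfl, fun M hM => (h₁ M).1 hM⟩,
      ⟨s, ⟨L, (h₁ L).2 rfl, h₂.isSymbol⟩, fun s' hs' => hsymbol h₁ h₂ hs'⟩⟩
  · rw [← range_sym]
    ext s
    constructor
    · rintro ⟨l, h0, hl, hs, hsy⟩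
      obtain ⟨L, s', h₁, h₂, ⟨h, -⟩ | ⟨ν, t, -, rfl⟩⟩ := key l hl hs
      · exact absurd h h0
      · exact ⟨t, (hsymbol h₁ h₂ hsy).symm⟩
    · rintro ⟨t, rfl⟩
      obtain ⟨l, L, h₁, h₂, h₃, h₄, h₅⟩ := exists_weight ν₀ t
      refine ⟨l, hne h₁, ν₀.isDominant_iff.2 fun k => ?_, isSmall_of_coroot_le h₂ h₃,
        L, (h₄ L).2 rfl, h₅.isSymbol⟩
      rw [h₁]
      exact_mod_cast lab_nonneg t k
  · obtain ⟨L', s', h₁, h₂, -⟩ := key l hl hs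
    obtain rfl := (h₁ L).1 hL
    obtain rfl := hsy.unique subset_rfl h₂.isSymbol
    exact ⟨h₂, hL.eq_sum⟩
  · obtain ⟨L, s₁, h₁, h₂, h₃⟩ := key l hl hsl
    obtain ⟨L', s₂, h₁', h₂', h₃'⟩ := key m hm hsm
    obtain rfl := hsymbol h₁ h₂ h
    obtain rfl := hsymbol h₁' h₂' h'
    rcases h₃ with ⟨rfl, hs⟩ | ⟨ν, t, ht, hs⟩ <;> rcases h₃' with ⟨rfl, hs'⟩ | ⟨ν', t', ht', hs'⟩
    · exact ν₀.diagramConjugate ν₀ fun k => rfl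
    · exact absurd (hs'.symm.trans hs) (hnil t')
    · exact absurd (hs.symm.trans hs') (hnil t)
    · obtain ⟨τ, hτ, hlab⟩ := conj t t' (hs.symm.trans hs')
      refine ν.diagramConjugate (ν'.comp τ hτ) fun k => ?_
      rw [ht, ← hlab]
      exact ht' (τ k)

end SmallWeights

namespace SmallWeights

/-! ### Invariant form and heights in terms of a labelling -/

namespace DynkinType

/-- Half the squared lengths of the simple roots, normalised so that they are coprime integers. -/
def halfNorm : (X : DynkinType) → Fin X.rank → ℤ
  | B n => fun i : Fin n => if (i : ℕ) + 1 = n then 1 else 2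
  | C n => fun i : Fin n => if (i : ℕ) + 1 = n then 2 else 1
  | F4 => fun i : Fin 4 => if (i : ℕ) < 2 then 2 else 1
  | G2 => fun i : Fin 2 => if (i : ℕ) = 0 then 3 else 1
  | _ => fun _ => 1

theorem halfNorm_pos (X : DynkinType) (i : Fin X.rank) : 0 < X.halfNorm i := by
  cases X <;> first
    | exact one_pos
    | (dsimp only [halfNorm]; split_ifs <;> norm_num)

/-- The Cartan matrix is symmetrised by the squared lengths. -/
theorem cartan_mul_halfNorm {X : DynkinType} (hX : X.IsProper) (i j : Fin X.rank) :
    X.cartan i j * X.halfNorm j = X.cartan j i * X.halfNorm i := by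
  match X, hX with
  | A n, _ =>
    change CartanMatrix.A n i j * 1 = CartanMatrix.A n j i * 1
    rw [mul_one, mul_one]
    exact congrFun (congrFun (CartanMatrix.A_isSymm n) j) i
  | D n, _ =>
    change CartanMatrix.D n i j * 1 = CartanMatrix.D n j i * 1
    rw [mul_one, mul_one]
    exact congrFun (congrFun (CartanMatrix.D_isSymm n) j) i
  | B n, _ =>
    change Fin n at i j
    change CartanMatrix.B n i j * (if (j : ℕ) + 1 = n then 1 else 2) =
      CartanMatrix.B n j i * (if (i : ℕ) + 1 = n then 1 else 2)
    simp only [CartanMatrix.B, Matrix.of_apply, Fin.ext_iff]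
    split_ifs <;> omega
  | C n, _ =>
    change Fin n at i j
    change CartanMatrix.C n i j * (if (j : ℕ) + 1 = n then 2 else 1) =
      CartanMatrix.C n j i * (if (i : ℕ) + 1 = n then 2 else 1)
    simp only [CartanMatrix.C, Matrix.of_apply, Fin.ext_iff]
    split_ifs <;> omega
  | E6, _ =>
    have h : ∀ i j : Fin 6, CartanMatrix.E₆ i j * 1 = CartanMatrix.E₆ j i * 1 := by decide
    exact h i j
  | E7, _ =>
    have h : ∀ i j : Fin 7, CartanMatrix.E₇ i j * 1 = CartanMatrix.E₇ j i * 1 := by decide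
    exact h i j
  | E8, _ =>
    have h : ∀ i j : Fin 8, CartanMatrix.E₈ i j * 1 = CartanMatrix.E₈ j i * 1 := by decide +kernel
    exact h i j
  | F4, _ =>
    have h : ∀ i j : Fin 4, CartanMatrix.F₄ i j * (if (j : ℕ) < 2 then 2 else 1) =
      CartanMatrix.F₄ j i * (if (i : ℕ) < 2 then 2 else 1) := by decide +kernel
    exact h i j
  | G2, _ =>
    have h : ∀ i j : Fin 2, CartanMatrix.G₂ i j * (if (j : ℕ) = 0 then 3 else 1) =
      CartanMatrix.G₂ j i * (if (i : ℕ) = 0 then 3 else 1) := by decide +kernel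
    exact h i j

end DynkinType

variable {ι V N : Type*} [AddCommGroup V] [Module ℝ V] [AddCommGroup N] [Module ℝ N]
  {P : RootPairing ι ℝ V N}

/-- The height is the linear functional with value `1` on all simple roots. -/
theorem apply_eq_height [P.IsRootSystem] [P.IsCrystallographic] {b : P.Base} (H : V →ₗ[ℝ] ℝ)
    (hH : ∀ j ∈ b.support, H (P.root j) = 1) (i : ι) : H (P.root i) = b.height i := by
  obtain ⟨f, -, -, hf⟩ := b.exists_root_eq_sum_int i
  rw [b.height_eq_sum hf, hf, map_sum]
  push_cast
  refine Finset.sum_congr rfl fun j hj => ?_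
  rw [map_zsmul, hH j hj]
  simp

variable [Fintype ι]

/-- The invariant form is determined by the labelling up to a positive factor. -/
theorem Labelling.exists_rootForm_eq [P.IsRootSystem] {b : P.Base} {X : DynkinType}
    (ν : Labelling b X) (hX : X.IsProper) :
    ∃ c : ℝ, 0 < c ∧ ∀ j x,
      P.RootForm (P.root (ν.node j)) x = c * (X.halfNorm j * P.coroot' (ν.node j) x) := by
  have hcoroot : ∀ j x, P.RootForm (P.root (ν.node j)) x =
      P.RootForm (P.root (ν.node j)) (P.root (ν.node j)) / 2 * P.coroot' (ν.node j) x := by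
    intro j x
    linarith [rootForm_self_mul_coroot (P := P) (ν.node j) x]
  set q : Fin X.rank → ℝ := fun j => P.RootForm (P.root (ν.node j)) (P.root (ν.node j)) / 2 with hq
  have hqpos : ∀ j, 0 < q j := fun j => half_pos (rootForm_self_pos _)
  have hd : ∀ j, (0 : ℝ) < X.halfNorm j := fun j => by exact_mod_cast X.halfNorm_pos j
  by_cases hr : Nonempty (Fin X.rank)
  swap
  · exact ⟨1, one_pos, fun j => (hr ⟨j⟩).elim⟩
  obtain ⟨k⟩ := hr
  -- The ratio of the squared lengths of adjacent simple roots is read off from the Cartan matrix.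
  have hT := DynkinType.connected hX {j | q j * X.halfNorm k = q k * X.halfNorm j} ⟨k, rfl⟩ (by
    intro i hi j hj
    by_contra hij
    apply hj
    have h₁ : q i * X.cartan j i = q j * X.cartan i j := by
      have h := hcoroot i (P.root (ν.node j))
      have hs : P.RootForm (P.root (ν.node i)) (P.root (ν.node j)) =
          P.RootForm (P.root (ν.node j)) (P.root (ν.node i)) :=
        (P.rootForm_symmetric.eq (P.root (ν.node j)) (P.root (ν.node i))).symm
      rw [hs, hcoroot j] at h
      simp only [RootPairing.root_coroot'_eq_pairing, ν.pairing] at h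
      exact h.symm
    have h₂ : (X.cartan i j * X.halfNorm j : ℝ) = X.cartan j i * X.halfNorm i := by
      exact_mod_cast DynkinType.cartan_mul_halfNorm hX i j
    have h₃ : (X.cartan i j : ℝ) ≠ 0 := by exact_mod_cast hij
    simp only [Set.mem_ofPred_eq] at hi ⊢
    apply mul_left_cancel₀ (mul_ne_zero h₃ (hd i).ne')
    linear_combination (-X.halfNorm i * X.halfNorm k) * h₁ + X.cartan j i * X.halfNorm i * hi
      - q k * X.halfNorm i * h₂)
  refine ⟨q k / X.halfNorm k, div_pos (hqpos k) (hd k), fun j x => ?_⟩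
  have : q j * X.halfNorm k = q k * X.halfNorm j := by
    have : j ∈ {j | q j * X.halfNorm k = q k * X.halfNorm j} := hT ▸ Set.mem_univ j
    exact this
  rw [hcoroot, ← mul_assoc]
  congr 1
  have := (hd k).ne'
  rw [div_mul_eq_mul_div, eq_div_iff this]
  exact ‹q j * _ = _›

variable [P.IsCrystallographic] {b : P.Base}

theorem isCanonical_snoc_singleton_iff {l : V} {i : ι} {k : ℕ} {L : List (Finset ι)}
    (horth : P.coroot' i (l - P.root i) = 0) (hk : HasLength P (l - P.root i) k)
    (hl : HasLength P l (k + 1)) (h₀ : 0 < b.height i)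
    (h : ∀ e, IsMinimalExpression P l e → ∀ j ∈ e, j = i ∨ b.height i < b.height j)
    (hL : ∀ M, IsCanonical b (l - P.root i) M ↔ M = L) (M : List (Finset ι)) :
    IsCanonical b l M ↔ M = L ++ [{i}] := by
  have hs : blockSum P {i} = P.root i := Finset.sum_singleton _ _
  refine isCanonical_snoc_iff (Finset.singleton_nonempty i) (by simp) ?_ ?_ hl
    (eq_or_blockHeight_lt_of_singleton h₀ h) ?_ M
  · simpa only [Finset.mem_singleton, forall_eq, hs]
  · rwa [hs]
  · rwa [hs]

theorem isCanonical_snoc_pair_iff [DecidableEq ι] {l : V} {i₁ i₂ : ι} {k : ℕ}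
    {L : List (Finset ι)} (hne : i₁ ≠ i₂) (hpos : 0 < P.pairing i₁ i₂)
    (horth₁ : P.coroot' i₁ (l - (P.root i₁ + P.root i₂)) = 0)
    (horth₂ : P.coroot' i₂ (l - (P.root i₁ + P.root i₂)) = 0)
    (hk : HasLength P (l - (P.root i₁ + P.root i₂)) k)
    (hl : HasLength P l (k + 2)) (h₁ : 0 < b.height i₁) (h₁₂ : b.height i₁ ≤ b.height i₂)
    (h : ∀ e, IsMinimalExpression P l e → ∀ i ∈ e, P.coroot' i l = 3 ∧
      (i = i₁ ∨ i = i₂ ∨ b.height i₂ < b.height i))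
    (hL : ∀ M, IsCanonical b (l - (P.root i₁ + P.root i₂)) M ↔ M = L) (M : List (Finset ι)) :
    IsCanonical b l M ↔ M = L ++ [{i₁, i₂}] := by
  have hs : blockSum P {i₁, i₂} = P.root i₁ + P.root i₂ := Finset.sum_pair hne
  refine isCanonical_snoc_iff (Finset.insert_nonempty _ _) ?_ ?_ ?_
    (by rwa [Finset.card_pair hne]) (eq_or_blockHeight_lt_of_pair hne h₁ h₁₂ h) ?_ M
  · simp only [Finset.mem_insert, Finset.mem_singleton]
    rintro _ (rfl | rfl) _ (rfl | rfl)
    · simp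
    · exact hpos
    · exact pairing_pos_comm.1 hpos
    · simp
  · simp only [Finset.mem_insert, Finset.mem_singleton, hs]
    rintro _ (rfl | rfl)
    · exact horth₁
    · exact horth₂
  · rwa [hs]
  · rwa [hs]

end SmallWeights

namespace SmallWeights

/-! ### Explicit root data -/

namespace DynkinType

variable (X : DynkinType)

/-- The coefficient of the `i`-th simple root in the root with code `n`: a positive root all of
whose coefficients are less than ten is encoded by the number with these decimal digits. -/
def coef (n : ℕ) (i : Fin X.rank) : ℤ := ((n / 10 ^ (X.rank - 1 - i) % 10 : ℕ) : ℤ)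

/-- The code of a simple root. -/
def simpleCode (j : Fin X.rank) : ℕ := 10 ^ (X.rank - 1 - j)

/-- The pairing of the root with code `n` with the `j`-th simple coroot. -/
def pair (n : ℕ) (j : Fin X.rank) : ℤ := ∑ i, X.coef n i * X.cartan i j

/-- The height of the root with code `n`. -/
def heightCode (n : ℕ) : ℤ := ∑ i, X.coef n i

/-- The invariant form, evaluated on the root with code `n` and the weight which pairs to `m j` with
the `j`-th simple coroot. -/
def form (n : ℕ) (m : Fin X.rank → ℤ) : ℤ := ∑ j, X.coef n j * (X.halfNorm j * m j)

/-- The squared length of the root with code `n`. -/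
def norm (n : ℕ) : ℤ := X.form n (X.pair n)

/-- The code of the image of a root under a simple reflection. -/
def reflect (n : ℕ) (j : Fin X.rank) : ℕ := (n - X.pair n j * X.simpleCode j).toNat

/-- A finite set of conditions which ensure that `R` lists the codes of the positive roots: it
contains the simple roots, is closed under simple reflections as far as possible, and each of its
members can be lowered to a simple root. -/
def IsRootList (R : List ℕ) : Prop :=
  (∀ j, X.simpleCode j ∈ R ∧ ∀ i, X.coef (X.simpleCode j) i = if i = j then 1 else 0) ∧
  (∀ n ∈ R, 0 < X.heightCode n) ∧
  (∀ n ∈ R, ∀ j, n = X.simpleCode j ∨ (X.reflect n j ∈ R ∧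
    ∀ i, X.coef (X.reflect n j) i = X.coef n i - if i = j then X.pair n j else 0)) ∧
  ∀ n ∈ R, ∃ j, n = X.simpleCode j ∨ X.reflect n j < n

instance (R : List ℕ) : Decidable (X.IsRootList R) := by
  unfold IsRootList
  infer_instance

end DynkinType

variable {ι V N : Type*} [AddCommGroup V] [Module ℝ V] [AddCommGroup N] [Module ℝ N]
  {P : RootPairing ι ℝ V N}

namespace Labelling

variable {b : P.Base} {X : DynkinType} (ν : Labelling b X)

/-- The vector with code `n`. -/
def vec (n : ℕ) : V := ∑ i, (X.coef n i : ℝ) • P.root (ν.node i)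

theorem coroot_vec (n : ℕ) (j : Fin X.rank) : P.coroot' (ν.node j) (ν.vec n) = X.pair n j := by
  simp [vec, DynkinType.pair, ν.pairing]

theorem vec_simpleCode {R : List ℕ} (hR : X.IsRootList R) (j : Fin X.rank) :
    ν.vec (X.simpleCode j) = P.root (ν.node j) := by
  simp [vec, (hR.1 j).2]

theorem vec_eq_sub {n n' : ℕ} {j : Fin X.rank} {a : ℤ}
    (h : ∀ i, X.coef n' i = X.coef n i - if i = j then a else 0) :
    ν.vec n' = ν.vec n - (a : ℝ) • P.root (ν.node j) := by
  simp [vec, h, sub_smul]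

theorem vec_reflect {n : ℕ} {j : Fin X.rank}
    (h : ∀ i, X.coef (X.reflect n j) i = X.coef n i - if i = j then X.pair n j else 0) :
    ν.vec (X.reflect n j) = P.reflection (ν.node j) (ν.vec n) := by
  rw [ν.vec_eq_sub h, P.reflection_apply, coroot_vec]

/-- The vectors with codes in `R` are roots, by induction: a simple reflection lowers the code. -/
theorem exists_root_eq_vec {R : List ℕ} (hR : X.IsRootList R) {n : ℕ} (hn : n ∈ R) :
    ∃ i, P.root i = ν.vec n := by
  induction n using Nat.strong_induction_on with
  | _ n ih =>
    obtain ⟨j, hj⟩ := hR.2.2.2 n hn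
    rcases hR.2.2.1 n hn j with rfl | ⟨h₁, h₂⟩
    · exact ⟨_, (ν.vec_simpleCode hR j).symm⟩
    rcases hj with rfl | hj
    · exact ⟨_, (ν.vec_simpleCode hR j).symm⟩
    obtain ⟨i, hi⟩ := ih _ hj h₁
    refine ⟨P.reflectionPerm (ν.node j) i, ?_⟩
    rw [P.root_reflectionPerm, hi, ν.vec_reflect h₂, P.reflection_same]

/-- All roots are obtained, since the listed ones and their negatives are stable under simple
reflections. -/
theorem exists_vec_eq_root [Finite ι] [P.IsRootSystem] [P.IsCrystallographic] [P.IsReduced]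
    {R : List ℕ} (hR : X.IsRootList R) (i : ι) :
    ∃ n ∈ R, P.root i = ν.vec n ∨ P.root i = -ν.vec n := by
  refine b.induction_reflect i (p := fun i => ∃ n ∈ R, P.root i = ν.vec n ∨ P.root i = -ν.vec n)
    ?_ ?_ ?_
  · rintro i ⟨n, hn, h⟩
    refine ⟨n, hn, ?_⟩
    rw [P.root_reflectionPerm, P.reflection_apply_self, neg_eq_iff_eq_neg, neg_inj]
    exact h.symm
  · intro j hj
    obtain ⟨k, rfl⟩ := ν.exists_node hj
    exact ⟨_, (hR.1 k).1, .inl (ν.vec_simpleCode hR k).symm⟩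
  · rintro i j ⟨n, hn, h⟩ hj
    obtain ⟨k, rfl⟩ := ν.exists_node hj
    rw [P.root_reflectionPerm]
    rcases hR.2.2.1 n hn k with rfl | ⟨h₁, h₂⟩
    · refine ⟨_, hn, ?_⟩
      rw [ν.vec_simpleCode hR] at h ⊢
      rcases h with h | h
      · rw [h, P.reflection_apply_self]
        exact .inr rfl
      · rw [h, map_neg, P.reflection_apply_self, neg_neg]
        exact .inl rfl
    · refine ⟨_, h₁, ?_⟩
      rw [ν.vec_reflect h₂]
      rcases h with h | h
      · exact .inl (by rw [h])
      · exact .inr (by rw [h, map_neg])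

theorem height_eq [P.IsRootSystem] [P.IsCrystallographic] {n : ℕ} {i : ι}
    (hi : P.root i = ν.vec n) : b.height i = X.heightCode n := by
  classical
  set H : V →ₗ[ℝ] ℝ := b.toWeightBasis.constr ℝ fun _ => (1 : ℝ)
  have hH : ∀ j ∈ b.support, H (P.root j) = 1 := by
    intro j hj
    have := b.toWeightBasis.constr_basis ℝ (fun _ => (1 : ℝ)) ⟨j, hj⟩
    rwa [RootPairing.Base.toWeightBasis_apply] at this
  have h := apply_eq_height H hH i
  rw [hi, vec, map_sum] at h
  simp only [map_smul, smul_eq_mul, hH _ (ν.node_mem _), mul_one] at h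
  simp only [DynkinType.heightCode]
  exact_mod_cast h.symm

end Labelling

end SmallWeights

namespace SmallWeights

/-! ### Numerical criteria for canonical block decompositions -/

namespace DynkinType

variable (X : DynkinType)

/-- The pairings with the simple coroots of the sum of the roots with codes in `e`. -/
def labels (e : List ℕ) (j : Fin X.rank) : ℤ := (e.map fun n => X.pair n j).sum

/-- The invariant form, evaluated on the sum of the roots with codes in `e` and the weight with
labels `m`. -/
def total (e : List ℕ) (m : Fin X.rank → ℤ) : ℤ := (e.map fun n => X.form n m).sum

/-- The largest value of the invariant form with the weight with labels `m` on the roots in `R`. -/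
def maxForm (R : List ℕ) (m : Fin X.rank → ℤ) : ℤ := (R.map fun n => X.form n m).foldr max 0

/-- The numerical conditions which roots of minimal expressions with `k` terms satisfy: the form
`(λ, ·)` takes values on them which are large compared to their length, and so large that `k - 1`
further roots suffice to reach `(λ, λ) = t`. -/
def IsCandidate (R : List ℕ) (m : Fin X.rank → ℤ) (t : ℤ) (k n : ℕ) : Prop :=
  X.norm n ≤ X.form n m ∧ t ≤ X.form n m + (k - 1) * X.maxForm R m

instance (R : List ℕ) (m : Fin X.rank → ℤ) (t : ℤ) (k n : ℕ) :
    Decidable (X.IsCandidate R m t k n) := by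
  unfold IsCandidate
  infer_instance

/-- The block `B` has smaller height than all other blocks which can be formed from candidates. -/
def IsLowest (R : List ℕ) (m : Fin X.rank → ℤ) (t : ℤ) (k : ℕ) : List ℕ → Prop
  | [n₀] => ∀ n ∈ R, X.IsCandidate R m t k n → n = n₀ ∨ X.heightCode n₀ < X.heightCode n
  | [n₁, n₂] => (∃ j, X.pair n₁ j ≠ X.pair n₂ j) ∧ 0 < X.form n₁ (X.pair n₂) ∧
      X.heightCode n₁ ≤ X.heightCode n₂ ∧
      ∀ n ∈ R, X.IsCandidate R m t k n → 2 * X.form n m = 3 * X.norm n ∧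
        (n = n₁ ∨ n = n₂ ∨ X.heightCode n₂ < X.heightCode n)
  | _ => False

instance (R : List ℕ) (m : Fin X.rank → ℤ) (t : ℤ) (k : ℕ) (B : List ℕ) :
    Decidable (X.IsLowest R m t k B) := by
  unfold IsLowest
  split <;> infer_instance

/-- A finite set of conditions which ensure that the sum of the blocks in `Bs` has `Bs` as its only
canonical block decomposition, the last block being the first entry. -/
def IsCanonicalCode (R : List ℕ) : List (List ℕ) → Prop
  | [] => True
  | bl :: Bs =>
    (∀ n ∈ R, 0 ≤ X.form n (X.labels (bl ++ Bs.flatten))) ∧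
    ((bl ++ Bs.flatten).length - 1 : ℤ) * X.maxForm R (X.labels (bl ++ Bs.flatten)) <
      X.total (bl ++ Bs.flatten) (X.labels (bl ++ Bs.flatten)) ∧
    (∀ n ∈ bl, n ∈ R ∧ X.form n (X.labels Bs.flatten) = 0) ∧
    X.IsLowest R (X.labels (bl ++ Bs.flatten))
      (X.total (bl ++ Bs.flatten) (X.labels (bl ++ Bs.flatten))) (bl ++ Bs.flatten).length bl ∧
    IsCanonicalCode R Bs

instance decidableIsCanonicalCode (R : List ℕ) : (Bs : List (List ℕ)) →
    Decidable (X.IsCanonicalCode R Bs)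
  | [] => isTrue trivial
  | bl :: Bs => by
    have := decidableIsCanonicalCode R Bs
    unfold IsCanonicalCode
    infer_instance

variable {X}

theorem form_le_maxForm {R : List ℕ} (m : Fin X.rank → ℤ) {n : ℕ} (hn : n ∈ R) :
    X.form n m ≤ X.maxForm R m := by
  induction R with
  | nil => simp at hn
  | cons a R ih =>
    rw [maxForm, List.map_cons, List.foldr_cons]
    rcases List.mem_cons.1 hn with rfl | hn
    · exact le_max_left _ _
    · exact (ih hn).trans (le_max_right _ _)

theorem maxForm_nonneg (R : List ℕ) (m : Fin X.rank → ℤ) : 0 ≤ X.maxForm R m := by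
  cases R with
  | nil => simp [maxForm]
  | cons a R =>
    induction R generalizing a with
    | nil => simp [maxForm]
    | cons c R ih =>
      rw [maxForm, List.map_cons, List.foldr_cons]
      exact (ih c).trans (le_max_right _ _)

theorem IsCanonicalCode.mem {R : List ℕ} {Bs : List (List ℕ)} (h : X.IsCanonicalCode R Bs) :
    ∀ n ∈ Bs.flatten, n ∈ R := by
  induction Bs with
  | nil => simp
  | cons bl Bs ih =>
    intro n hn
    rw [List.flatten_cons, List.mem_append] at hn
    exact hn.elim (fun hn => (h.2.2.1 n hn).1) (ih h.2.2.2.2 n)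

end DynkinType

/-- A variant of `IsExpression.apply_le` which isolates one term. -/
theorem IsExpression.apply_le_add {ι V N : Type*} [AddCommGroup V] [Module ℝ V] [AddCommGroup N]
    [Module ℝ N] {P : RootPairing ι ℝ V N} {l : V} {e : Multiset ι} (he : IsExpression P l e)
    {f : V →ₗ[ℝ] ℝ} {c : ℝ} (hf : ∀ i, f (P.root i) ≤ c) {i : ι} (hi : i ∈ e) :
    f l ≤ f (P.root i) + (e.card - 1) * c := by
  classical
  have h : IsExpression P (l - P.root i) (e.erase i) := by
    have := he
    rw [IsExpression, ← Multiset.cons_erase hi, Multiset.map_cons, Multiset.sum_cons] at this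
    rw [IsExpression, ← this, add_sub_cancel_left]
  have h := h.apply_le hf
  rw [Multiset.card_erase_of_mem hi, map_sub] at h
  have : 1 ≤ e.card := Multiset.card_pos.2 (by rintro rfl; simp at hi)
  rw [Nat.pred_eq_sub_one, Nat.cast_sub this] at h
  push_cast at h
  linarith

variable {ι V N : Type*} [AddCommGroup V] [Module ℝ V] [AddCommGroup N] [Module ℝ N]
  {P : RootPairing ι ℝ V N}

namespace Labelling

variable {b : P.Base} {X : DynkinType} (ν : Labelling b X)

/-- The sum of the roots with codes in `e`. -/
def weight (e : List ℕ) : V := (e.map ν.vec).sum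

theorem coroot_weight (e : List ℕ) (j : Fin X.rank) :
    P.coroot' (ν.node j) (ν.weight e) = X.labels e j := by
  simp only [weight, DynkinType.labels, map_list_sum, List.map_map, Int.cast_list_sum]
  congr 1
  refine List.map_congr_left fun n _ => ?_
  exact ν.coroot_vec n j

variable [Fintype ι] [P.IsRootSystem]

theorem exists_rootForm_vec (hX : X.IsProper) : ∃ c : ℝ, 0 < c ∧
    ∀ (n : ℕ) (x : V) (m : Fin X.rank → ℤ), (∀ j, P.coroot' (ν.node j) x = m j) →
      P.RootForm (ν.vec n) x = c * X.form n m := by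
  obtain ⟨c, hc, h⟩ := ν.exists_rootForm_eq hX
  refine ⟨c, hc, fun n x m hm => ?_⟩
  simp only [vec, map_sum, map_smul, LinearMap.sum_apply, LinearMap.smul_apply, smul_eq_mul, h, hm,
    DynkinType.form]
  push_cast
  rw [Finset.mul_sum]
  exact Finset.sum_congr rfl fun j _ => by ring

theorem norm_mul_coroot (hX : X.IsProper) {n : ℕ} {i : ι} (hi : P.root i = ν.vec n) {x : V}
    {m : Fin X.rank → ℤ} (hm : ∀ j, P.coroot' (ν.node j) x = m j) :
    X.norm n * P.coroot' i x = 2 * X.form n m := by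
  obtain ⟨c, hc, h⟩ := ν.exists_rootForm_vec hX
  have := rootForm_self_mul_coroot (P := P) i x
  rw [hi, h n _ _ (ν.coroot_vec n), h n x m hm] at this
  apply mul_left_cancel₀ hc.ne'
  rw [DynkinType.norm]
  linarith

theorem norm_pos (hX : X.IsProper) {n : ℕ} {i : ι} (hi : P.root i = ν.vec n) : 0 < X.norm n := by
  obtain ⟨c, hc, h⟩ := ν.exists_rootForm_vec hX
  have := rootForm_self_pos (P := P) i
  rw [hi, h n _ _ (ν.coroot_vec n)] at this
  exact_mod_cast (mul_pos_iff_of_pos_left hc).1 this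

theorem coroot_eq_zero (hX : X.IsProper) {n : ℕ} {i : ι} (hi : P.root i = ν.vec n) {x : V}
    {m : Fin X.rank → ℤ} (hm : ∀ j, P.coroot' (ν.node j) x = m j) (h : X.form n m = 0) :
    P.coroot' i x = 0 := by
  have h₁ := ν.norm_mul_coroot hX hi hm
  have h₂ : (X.norm n : ℝ) ≠ 0 := by exact_mod_cast (ν.norm_pos hX hi).ne'
  rw [h, Int.cast_zero, mul_zero] at h₁
  exact (mul_eq_zero.1 h₁).resolve_left h₂

variable [P.IsCrystallographic] [P.IsReduced]

/-- The number of terms of a sum of roots is minimal if the invariant form detects it. -/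
theorem hasLength_weight (hX : X.IsProper) {R : List ℕ} (hR : X.IsRootList R) {e : List ℕ}
    (he : ∀ n ∈ e, n ∈ R) (h₀ : ∀ n ∈ R, 0 ≤ X.form n (X.labels e))
    (h : (e.length - 1 : ℤ) * X.maxForm R (X.labels e) < X.total e (X.labels e)) :
    HasLength P (ν.weight e) e.length ∧
      ∀ e', IsMinimalExpression P (ν.weight e) e' → ∀ i ∈ e', ∃ n ∈ R, P.root i = ν.vec n ∧
        X.IsCandidate R (X.labels e) (X.total e (X.labels e)) e.length n := by
  obtain ⟨c, hc, hform⟩ := ν.exists_rootForm_vec hX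
  set l := ν.weight e with hl
  set m := X.labels e with hm
  have hlm : ∀ j, P.coroot' (ν.node j) l = m j := ν.coroot_weight e
  have hf : ∀ n, P.RootForm.flip l (ν.vec n) = c * X.form n m := fun n => hform n l m hlm
  have hmax : (0 : ℝ) ≤ c * X.maxForm R m :=
    mul_nonneg hc.le (by exact_mod_cast DynkinType.maxForm_nonneg R m)
  have hle : ∀ i, P.RootForm.flip l (P.root i) ≤ c * X.maxForm R m := by
    intro i
    obtain ⟨n, hn, hi | hi⟩ := ν.exists_vec_eq_root hR i
    · rw [hi, hf]
      exact mul_le_mul_of_nonneg_left (by exact_mod_cast DynkinType.form_le_maxForm m hn) hc.le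
    · rw [hi, map_neg, hf]
      have : 0 ≤ c * X.form n m := mul_nonneg hc.le (by exact_mod_cast h₀ n hn)
      linarith
  have htotal : P.RootForm.flip l l = c * X.total e m := by
    have hl' : P.RootForm.flip l l = P.RootForm.flip l (e.map ν.vec).sum := rfl
    rw [hl', map_list_sum, DynkinType.total, Int.cast_list_sum, List.map_map, List.map_map,
      ← List.sum_map_mul_left]
    congr 1
    exact List.map_congr_left fun n _ => hf n
  obtain ⟨e₁, he₁, hcard⟩ : ∃ e₁ : List ι, e₁.map P.root = e.map ν.vec ∧ e₁.length = e.length := by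
    clear_value l m
    clear hl hm h htotal
    induction e with
    | nil => exact ⟨[], rfl, rfl⟩
    | cons n e ih =>
      obtain ⟨e₁, h₁, h₂⟩ := ih fun n hn => he n (List.mem_cons_of_mem _ hn)
      obtain ⟨i, hi⟩ := ν.exists_root_eq_vec hR (he n List.mem_cons_self)
      exact ⟨i :: e₁, by simp [hi, h₁], by simp [h₂]⟩
  have hexp : IsExpression P l (e₁ : Multiset ι) := by
    rw [IsExpression, Multiset.map_coe, Multiset.sum_coe, he₁, hl, weight]
  have hlen : HasLength P l e.length := by
    have := hasLength_of_functional hexp (P.RootForm.flip l) hmax hle (by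
      rw [htotal, Multiset.coe_card, hcard]
      have : ((e.length - 1) * X.maxForm R m : ℝ) < X.total e m := by exact_mod_cast h
      have := mul_lt_mul_of_pos_left this hc
      linarith)
    rwa [Multiset.coe_card, hcard] at this
  refine ⟨hlen, fun e' he' i hi => ?_⟩
  -- A term of a minimal expression pairs to at least `2` with its coroot, hence is positive.
  have h2 := he'.two_le_coroot hi
  obtain ⟨n, hn, hin | hin⟩ := ν.exists_vec_eq_root hR i
  · refine ⟨n, hn, hin, ?_, ?_⟩
    · have h₁ := ν.norm_mul_coroot hX hin hlm
      have h₃ : (0 : ℝ) < X.norm n := by exact_mod_cast ν.norm_pos hX hin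
      have : (X.norm n : ℝ) ≤ X.form n m := by nlinarith
      exact_mod_cast this
    · have h₁ := he'.1.apply_le_add hle hi
      rw [htotal, hin, hf, hlen.card_eq he'] at h₁
      have : (X.total e m : ℝ) ≤ X.form n m + (e.length - 1) * X.maxForm R m := by
        apply le_of_mul_le_mul_left _ hc
        linarith
      exact_mod_cast this
  · exfalso
    have h₁ := rootForm_self_mul_coroot (P := P) i l
    have h₃ : P.RootForm (P.root i) l = -(c * X.form n m) := by
      rw [hin, map_neg, LinearMap.neg_apply, hform n l m hlm]
    have h₄ : 0 ≤ c * X.form n m := mul_nonneg hc.le (by exact_mod_cast h₀ n hn)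
    have h₅ := rootForm_self_pos (P := P) i
    rw [h₃] at h₁
    nlinarith

/-- Soundness of the numerical conditions for canonical block decompositions. -/
theorem isCanonical_iff_of_code [DecidableEq ι] (hX : X.IsProper) {R : List ℕ}
    (hR : X.IsRootList R) {idx : ℕ → ι} (hidx : ∀ n ∈ R, P.root (idx n) = ν.vec n)
    {Bs : List (List ℕ)} (h : X.IsCanonicalCode R Bs) (M : List (Finset ι)) :
    IsCanonical b (ν.weight Bs.flatten) M ↔
      M = (Bs.map fun B => (B.map idx).toFinset).reverse := by
  induction Bs generalizing M with
  | nil => simpa [weight] using isCanonical_zero_iff M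
  | cons B Bs ih =>
    have hmem := h.mem
    obtain ⟨h₀, hlt, hB, hlow, hBs⟩ := h
    have hlen : HasLength P (ν.weight Bs.flatten) Bs.flatten.length := by
      cases Bs with
      | nil => simpa [weight] using hasLength_zero
      | cons B' Bs => exact (ν.hasLength_weight hX hR hBs.mem hBs.1 hBs.2.1).1
    obtain ⟨hlen', hcand⟩ := ν.hasLength_weight hX hR hmem h₀ hlt
    rw [List.flatten_cons] at hlen' hcand ⊢
    have hsub : ν.weight (B ++ Bs.flatten) - (B.map ν.vec).sum = ν.weight Bs.flatten := by
      simp [weight]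
    have horth : ∀ n ∈ B, P.coroot' (idx n) (ν.weight Bs.flatten) = 0 := fun n hn =>
      ν.coroot_eq_zero hX (hidx n (hB n hn).1) (ν.coroot_weight _) (hB n hn).2
    have hidx_eq : ∀ {n i}, n ∈ R → P.root i = ν.vec n → i = idx n := fun hn hi =>
      P.root.injective (hi.trans (hidx _ hn).symm)
    rw [List.map_cons, List.reverse_cons]
    match B, hlow with
    | [n₀], hlow =>
      have hn₀ := (hB n₀ List.mem_cons_self).1
      simp only [List.map_cons, List.map_nil, List.sum_singleton, ← hidx _ hn₀] at hsub
      refine isCanonical_snoc_singleton_iff (k := Bs.flatten.length) ?_ ?_ ?_ ?_ ?_ ?_ M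
      · rw [hsub]; exact horth n₀ List.mem_cons_self
      · rwa [hsub]
      · simpa [add_comm] using hlen'
      · rw [ν.height_eq (hidx _ hn₀)]; exact hR.2.1 n₀ hn₀
      · intro e he i hi
        obtain ⟨n, hn, hin, hc⟩ := hcand e he i hi
        rcases hlow n hn hc with rfl | hlow
        · exact .inl (hidx_eq hn hin)
        · right
          rwa [ν.height_eq (hidx _ hn₀), ν.height_eq hin]
      · rw [hsub]; exact ih hBs
    | [n₁, n₂], ⟨⟨j, hne⟩, hpos, h₁₂, hlow⟩ =>
      have hn₁ := (hB n₁ (by simp)).1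
      have hn₂ := (hB n₂ (by simp)).1
      simp only [List.map_cons, List.map_nil, List.sum_cons, List.sum_nil, add_zero,
        ← hidx _ hn₁, ← hidx _ hn₂] at hsub
      have hpos' : 0 < P.pairing (idx n₂) (idx n₁) := by
        have h₁ := ν.norm_mul_coroot hX (hidx _ hn₁) (x := P.root (idx n₂)) (m := X.pair n₂)
          fun j => by rw [hidx _ hn₂]; exact ν.coroot_vec n₂ j
        rw [P.root_coroot'_eq_pairing] at h₁
        have h₂ : (0 : ℝ) < X.norm n₁ := by exact_mod_cast ν.norm_pos hX (hidx _ hn₁)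
        have h₃ : (0 : ℝ) < X.form n₁ (X.pair n₂) := by exact_mod_cast hpos
        by_contra hle
        nlinarith
      have hfin : (List.map idx [n₁, n₂]).toFinset = {idx n₁, idx n₂} := by simp
      rw [hfin]
      refine isCanonical_snoc_pair_iff (k := Bs.flatten.length) ?_ (pairing_pos_comm.1 hpos')
        ?_ ?_ ?_ ?_ ?_ ?_ ?_ ?_ M
      · intro h
        have h := congrArg (fun i => P.coroot' (ν.node j) (P.root i)) h
        simp only [hidx _ hn₁, hidx _ hn₂, coroot_vec] at h
        exact hne (by exact_mod_cast h)
      · rw [hsub]; exact horth n₁ (by simp)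
      · rw [hsub]; exact horth n₂ (by simp)
      · rwa [hsub]
      · exact hlen'
      · rw [ν.height_eq (hidx _ hn₁)]; exact hR.2.1 n₁ hn₁
      · rwa [ν.height_eq (hidx _ hn₁), ν.height_eq (hidx _ hn₂)]
      · intro e he i hi
        obtain ⟨n, hn, hin, hc⟩ := hcand e he i hi
        obtain ⟨h3, hlow⟩ := hlow n hn hc
        constructor
        · have h₁ := ν.norm_mul_coroot hX hin (ν.coroot_weight (n₁ :: n₂ :: Bs.flatten))
          have h₂ : (X.norm n : ℝ) ≠ 0 := by exact_mod_cast (ν.norm_pos hX hin).ne'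
          have h₃ : (2 * X.form n (X.labels (n₁ :: n₂ :: Bs.flatten)) : ℝ) = 3 * X.norm n := by
            exact_mod_cast h3
          apply mul_left_cancel₀ h₂
          refine h₁.trans ?_
          rw [h₃, mul_comm]
        · rcases hlow with rfl | rfl | hlow
          · exact .inl (hidx_eq hn hin)
          · exact .inr (.inl (hidx_eq hn hin))
          · right; right
            rwa [ν.height_eq (hidx _ hn₂), ν.height_eq hin]
      · rw [hsub]; exact ih hBs

end Labelling

end SmallWeights

namespace SmallWeights

/-! ### Numerical criteria for cascades -/

namespace DynkinType

instance decidableIsProper : (X : DynkinType) → Decidable X.IsProper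
  | A n => inferInstanceAs (Decidable (1 ≤ n))
  | B n => inferInstanceAs (Decidable (2 ≤ n))
  | C n => inferInstanceAs (Decidable (3 ≤ n))
  | D n => inferInstanceAs (Decidable (4 ≤ n))
  | E6 => isTrue trivial
  | E7 => isTrue trivial
  | E8 => isTrue trivial
  | F4 => isTrue trivial
  | G2 => isTrue trivial

instance decidableCartanEq {X Y : DynkinType} (g : Fin Y.rank → Fin X.rank) :
    Decidable (∀ i j, X.cartan (g i) (g j) = Y.cartan i j) :=
  @Nat.decidableForallFin _ _ fun i => @Nat.decidableForallFin _ _ fun j =>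
    decidableEntryEq X.cartan (g i) (g j) (Y.cartan i j)

/-- A step of the cascade construction: a component of the given type, with numbered nodes, and a
block in this component with its mark. -/
structure CascadeStep (X : DynkinType) where
  /-- The Dynkin type of the component. -/
  type : DynkinType
  /-- The nodes of the component. -/
  node : Fin type.rank → Fin X.rank
  /-- The mark of the block. -/
  mark : Mark
  /-- The codes of the roots of the block, in order of increasing height. -/
  block : List ℕ

variable (X : DynkinType)

/-- The length condition expressed by a mark. -/
def IsLengthMarkCode (R : List ℕ) (n₀ : ℕ) : Mark → Prop
  | .one => ∀ n ∈ R, X.norm n = X.norm n₀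
  | .oneShort => (∃ n ∈ R, X.norm n ≠ X.norm n₀) ∧ ∀ n ∈ R, X.norm n₀ ≤ X.norm n
  | .oneLong => (∃ n ∈ R, X.norm n ≠ X.norm n₀) ∧ ∀ n ∈ R, X.norm n ≤ X.norm n₀
  | .two => False

instance (R : List ℕ) (n₀ : ℕ) (a : Mark) : Decidable (X.IsLengthMarkCode R n₀ a) := by
  unfold IsLengthMarkCode
  split <;> infer_instance

variable {X}

/-- The root with code `n` is a dominant root of the component of the step `s`. -/
def CascadeStep.IsDominantCode (s : CascadeStep X) (n : ℕ) : Prop :=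
  (∀ j, (∀ k, s.node k ≠ j) → X.coef n j = 0) ∧ ∀ k, 0 ≤ X.pair n (s.node k)

instance (s : CascadeStep X) (n : ℕ) : Decidable (s.IsDominantCode n) := by
  unfold CascadeStep.IsDominantCode
  infer_instance

/-- The block of the step `s` is a dominant block of its component. -/
def CascadeStep.IsBlockCode (R : List ℕ) (s : CascadeStep X) : Prop :=
  match s.block, s.mark with
  | [n], a => n ∈ R ∧ s.IsDominantCode n ∧ X.IsLengthMarkCode R n a
  | [n', n], .two => (∀ i j, i ≠ j → s.type.cartan i j = 0 ∨ s.type.cartan i j = -1) ∧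
      n ∈ R ∧ n' ∈ R ∧ s.IsDominantCode n ∧ ∃ k, X.pair n (s.node k) ≠ 0 ∧
        ∀ i, X.coef n' i = X.coef n i - if i = s.node k then 1 else 0
  | _, _ => False

instance (R : List ℕ) (s : CascadeStep X) : Decidable (s.IsBlockCode R) := by
  unfold CascadeStep.IsBlockCode
  split <;> infer_instance

/-- The nodes of the component of `s` which are orthogonal to the block of `s`. -/
def CascadeStep.rest (s : CascadeStep X) : List (Fin X.rank) :=
  (List.ofFn s.node).filter fun j => ∀ n ∈ s.block, X.pair n j = 0

/-- The steps form a cascade which starts with the parabolic subsystem with nodes `Γ`. -/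
def IsCascadeCode (R : List ℕ) : List (Fin X.rank) → List (CascadeStep X) → Prop
  | _, [] => True
  | Γ, s :: ss =>
    (s.type.IsProper ∧ (∀ i j, s.node i = s.node j → i = j) ∧ 0 < s.type.rank ∧
      (∀ k, s.node k ∈ Γ) ∧ (∀ i j, X.cartan (s.node i) (s.node j) = s.type.cartan i j) ∧
      (∀ k, ∀ j ∈ Γ, (∀ k', s.node k' ≠ j) → X.cartan (s.node k) j = 0) ∧ s.IsBlockCode R) ∧
    IsCascadeCode R s.rest ss

instance decidableIsCascadeCode (R : List ℕ) : (Γ : List (Fin X.rank)) →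
    (ss : List (CascadeStep X)) → Decidable (IsCascadeCode R Γ ss)
  | _, [] => isTrue trivial
  | _, s :: ss => by
    have := decidableIsCascadeCode R s.rest ss
    unfold IsCascadeCode
    infer_instance

end DynkinType

variable {ι V N : Type*} [AddCommGroup V] [Module ℝ V] [AddCommGroup N] [Module ℝ N]
  {P : RootPairing ι ℝ V N}

namespace Labelling

variable {b : P.Base} {X : DynkinType} (ν : Labelling b X)

theorem isDominantRoot_of_code {s : DynkinType.CascadeStep X} {n : ℕ} {i : ι}
    (hi : P.root i = ν.vec n) (h : s.IsDominantCode n) :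
    IsDominantRoot P (Set.range fun k => ν.node (s.node k)) i := by
  constructor
  · rw [InParabolic, hi, vec]
    refine Submodule.sum_mem _ fun j _ => ?_
    by_cases hj : ∃ k, s.node k = j
    · obtain ⟨k, rfl⟩ := hj
      exact Submodule.smul_mem _ _ (Submodule.subset_span ⟨_, ⟨k, rfl⟩, rfl⟩)
    · rw [h.1 j (not_exists.1 hj), Int.cast_zero, zero_smul]
      exact Submodule.zero_mem _
  · rintro _ ⟨k, rfl⟩
    rw [← P.root_coroot'_eq_pairing, hi, coroot_vec]
    exact_mod_cast h.2 k

theorem pairing_eq_zero {i j : Fin X.rank} (h : X.cartan i j = 0) :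
    P.pairing (ν.node i) (ν.node j) = 0 := by
  rw [ν.pairing, h, Int.cast_zero]

theorem hasType_range [P.IsCrystallographic] {Y : DynkinType} (hY : Y.IsProper)
    {g : Fin Y.rank → Fin X.rank} (hg : Function.Injective g)
    (h : ∀ i j, X.cartan (g i) (g j) = Y.cartan i j) :
    HasType P (Set.range fun k => ν.node (g k)) Y := by
  refine ⟨hY, Equiv.ofInjective (fun k => ν.node (g k)) (ν.injective.comp hg), fun i j => ?_⟩
  rw [Equiv.ofInjective_apply, Equiv.ofInjective_apply, ← h]
  have := ν.pairing (g i) (g j)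
  rw [← P.algebraMap_pairingIn ℤ] at this
  have h' : ((P.pairingIn ℤ (ν.node (g i)) (ν.node (g j)) : ℤ) : ℝ) = X.cartan (g i) (g j) := this
  exact_mod_cast h'

variable [Fintype ι] [P.IsRootSystem]

theorem rootForm_eq_norm (hX : X.IsProper) : ∃ c : ℝ, 0 < c ∧ ∀ (n : ℕ) (i : ι),
    P.root i = ν.vec n ∨ P.root i = -ν.vec n →
      P.RootForm (P.root i) (P.root i) = c * X.norm n := by
  obtain ⟨c, hc, h⟩ := ν.exists_rootForm_vec hX
  refine ⟨c, hc, fun n i hi => ?_⟩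
  have := h n _ _ (ν.coroot_vec n)
  rcases hi with hi | hi <;> simp [hi, this, DynkinType.norm]

variable [P.IsCrystallographic]

theorem lengthMark_of_code [P.IsReduced] (hX : X.IsProper) {R : List ℕ} (hR : X.IsRootList R)
    {n₀ : ℕ} {i₀ : ι} (hi₀ : P.root i₀ = ν.vec n₀) {a : Mark} (h : X.IsLengthMarkCode R n₀ a) :
    a.LengthMark P i₀ := by
  obtain ⟨c, hc, hform⟩ := ν.rootForm_eq_norm hX
  have h₀ := hform n₀ i₀ (.inl hi₀)
  have hnot : (∃ n ∈ R, X.norm n ≠ X.norm n₀) → ¬ OneLength P := by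
    rintro ⟨n, hn, hne⟩ hone
    obtain ⟨i, hi⟩ := ν.exists_root_eq_vec hR hn
    have := hone i i₀
    rw [h₀, hform n i (.inl hi)] at this
    exact hne (by exact_mod_cast mul_left_cancel₀ hc.ne' this)
  match a, h with
  | .one, h =>
    have : ∀ i, P.RootForm (P.root i) (P.root i) = c * X.norm n₀ := by
      intro i
      obtain ⟨n, hn, hi⟩ := ν.exists_vec_eq_root hR i
      rw [hform n i hi, h n hn]
    exact fun i j => (this i).trans (this j).symm
  | .oneShort, h =>
    refine ⟨hnot h.1, fun i => ?_⟩
    obtain ⟨n, hn, hi⟩ := ν.exists_vec_eq_root hR i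
    rw [h₀, hform n i hi]
    exact mul_le_mul_of_nonneg_left (by exact_mod_cast h.2 n hn) hc.le
  | .oneLong, h =>
    refine ⟨hnot h.1, fun i => ?_⟩
    obtain ⟨n, hn, hi⟩ := ν.exists_vec_eq_root hR i
    rw [h₀, hform n i hi]
    exact mul_le_mul_of_nonneg_left (by exact_mod_cast h.2 n hn) hc.le

/-- Soundness of the numerical conditions for cascades. -/
theorem isCascade_of_code [P.IsReduced] [DecidableEq ι] (hX : X.IsProper) {R : List ℕ}
    (hR : X.IsRootList R) {idx : ℕ → ι} (hidx : ∀ n ∈ R, P.root (idx n) = ν.vec n)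
    {Γ : List (Fin X.rank)} {ss : List (DynkinType.CascadeStep X)}
    (h : DynkinType.IsCascadeCode R Γ ss) :
    IsCascade P (ν.node '' {j | j ∈ Γ}) (ss.map fun s => (s.block.map idx).toFinset)
      (ss.map fun s => (s.mark, s.type)) := by
  induction ss generalizing Γ with
  | nil => exact .nil
  | cons s ss ih =>
    obtain ⟨⟨hprop, hinj, hpos, hsub, hcartan, horth, hblock⟩, hrest⟩ := h
    have hsub' : (Set.range fun k => ν.node (s.node k)) ⊆ ν.node '' {j | j ∈ Γ} := by
      rintro _ ⟨k, rfl⟩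
      exact ⟨_, hsub k, rfl⟩
    have hT := ν.hasType_range hprop hinj hcartan
    have hC := hT.isComponent hsub' ⟨_, ⟨⟨0, hpos⟩, rfl⟩⟩ (by
      rintro _ ⟨k, rfl⟩ _ ⟨⟨j, hj, rfl⟩, hjC⟩
      exact ν.pairing_eq_zero (horth k j hj fun k' hk' => hjC ⟨k', by rw [← hk']⟩))
    have hR' : ∀ n ∈ s.block, n ∈ R := by
      unfold DynkinType.CascadeStep.IsBlockCode at hblock
      split at hblock
      · next hb => simpa [hb] using hblock.1
      · next hb _ => simpa [hb] using ⟨hblock.2.2.1, hblock.2.1⟩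
      · exact hblock.elim
    have hΓ : orthogonalNodes P (Set.range fun k => ν.node (s.node k))
        (s.block.map idx).toFinset = ν.node '' {j | j ∈ s.rest} := by
      ext i
      have key : ∀ j, (∀ i ∈ (s.block.map idx).toFinset, P.pairing (ν.node j) i = 0) ↔
          ∀ n ∈ s.block, X.pair n j = 0 := by
        intro j
        simp only [List.mem_toFinset, List.mem_map, forall_exists_index, and_imp,
          forall_apply_eq_imp_iff₂]
        refine forall₂_congr fun n hn => ?_
        rw [P.pairing_eq_zero_iff, ← P.root_coroot'_eq_pairing, hidx n (hR' n hn), coroot_vec]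
        exact_mod_cast Iff.rfl
      constructor
      · rintro ⟨⟨k, rfl⟩, hk⟩
        refine ⟨s.node k, ?_, rfl⟩
        simpa [DynkinType.CascadeStep.rest] using (key _).1 hk
      · rintro ⟨j, hj, rfl⟩
        obtain ⟨⟨k, rfl⟩, hj⟩ : (∃ k, s.node k = j) ∧ ∀ n ∈ s.block, X.pair n j = 0 := by
          simpa [DynkinType.CascadeStep.rest] using hj
        exact ⟨⟨k, rfl⟩, (key _).2 hj⟩
    refine .cons hC hT ?_ (hΓ ▸ ih hrest)
    unfold DynkinType.CascadeStep.IsBlockCode at hblock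
    split at hblock
    · next n hb =>
      obtain ⟨hn, hdom, hlen⟩ := hblock
      refine .inl ⟨idx n, ν.isDominantRoot_of_code (hidx n hn) hdom, ?_, by simp [hb]⟩
      exact ν.lengthMark_of_code hX hR (hidx n hn) hlen
    · next n' n hb ha =>
      obtain ⟨hsl, hn, hn', hdom, k, hk, hcoef⟩ := hblock
      refine .inr ⟨ha, fun i j hij => hsl i j hij, idx n, idx n',
        ν.isDominantRoot_of_code (hidx n hn) hdom, ⟨ν.node (s.node k), ⟨k, rfl⟩, ?_, ?_⟩, ?_⟩
      · rw [← P.root_coroot'_eq_pairing, hidx n hn, coroot_vec]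
        exact_mod_cast hk
      · rw [hidx n hn, hidx n' hn', ν.vec_eq_sub hcoef, Int.cast_one, one_smul]
      · simp [hb, Set.pair_comm]
    · exact hblock.elim

end Labelling

end SmallWeights

namespace SmallWeights

/-! ### Classification from a certificate -/

/-- All sequences `[m₁, …, m_r]` of natural numbers with `k₁ m₁ + … + k_r m_r ≤ N`, for positive
`k_i`. -/
def boundedLabels : List ℕ → ℕ → List (List ℕ)
  | [], _ => [[]]
  | k :: ks, N =>
    (List.range (N / k + 1)).flatMap fun a => (boundedLabels ks (N - a * k)).map (a :: ·)

theorem ofFn_mem_boundedLabels {r : ℕ} (k m : Fin r → ℕ) (hk : ∀ i, 0 < k i) {N : ℕ}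
    (h : ∑ i, k i * m i ≤ N) : List.ofFn m ∈ boundedLabels (List.ofFn k) N := by
  induction r generalizing N with
  | zero => simp [boundedLabels]
  | succ r ih =>
    rw [Fin.sum_univ_succ] at h
    rw [List.ofFn_succ, List.ofFn_succ, boundedLabels, List.mem_flatMap]
    refine ⟨m 0, ?_, ?_⟩
    · rw [List.mem_range, Nat.lt_succ_iff, Nat.le_div_iff_mul_le (hk 0), mul_comm]
      omega
    · refine List.mem_map_of_mem (ih _ _ (fun i => hk i.succ) ?_)
      rw [mul_comm (m 0)]
      omega

namespace DynkinType

/-- The sum of the blocks of the steps of a cascade. -/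
def cascadeLabels {X : DynkinType} (w : List (CascadeStep X)) : Fin X.rank → ℤ :=
  X.labels (w.reverse.map CascadeStep.block).flatten

/-- The data from which the small dominant weights of a root system of type `X` can be read off. -/
structure Certificate (X : DynkinType) where
  /-- The codes of the positive roots. -/
  roots : List ℕ
  /-- The code of the dominant short root. -/
  shortRoot : ℕ
  /-- The only simple root which is not orthogonal to the dominant short root. -/
  shortNode : Fin X.rank
  /-- A number which divides the value of `functional` on the root lattice; this is `1` if the root
  lattice is the whole weight lattice. -/
  modulus : ℤ
  /-- A linear functional of the labels. -/
  functional : Fin X.rank → ℤ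
  /-- A diagram automorphism. -/
  symm : Equiv.Perm (Fin X.rank)
  /-- The cascades, up to the diagram automorphism. -/
  weights : List (List (CascadeStep X))

variable {X : DynkinType}

/-- Validity of a single cascade: its sum is a small dominant weight, and its blocks form the
canonical block decomposition of this sum. -/
def Certificate.IsValidCascade (C : Certificate X) (w : List (CascadeStep X)) : Prop :=
  (∀ j, 0 ≤ cascadeLabels w j) ∧ (∃ j, cascadeLabels w j ≠ 0) ∧
  (∀ n ∈ C.roots, 0 ≤ X.form n (cascadeLabels w) ∧
    2 * X.form n (cascadeLabels w) ≤ 3 * X.norm n) ∧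
  X.IsCanonicalCode C.roots (w.reverse.map CascadeStep.block) ∧
  IsCascadeCode C.roots (List.finRange X.rank) w

instance (C : Certificate X) (w : List (CascadeStep X)) : Decidable (C.IsValidCascade w) := by
  unfold Certificate.IsValidCascade
  infer_instance

/-- The weight of the root lattice with labels `ms` is zero or the sum of a given cascade. -/
def Certificate.IsListed (C : Certificate X) (ms : List ℕ) : Prop :=
  C.modulus ∣ ∑ j : Fin X.rank, (ms.getD j 0 : ℤ) * C.functional j →
    (∀ j : Fin X.rank, ms.getD j 0 = 0) ∨ ∃ w ∈ C.weights,
      (∀ j : Fin X.rank, (ms.getD j 0 : ℤ) = cascadeLabels w j) ∨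
      ∀ j : Fin X.rank, (ms.getD (C.symm j) 0 : ℤ) = cascadeLabels w j

instance (C : Certificate X) (ms : List ℕ) : Decidable (C.IsListed ms) := by
  unfold Certificate.IsListed
  infer_instance

/-- The conditions on the auxiliary data, and completeness of the list of cascades. The last
condition runs over all dominant `l` with `(l, t^∨) ≤ 3` for the dominant short root `t`. -/
def Certificate.IsComplete (C : Certificate X) : Prop :=
  C.shortRoot ∈ C.roots ∧ X.norm C.shortRoot = 2 ∧
  (∀ j, 0 < X.coef C.shortRoot j) ∧
  (∀ j, j ≠ C.shortNode → X.pair C.shortRoot j = 0) ∧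
  (∀ i, C.modulus ∣ ∑ j, X.cartan i j * C.functional j) ∧
  (∀ i j, X.cartan (C.symm i) (C.symm j) = X.cartan i j) ∧
  ∀ ms ∈ boundedLabels
    (List.ofFn fun j => (X.coef C.shortRoot j * X.halfNorm j).toNat) 3, C.IsListed ms

instance (C : Certificate X) : Decidable C.IsComplete := by
  have := decidableCartanEq (C.symm : Fin X.rank → Fin X.rank)
  unfold Certificate.IsComplete
  infer_instance

end DynkinType

variable {ι V N : Type*} [AddCommGroup V] [Module ℝ V] [AddCommGroup N] [Module ℝ N]
  {P : RootPairing ι ℝ V N}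

theorem Labelling.vec_mem_rootSpan {b : P.Base} {X : DynkinType} (ν : Labelling b X) (n : ℕ) :
    ν.vec n ∈ P.rootSpan ℤ := by
  refine Submodule.sum_mem _ fun i _ => ?_
  rw [Int.cast_smul_eq_zsmul]
  exact Submodule.smul_mem _ _ (Submodule.subset_span ⟨_, rfl⟩)

theorem Labelling.exists_int_coord {b : P.Base} {X : DynkinType} (ν : Labelling b X) {l : V}
    (hl : l ∈ P.rootSpan ℤ) :
    ∃ z : Fin X.rank → ℤ, l = ∑ i, (z i : ℝ) • P.root (ν.node i) := by
  rw [RootPairing.rootSpan, ← b.span_int_root_support, ← ν.range_eq, ← Set.range_comp,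
    Submodule.mem_span_range_iff_exists_fun] at hl
  obtain ⟨z, rfl⟩ := hl
  exact ⟨z, by simp [Int.cast_smul_eq_zsmul]⟩

theorem Labelling.exists_labels {b : P.Base} {X : DynkinType} (ν : Labelling b X) {l : V}
    (hl : l ∈ P.rootSpan ℤ) (hd : IsDominant b l) :
    ∃ (z : Fin X.rank → ℤ) (m : Fin X.rank → ℕ), (∀ j, P.coroot' (ν.node j) l = m j) ∧
      ∀ j, (m j : ℤ) = ∑ i, z i * X.cartan i j := by
  obtain ⟨z, hz⟩ := ν.exists_int_coord hl
  have h : ∀ j, P.coroot' (ν.node j) l = (∑ i, z i * X.cartan i j : ℤ) := by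
    intro j
    simp [hz, ν.pairing]
  have h₀ : ∀ j, 0 ≤ ∑ i, z i * X.cartan i j := by
    intro j
    have := hd _ (ν.node_mem j)
    rw [h] at this
    exact_mod_cast this
  refine ⟨z, fun j => (∑ i, z i * X.cartan i j).toNat, fun j => ?_, fun j => ?_⟩
  · rw [h, ← Int.cast_natCast, Int.toNat_of_nonneg (h₀ j)]
  · exact Int.toNat_of_nonneg (h₀ j)

variable [Fintype ι] [P.IsRootSystem] [P.IsCrystallographic]

/-- The classification of small dominant weights follows from a valid certificate: the bound
`IsSmall.coroot_le_three` for the dominant short root leaves finitely many weights, and the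
certificate says that those in the root lattice are zero or sums of the given cascades. -/
theorem classification_of_certificate [P.IsReduced] {b : P.Base} {X : DynkinType}
    (hX : X.IsProper) (ν₀ : Labelling b X) (C : DynkinType.Certificate X)
    (hR : X.IsRootList C.roots) (hC : C.IsComplete) (hw : ∀ w ∈ C.weights, C.IsValidCascade w)
    (range_sym : {s | ∃ w ∈ C.weights, s = w.map fun s => (s.mark, s.type)} = X.symbols)
    (inj : (C.weights.map fun w => w.map fun s => (s.mark, s.type)).Nodup) :
    IsClassified b X := by
  classical
  refine classification_of_family (T := Fin C.weights.length)
    (fun t => DynkinType.cascadeLabels (C.weights.get t))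
    (fun t => (C.weights.get t).map fun s => (s.mark, s.type))
    (fun t => (hw _ (C.weights.get_mem t)).1) (fun t => (hw _ (C.weights.get_mem t)).2.1)
    ?_ ?_ ?_ ν₀ ?_
  · intro ν t
    obtain ⟨-, -, h₁, h₂, h₃⟩ := hw _ (C.weights.get_mem t)
    set w := C.weights.get t
    have hidx : ∀ n, ∃ i, n ∈ C.roots → P.root i = ν.vec n := by
      intro n
      by_cases hn : n ∈ C.roots
      · obtain ⟨i, hi⟩ := ν.exists_root_eq_vec hR hn
        exact ⟨i, fun _ => hi⟩
      · exact ⟨ν.node C.shortNode, fun h => absurd h hn⟩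
    choose idx hidx using hidx
    have hl : ∀ j, P.coroot' (ν.node j)
        (ν.weight (w.reverse.map DynkinType.CascadeStep.block).flatten) =
          DynkinType.cascadeLabels w j := ν.coroot_weight _
    refine ⟨ν.weight (w.reverse.map DynkinType.CascadeStep.block).flatten,
      w.map fun s => (s.block.map idx).toFinset, hl, ?_, fun i => ?_, fun M => ?_, ?_⟩
    · refine list_sum_mem fun v hv => ?_
      obtain ⟨n, -, rfl⟩ := List.mem_map.1 hv
      exact ν.vec_mem_rootSpan n
    · have key : ∀ n ∈ C.roots, ∀ i, P.root i = ν.vec n →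
          0 ≤ P.coroot' i (ν.weight (w.reverse.map DynkinType.CascadeStep.block).flatten) ∧
          P.coroot' i (ν.weight (w.reverse.map DynkinType.CascadeStep.block).flatten) ≤ 3 := by
        intro n hn i hi
        have h := ν.norm_mul_coroot hX hi hl
        have hpos : (0 : ℝ) < X.norm n := by exact_mod_cast ν.norm_pos hX hi
        have h3 : (2 * X.form n (DynkinType.cascadeLabels w) : ℝ) ≤ 3 * X.norm n := by
          exact_mod_cast (h₁ n hn).2
        have h0 : (0 : ℝ) ≤ X.form n (DynkinType.cascadeLabels w) := by
          exact_mod_cast (h₁ n hn).1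
        constructor
        · by_contra hlt
          push Not at hlt
          have := mul_neg_of_pos_of_neg hpos hlt
          rw [h] at this
          linarith
        · by_contra hlt
          push Not at hlt
          have := mul_lt_mul_of_pos_left hlt hpos
          rw [h] at this
          linarith
      obtain ⟨n, hn, hi | hi⟩ := ν.exists_vec_eq_root hR i
      · exact (key n hn i hi).2
      · obtain ⟨i', hi'⟩ := ν.exists_root_eq_vec hR hn
        have hneg : P.root (P.reflectionPerm i' i') = P.root i := by
          rw [P.root_reflectionPerm, P.reflection_apply_self, hi', hi]
        rw [← P.root.injective hneg, P.coroot'_reflectionPerm]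
        have := (key n hn i' hi').1
        simp only [LinearMap.comp_apply, LinearEquiv.coe_coe, P.reflection_apply, map_sub, map_smul,
          P.root_coroot'_eq_pairing, P.pairing_same, smul_eq_mul]
        linarith
    · rw [ν.isCanonical_iff_of_code hX hR hidx h₂, ← List.map_reverse, ← List.map_reverse,
        List.reverse_reverse, List.map_map]
      rfl
    · have := ν.isCascade_of_code hX hR hidx h₃
      have huniv : ν.node '' {j | j ∈ List.finRange X.rank} = b.support := by
        simp [← ν.range_eq, Set.image_univ]
      rwa [huniv] at this
  · intro l hd hs hne
    obtain ⟨hmem, hnorm, hcoef, horth, hmod, hsymm, hlist⟩ := hC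
    obtain ⟨z, m, hm, hz⟩ := ν₀.exists_labels hs.1 hd
    obtain ⟨t, ht⟩ := ν₀.exists_root_eq_vec hR hmem
    have h3 : P.coroot' t l ≤ 3 := by
      refine hs.coroot_le_three b (j₀ := ν₀.node C.shortNode) fun j hj hne => ?_
      obtain ⟨k, rfl⟩ := ν₀.exists_node hj
      rw [← P.root_coroot'_eq_pairing, ht, ν₀.coroot_vec,
        horth k fun h => hne (by rw [h]), Int.cast_zero]
    -- As the dominant short root `t` involves all simple roots, `(l, t^∨) ≤ 3` leaves finitely many
    -- weights `l`.
    have hform : X.form C.shortRoot (fun j => (m j : ℤ)) ≤ 3 := by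
      have := ν₀.norm_mul_coroot hX ht (m := fun j => (m j : ℤ)) (x := l) (by simpa using hm)
      rw [hnorm] at this
      push_cast at this
      have : (X.form C.shortRoot (fun j => (m j : ℤ)) : ℝ) ≤ 3 := by linarith
      exact_mod_cast this
    have hkpos : ∀ j, 0 < X.coef C.shortRoot j * X.halfNorm j := fun j =>
      mul_pos (hcoef j) (X.halfNorm_pos j)
    have hmemb := ofFn_mem_boundedLabels
      (fun j => (X.coef C.shortRoot j * X.halfNorm j).toNat) m
      (fun j => Int.lt_toNat.2 (hkpos j)) (N := 3) (by
        zify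
        refine le_trans (le_of_eq ?_) hform
        refine Finset.sum_congr rfl fun j _ => ?_
        rw [Int.toNat_of_nonneg (hkpos j).le, mul_assoc])
    have hget : ∀ j : Fin X.rank, (List.ofFn m).getD j 0 = m j := by
      intro j
      simp [List.getD_eq_getElem?_getD]
    have hl := hlist _ hmemb
    simp only [DynkinType.Certificate.IsListed, hget] at hl
    have hdvd : C.modulus ∣ ∑ j, (m j : ℤ) * C.functional j := by
      have : ∑ j, (m j : ℤ) * C.functional j =
          ∑ i, z i * ∑ j, X.cartan i j * C.functional j := by
        simp only [hz, Finset.sum_mul, Finset.mul_sum]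
        rw [Finset.sum_comm]
        simp only [mul_assoc]
      rw [this]
      exact Finset.dvd_sum fun i _ => Dvd.dvd.mul_left (hmod i) _
    rcases hl hdvd with h | ⟨w, hwC, h⟩
    · exact absurd (ν₀.ext_coroot (y := 0) fun k => by simp [hm, h]) hne
    · obtain ⟨t, rfl⟩ := List.get_of_mem hwC
      rcases h with h | h
      · exact ⟨ν₀, t, fun j => by rw [hm, ← h]; simp⟩
      · exact ⟨ν₀.comp C.symm hsymm, t, fun j => by
          rw [← h]; exact (hm (C.symm j)).trans (by simp)⟩
  · rw [← range_sym]
    ext s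
    constructor
    · rintro ⟨t, rfl⟩
      exact ⟨_, C.weights.get_mem t, rfl⟩
    · rintro ⟨w, hw, rfl⟩
      obtain ⟨t, rfl⟩ := List.get_of_mem hw
      exact ⟨t, rfl⟩
  · intro t t' h
    refine ⟨1, fun _ _ => rfl, fun j => ?_⟩
    obtain rfl : t = t' := by
      have := List.nodup_iff_injective_get.1 inj (a₁ := t.cast (by simp)) (a₂ := t'.cast (by simp))
        (by simpa using h)
      ext
      simpa using congrArg Fin.val this
    rfl

end SmallWeights

namespace SmallWeights

/-! ### The exceptional types -/

namespace DynkinType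

/-- The codes of the positive roots of type `E6`. -/
def rootsE6 : List ℕ :=
   [1, 10, 100, 1000, 10000, 100000, 11, 110, 1100, 10100, 101000, 111, 1110, 10110, 11100,
    101100, 1111, 10111, 11110, 101110, 111100, 11111, 11210, 101111, 111110, 11211, 111111,
    111210, 11221, 111211, 112210, 111221, 112211, 112221, 112321, 122321]

theorem isRootList_E6 : E6.IsRootList rootsE6 := by decide +kernel

/-- The cascades in type `E6`. -/
def certificateE6 : Certificate E6 where
  roots := rootsE6
  shortRoot := 122321
  shortNode := (1 : Fin 6)
  -- The labels of the elements of the root lattice satisfy a congruence modulo `3`.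
  modulus := 3
  functional := (![1, 0, -1, 0, 1, -1] : Fin 6 → ℤ)
  symm := (Equiv.swap 0 5 * Equiv.swap 2 4 : Equiv.Perm (Fin 6))
  weights := [
    [⟨E6, (fun i => i : Fin 6 → Fin 6), .one, [122321]⟩],
    [⟨E6, (fun i => i : Fin 6 → Fin 6), .one, [122321]⟩,
      ⟨A 5, (![0, 2, 3, 4, 5] : Fin 5 → Fin 6), .one, [101111]⟩],
    [⟨E6, (fun i => i : Fin 6 → Fin 6), .two, [112321, 122321]⟩],
    [⟨E6, (fun i => i : Fin 6 → Fin 6), .two, [112321, 122321]⟩,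
      ⟨A 2, (![4, 5] : Fin 2 → Fin 6), .one, [11]⟩],
    [⟨E6, (fun i => i : Fin 6 → Fin 6), .two, [112321, 122321]⟩,
      ⟨A 2, (![4, 5] : Fin 2 → Fin 6), .two, [1, 11]⟩]]

theorem isComplete_E6 : certificateE6.IsComplete := by decide +kernel

theorem isValidCascade_E6 : ∀ w ∈ certificateE6.weights, certificateE6.IsValidCascade w := by
  decide +kernel

theorem symbols_E6 : {s | ∃ w ∈ certificateE6.weights, s = w.map fun s => (s.mark, s.type)} =
    E6.symbols := by
  ext s
  simp [certificateE6, symbols]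

theorem nodup_E6 : (certificateE6.weights.map fun w => w.map fun s => (s.mark, s.type)).Nodup := by
  simp [certificateE6]

/-- The codes of the positive roots of type `E7`. -/
def rootsE7 : List ℕ :=
   [1, 10, 100, 1000, 10000, 100000, 1000000, 11, 110, 1100, 11000, 101000, 1010000, 111, 1110,
    11100, 101100, 111000, 1011000, 1111, 11110, 101110, 111100, 1011100, 1111000, 11111, 101111,
    111110, 112100, 1011110, 1111100, 111111, 112110, 1011111, 1111110, 1112100, 112111, 112210,
    1111111, 1112110, 1122100, 112211, 1112111, 1112210, 1122110, 112221, 1112211, 1122111,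
    1122210, 1112221, 1122211, 1123210, 1122221, 1123211, 1223210, 1123221, 1223211, 1123321,
    1223221, 1223321, 1224321, 1234321, 2234321]

theorem isRootList_E7 : E7.IsRootList rootsE7 := by decide +kernel

/-- The cascades in type `E7`. -/
def certificateE7 : Certificate E7 where
  roots := rootsE7
  shortRoot := 2234321
  shortNode := (0 : Fin 7)
  -- The labels of the elements of the root lattice satisfy a congruence modulo `2`.
  modulus := 2
  functional := (![0, 1, 0, 0, 1, 0, 1] : Fin 7 → ℤ)
  symm := (1 : Equiv.Perm (Fin 7))
  weights := [
    [⟨E7, (fun i => i : Fin 7 → Fin 7), .one, [2234321]⟩],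
    [⟨E7, (fun i => i : Fin 7 → Fin 7), .one, [2234321]⟩,
      ⟨D 6, (![6, 5, 4, 3, 1, 2] : Fin 6 → Fin 7), .one, [112221]⟩],
    [⟨E7, (fun i => i : Fin 7 → Fin 7), .one, [2234321]⟩,
      ⟨D 6, (![6, 5, 4, 3, 1, 2] : Fin 6 → Fin 7), .one, [112221]⟩,
      ⟨A 1, (![6] : Fin 1 → Fin 7), .one, [1]⟩],
    [⟨E7, (fun i => i : Fin 7 → Fin 7), .two, [1234321, 2234321]⟩],
    [⟨E7, (fun i => i : Fin 7 → Fin 7), .two, [1234321, 2234321]⟩,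
      ⟨A 5, (![1, 3, 4, 5, 6] : Fin 5 → Fin 7), .one, [101111]⟩]]

theorem isComplete_E7 : certificateE7.IsComplete := by decide +kernel

theorem isValidCascade_E7 : ∀ w ∈ certificateE7.weights, certificateE7.IsValidCascade w := by
  decide +kernel

theorem symbols_E7 : {s | ∃ w ∈ certificateE7.weights, s = w.map fun s => (s.mark, s.type)} =
    E7.symbols := by
  ext s
  simp [certificateE7, symbols]

theorem nodup_E7 : (certificateE7.weights.map fun w => w.map fun s => (s.mark, s.type)).Nodup := by
  simp [certificateE7]

/-- The codes of the positive roots of type `E8`. -/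
def rootsE8 : List ℕ :=
   [1, 10, 100, 1000, 10000, 100000, 1000000, 10000000, 11, 110, 1100, 11000, 110000, 1010000,
    10100000, 111, 1110, 11100, 111000, 1011000, 1110000, 10110000, 1111, 11110, 111100, 1011100,
    1111000, 10111000, 11110000, 11111, 111110, 1011110, 1111100, 1121000, 10111100, 11111000,
    111111, 1011111, 1111110, 1121100, 10111110, 11111100, 11121000, 1111111, 1121110, 1122100,
    10111111, 11111110, 11121100, 11221000, 1121111, 1122110, 11111111, 11121110, 11122100,
    11221100, 1122111, 1122210, 11121111, 11122110, 11221110, 11222100, 1122211, 11122111,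
    11122210, 11221111, 11222110, 11232100, 1122221, 11122211, 11222111, 11222210, 11232110,
    12232100, 11122221, 11222211, 11232111, 11232210, 12232110, 11222221, 11232211, 11233210,
    12232111, 12232210, 11232221, 11233211, 12232211, 12233210, 11233221, 12232221, 12233211,
    12243210, 11233321, 12233221, 12243211, 12343210, 12233321, 12243221, 12343211, 22343210,
    12243321, 12343221, 22343211, 12244321, 12343321, 22343221, 12344321, 22343321, 12354321,
    22344321, 13354321, 22354321, 22454321, 23354321, 23454321, 23464321, 23465321, 23465421,
    23465431, 23465432]

theorem isRootList_E8 : E8.IsRootList rootsE8 := by decide +kernel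

/-- The cascades in type `E8`. -/
def certificateE8 : Certificate E8 where
  roots := rootsE8
  shortRoot := 23465432
  shortNode := (7 : Fin 8)
  modulus := 1
  functional := (![0, 0, 0, 0, 0, 0, 0, 0] : Fin 8 → ℤ)
  symm := (1 : Equiv.Perm (Fin 8))
  weights := [
    [⟨E8, (fun i => i : Fin 8 → Fin 8), .one, [23465432]⟩],
    [⟨E8, (fun i => i : Fin 8 → Fin 8), .one, [23465432]⟩,
      ⟨E7, (![0, 1, 2, 3, 4, 5, 6] : Fin 7 → Fin 8), .one, [22343210]⟩],
    [⟨E8, (fun i => i : Fin 8 → Fin 8), .two, [23465431, 23465432]⟩],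
    [⟨E8, (fun i => i : Fin 8 → Fin 8), .two, [23465431, 23465432]⟩,
      ⟨E6, (![0, 1, 2, 3, 4, 5] : Fin 6 → Fin 8), .one, [12232100]⟩]]

theorem isComplete_E8 : certificateE8.IsComplete := by decide +kernel

theorem isValidCascade_E8 : ∀ w ∈ certificateE8.weights, certificateE8.IsValidCascade w := by
  decide +kernel

theorem symbols_E8 : {s | ∃ w ∈ certificateE8.weights, s = w.map fun s => (s.mark, s.type)} =
    E8.symbols := by
  ext s
  simp [certificateE8, symbols]

theorem nodup_E8 : (certificateE8.weights.map fun w => w.map fun s => (s.mark, s.type)).Nodup := by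
  simp [certificateE8]

/-- The codes of the positive roots of type `F4`. -/
def rootsF4 : List ℕ :=
   [1, 10, 100, 1000, 11, 110, 1100, 111, 120, 1110, 121, 1111, 1120, 122, 1121, 1220, 1122, 1221,
    1222, 1231, 1232, 1242, 1342, 2342]

theorem isRootList_F4 : F4.IsRootList rootsF4 := by decide +kernel

/-- The cascades in type `F4`. -/
def certificateF4 : Certificate F4 where
  roots := rootsF4
  shortRoot := 1232
  shortNode := (3 : Fin 4)
  modulus := 1
  functional := (![0, 0, 0, 0] : Fin 4 → ℤ)
  symm := (1 : Equiv.Perm (Fin 4))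
  weights := [
    [⟨F4, (fun i => i : Fin 4 → Fin 4), .oneShort, [1232]⟩],
    [⟨F4, (fun i => i : Fin 4 → Fin 4), .oneLong, [2342]⟩],
    [⟨F4, (fun i => i : Fin 4 → Fin 4), .oneLong, [2342]⟩,
      ⟨C 3, (![3, 2, 1] : Fin 3 → Fin 4), .oneShort, [121]⟩]]

theorem isComplete_F4 : certificateF4.IsComplete := by decide +kernel

theorem isValidCascade_F4 : ∀ w ∈ certificateF4.weights, certificateF4.IsValidCascade w := by
  decide +kernel

theorem symbols_F4 : {s | ∃ w ∈ certificateF4.weights, s = w.map fun s => (s.mark, s.type)} =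
    F4.symbols := by
  ext s
  simp [certificateF4, symbols]

theorem nodup_F4 : (certificateF4.weights.map fun w => w.map fun s => (s.mark, s.type)).Nodup := by
  simp [certificateF4]

/-- The codes of the positive roots of type `G2`. -/
def rootsG2 : List ℕ :=
   [1, 10, 11, 12, 13, 23]

theorem isRootList_G2 : G2.IsRootList rootsG2 := by decide +kernel

/-- The cascades in type `G2`. -/
def certificateG2 : Certificate G2 where
  roots := rootsG2
  shortRoot := 12
  shortNode := (1 : Fin 2)
  modulus := 1
  functional := (![0, 0] : Fin 2 → ℤ)
  symm := (1 : Equiv.Perm (Fin 2))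
  weights := [
    [⟨G2, (fun i => i : Fin 2 → Fin 2), .oneShort, [12]⟩],
    [⟨G2, (fun i => i : Fin 2 → Fin 2), .oneLong, [23]⟩]]

theorem isComplete_G2 : certificateG2.IsComplete := by decide +kernel

theorem isValidCascade_G2 : ∀ w ∈ certificateG2.weights, certificateG2.IsValidCascade w := by
  decide +kernel

theorem symbols_G2 : {s | ∃ w ∈ certificateG2.weights, s = w.map fun s => (s.mark, s.type)} =
    G2.symbols := by
  ext s
  simp [certificateG2, symbols]

theorem nodup_G2 : (certificateG2.weights.map fun w => w.map fun s => (s.mark, s.type)).Nodup := by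
  simp [certificateG2]

end DynkinType

end SmallWeights

namespace SmallWeights

/-! ### Coordinates for the classical types -/

namespace DynkinType

/-- The types `B_n` (`n ≥ 2`), `C_n` (`n ≥ 3`) and `D_n` (`n ≥ 4`). -/
def IsClassical : DynkinType → Prop
  | B n => 2 ≤ n
  | C n => 3 ≤ n
  | D n => 4 ≤ n
  | _ => False

/-- The `k`-th coordinate of the `i`-th simple root in the usual realisation. The simple roots are
`e_i - e_{i+1}`, except for the last one, which is `e_{n-1}`, `2 e_{n-1}` or `e_{n-2} + e_{n-1}`. -/
def simpleCoord : DynkinType → ℕ → ℕ → ℤ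
  | B n, i, k => if k < n then (if k = i then 1 else 0) - (if k = i + 1 then 1 else 0) else 0
  | C n, i, k => if k < n then (if k = i then (if i + 1 = n then 2 else 1) else 0) -
      (if k = i + 1 then 1 else 0) else 0
  | D n, i, k => if k < n then (if k = i then 1 else 0) - (if k = i + 1 then 1 else 0) +
      (if i + 1 = n ∧ k + 1 = i then 1 else 0) else 0
  | _, _, _ => 0

/-- The pairing of the vector with coordinates `x` with the `j`-th simple coroot. -/
def corootCoord {R : Type*} [Ring R] : DynkinType → (ℕ → R) → ℕ → R
  | B n, x, j => if j + 1 = n then 2 * x j else x j - x (j + 1)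
  | C n, x, j => if j + 1 = n then x j else x j - x (j + 1)
  | D n, x, j => if j + 1 = n then x (j - 1) + x j else x j - x (j + 1)
  | _, _, _ => 0

variable {X : DynkinType}

theorem IsClassical.isProper (hX : X.IsClassical) : X.IsProper := by
  cases X <;> first | exact hX | exact hX.elim

theorem corootCoord_intCast (x : ℕ → ℤ) (j : ℕ) :
    ((X.corootCoord x j : ℤ) : ℝ) = X.corootCoord (fun k => (x k : ℝ)) j := by
  cases X <;> simp only [corootCoord] <;> (try split_ifs) <;> push_cast <;> rfl

theorem cartan_eq_corootCoord (hX : X.IsClassical) (i j : Fin X.rank) :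
    X.cartan i j = X.corootCoord (X.simpleCoord i) j := by
  match X, hX with
  | B n, (hn : 2 ≤ n) =>
    change Fin n at i j
    change CartanMatrix.B n i j = _
    have := i.2
    have := j.2
    simp only [CartanMatrix.B, Matrix.of_apply, Fin.ext_iff, corootCoord, simpleCoord]
    split_ifs <;> omega
  | C n, (hn : 3 ≤ n) =>
    change Fin n at i j
    change CartanMatrix.C n i j = _
    have := i.2
    have := j.2
    simp only [CartanMatrix.C, Matrix.of_apply, Fin.ext_iff, corootCoord, simpleCoord]
    split_ifs <;> omega
  | D n, (hn : 4 ≤ n) =>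
    change Fin n at i j
    obtain ⟨i, hi⟩ := i
    obtain ⟨j, hj⟩ := j
    change CartanMatrix.D n ⟨i, hi⟩ ⟨j, hj⟩ = (D n).corootCoord ((D n).simpleCoord i) j
    simp only [CartanMatrix.D, Matrix.of_apply, Fin.mk.injEq, corootCoord, simpleCoord]
    grind

/-- The ratio of `X.halfNorm` and half the squared lengths in the usual realisation. -/
def normRatio : DynkinType → ℤ
  | B _ => 2
  | _ => 1

theorem normRatio_pos (X : DynkinType) : 0 < X.normRatio := by
  cases X <;> simp [normRatio]

/-- In coordinates, the scalar product with a simple root is a multiple of the pairing with its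
coroot. -/
theorem sum_simpleCoord_mul (hX : X.IsClassical) (x : ℕ → ℝ) (j : Fin X.rank) :
    X.normRatio * ∑ k ∈ Finset.range X.rank, (X.simpleCoord j k : ℝ) * x k =
      X.halfNorm j * X.corootCoord x j := by
  match X, hX with
  | B n, (hn : 2 ≤ n) =>
    change Fin n at j
    change ((2 : ℤ) : ℝ) * ∑ k ∈ Finset.range n, _ =
      ((if (j : ℕ) + 1 = n then 1 else 2 : ℤ) : ℝ) * _
    have hj := j.2
    have : ∀ k ∈ Finset.range n, (((B n).simpleCoord j k : ℤ) : ℝ) * x k =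
        (if k = j then x k else 0) - (if k = j + 1 then x k else 0) := by
      intro k hk
      rw [Finset.mem_range] at hk
      simp only [simpleCoord, if_pos hk]
      split_ifs <;> first | omega | simp
    rw [Finset.sum_congr rfl this, Finset.sum_sub_distrib, Finset.sum_ite_eq', Finset.sum_ite_eq']
    simp only [Finset.mem_range, hj, if_true, corootCoord]
    split_ifs <;> first | omega | (push_cast; ring)
  | C n, (hn : 3 ≤ n) =>
    change Fin n at j
    change ((1 : ℤ) : ℝ) * ∑ k ∈ Finset.range n, _ =
      ((if (j : ℕ) + 1 = n then 2 else 1 : ℤ) : ℝ) * _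
    have hj := j.2
    have : ∀ k ∈ Finset.range n, (((C n).simpleCoord j k : ℤ) : ℝ) * x k =
        (if k = j then (if (j : ℕ) + 1 = n then 2 else 1) * x k else 0) -
          (if k = j + 1 then x k else 0) := by
      intro k hk
      rw [Finset.mem_range] at hk
      simp only [simpleCoord, if_pos hk]
      split_ifs <;> first | omega | simp
    rw [Finset.sum_congr rfl this, Finset.sum_sub_distrib, Finset.sum_ite_eq', Finset.sum_ite_eq']
    simp only [Finset.mem_range, hj, if_true, corootCoord]
    split_ifs <;> first | omega | (push_cast; ring)
  | D n, (hn : 4 ≤ n) =>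
    change Fin n at j
    change ((1 : ℤ) : ℝ) * ∑ k ∈ Finset.range n, _ = ((1 : ℤ) : ℝ) * _
    have hj := j.2
    have : ∀ k ∈ Finset.range n, (((D n).simpleCoord j k : ℤ) : ℝ) * x k =
        (if k = j then x k else 0) - (if k = j + 1 then x k else 0) +
          (if k = j - 1 then (if (j : ℕ) + 1 = n then x k else 0) else 0) := by
      intro k hk
      rw [Finset.mem_range] at hk
      simp only [simpleCoord, if_pos hk]
      split_ifs <;> first | omega | simp
    rw [Finset.sum_congr rfl this, Finset.sum_add_distrib, Finset.sum_sub_distrib,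
      Finset.sum_ite_eq', Finset.sum_ite_eq', Finset.sum_ite_eq']
    have hj' : (j : ℕ) - 1 < n := by omega
    simp only [Finset.mem_range, hj, hj', if_true, corootCoord]
    split_ifs <;> first | omega | (push_cast; ring)

theorem eq_of_corootCoord_eq (hX : X.IsClassical) {x y : ℕ → ℤ}
    (h : ∀ k < X.rank, x k = y k) (j : Fin X.rank) : X.corootCoord x j = X.corootCoord y j := by
  match X, hX with
  | B n, _ =>
    have hj : (j : ℕ) < n := j.2
    simp only [corootCoord]
    split_ifs
    · rw [h _ hj]
    · rw [h _ hj, h _ (by change _ < n; omega)]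
  | C n, _ =>
    have hj : (j : ℕ) < n := j.2
    simp only [corootCoord]
    split_ifs
    · rw [h _ hj]
    · rw [h _ hj, h _ (by change _ < n; omega)]
  | D n, _ =>
    have hj : (j : ℕ) < n := j.2
    simp only [corootCoord]
    split_ifs
    · rw [h _ hj, h _ (by change _ < n; omega)]
    · rw [h _ hj, h _ (by change _ < n; omega)]

end DynkinType

variable {ι V N : Type*} [AddCommGroup V] [Module ℝ V] [AddCommGroup N] [Module ℝ N]
  {P : RootPairing ι ℝ V N} [P.IsRootSystem]

namespace Labelling

variable {b : P.Base} {X : DynkinType} (ν : Labelling b X)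

/-- The coordinates on `V` in which the simple roots take their usual form. -/
noncomputable def coord (k : ℕ) : V →ₗ[ℝ] ℝ :=
  b.toWeightBasis.constr ℝ fun j => (X.simpleCoord (ν.equiv.symm j) k : ℝ)

theorem coord_node (j : Fin X.rank) (k : ℕ) :
    ν.coord k (P.root (ν.node j)) = X.simpleCoord j k := by
  have := b.toWeightBasis.constr_basis ℝ
    (fun j => (X.simpleCoord (ν.equiv.symm j) k : ℝ)) (ν.equiv j)
  rwa [RootPairing.Base.toWeightBasis_apply, coe_equiv, Equiv.symm_apply_apply] at this

/-- As the formulas for simple coroots are linear in the coordinates, it suffices to compare the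
pairings of simple roots. -/
theorem coroot_eq_corootCoord (hX : X.IsClassical) (j : Fin X.rank) (x : V) :
    P.coroot' (ν.node j) x = X.corootCoord (fun k => ν.coord k x) j := by
  have key : ∀ g : V →ₗ[ℝ] ℝ, (∀ y, g y = X.corootCoord (fun k => ν.coord k y) j) →
      P.coroot' (ν.node j) x = X.corootCoord (fun k => ν.coord k x) j := by
    intro g hg
    have : P.coroot' (ν.node j) = g := by
      refine ν.linearMap_ext fun i => ?_
      rw [hg, P.root_coroot'_eq_pairing, ν.pairing, DynkinType.cartan_eq_corootCoord hX,
        DynkinType.corootCoord_intCast]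
      simp only [coord_node]
    rw [this, hg]
  match X, hX with
  | .B n, _ =>
    by_cases h : (j : ℕ) + 1 = n
    · exact key ((2 : ℝ) • ν.coord j) fun y => by simp [DynkinType.corootCoord, h]
    · exact key (ν.coord j - ν.coord (j + 1)) fun y => by simp [DynkinType.corootCoord, h]
  | .C n, _ =>
    by_cases h : (j : ℕ) + 1 = n
    · exact key (ν.coord j) fun y => by simp [DynkinType.corootCoord, h]
    · exact key (ν.coord j - ν.coord (j + 1)) fun y => by simp [DynkinType.corootCoord, h]
  | .D n, _ =>
    by_cases h : (j : ℕ) + 1 = n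
    · exact key (ν.coord (j - 1) + ν.coord j) fun y => by simp [DynkinType.corootCoord, h]
    · exact key (ν.coord j - ν.coord (j + 1)) fun y => by simp [DynkinType.corootCoord, h]

theorem coord_eq_zero (hX : X.IsClassical) {k : ℕ} (hk : X.rank ≤ k) : ν.coord k = 0 := by
  refine ν.linearMap_ext fun j => ?_
  rw [coord_node]
  match X, hX with
  | .B n, _ => simp [DynkinType.simpleCoord, not_lt.2 (show n ≤ k from hk)]
  | .C n, _ => simp [DynkinType.simpleCoord, not_lt.2 (show n ≤ k from hk)]
  | .D n, _ => simp [DynkinType.simpleCoord, not_lt.2 (show n ≤ k from hk)]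

theorem ext_coord (hX : X.IsClassical) {x y : V} (h : ∀ k, ν.coord k x = ν.coord k y) : x = y := by
  refine ν.ext_coroot fun j => ?_
  rw [ν.coroot_eq_corootCoord hX, ν.coroot_eq_corootCoord hX]
  simp only [h]

/-- The standard scalar product in coordinates is invariant. -/
theorem exists_rootForm_eq_coord [Fintype ι] (hX : X.IsClassical) : ∃ c : ℝ, 0 < c ∧ ∀ x y,
    P.RootForm x y = c * ∑ k ∈ Finset.range X.rank, ν.coord k x * ν.coord k y := by
  obtain ⟨c, hc, h⟩ := ν.exists_rootForm_eq hX.isProper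
  have hr : (0 : ℝ) < X.normRatio := by exact_mod_cast X.normRatio_pos
  refine ⟨c * X.normRatio, mul_pos hc hr, fun x y => ?_⟩
  have : P.RootForm.flip y =
      (c * X.normRatio) • ∑ k ∈ Finset.range X.rank, ν.coord k y • ν.coord k := by
    refine ν.linearMap_ext fun j => ?_
    change P.RootForm (P.root (ν.node j)) y = _
    rw [h, ν.coroot_eq_corootCoord hX,
      ← DynkinType.sum_simpleCoord_mul hX]
    simp only [LinearMap.smul_apply, LinearMap.sum_apply, smul_eq_mul, coord_node, mul_assoc]
    simp only [mul_comm]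
  have := LinearMap.congr_fun this x
  refine Eq.trans this ?_
  simp only [LinearMap.smul_apply, LinearMap.sum_apply, smul_eq_mul, mul_comm]

end Labelling

end SmallWeights

namespace SmallWeights

/-! ### Roots of the classical types in coordinates -/

namespace DynkinType

/-- The possible coordinates of roots: integral vectors with the appropriate squared lengths, where
the long roots in type `C` are twice a unit vector. -/
def IsRootCoord : DynkinType → (ℕ → ℤ) → Prop
  | B n, β => ∑ k ∈ Finset.range n, β k ^ 2 = 1 ∨ ∑ k ∈ Finset.range n, β k ^ 2 = 2
  | C n, β => ∑ k ∈ Finset.range n, β k ^ 2 = 2 ∨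
      ∃ γ : ℕ → ℤ, (∀ k, β k = 2 * γ k) ∧ ∑ k ∈ Finset.range n, γ k ^ 2 = 1
  | D n, β => ∑ k ∈ Finset.range n, β k ^ 2 = 2
  | _, _ => False

variable {X : DynkinType}

theorem corootCoord_two_mul (x : ℕ → ℤ) (j : ℕ) :
    X.corootCoord (fun k => 2 * x k) j = 2 * X.corootCoord x j := by
  cases X <;> simp only [corootCoord] <;> (try split_ifs) <;> ring

theorem sum_sq_simpleCoord (hX : X.IsClassical) (j : Fin X.rank) :
    X.normRatio * ∑ k ∈ Finset.range X.rank, X.simpleCoord j k ^ 2 = 2 * X.halfNorm j := by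
  have h := sum_simpleCoord_mul hX (fun k => (X.simpleCoord j k : ℝ)) j
  rw [← corootCoord_intCast, ← cartan_eq_corootCoord hX] at h
  have h2 : X.cartan j j = 2 := by
    match X, hX with
    | B n, _ => exact CartanMatrix.B_diag n j
    | C n, _ => exact CartanMatrix.C_diag n j
    | D n, _ => exact CartanMatrix.D_diag n j
  rw [h2] at h
  simp only [pow_two]
  rw [mul_comm 2]
  exact_mod_cast h

theorem isRootCoord_simpleCoord (hX : X.IsClassical) (j : Fin X.rank) :
    X.IsRootCoord (X.simpleCoord j) := by
  have h := sum_sq_simpleCoord hX j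
  match X, hX with
  | B n, _ =>
    change (2 : ℤ) * ∑ k ∈ Finset.range n, _ = 2 * (if (j : ℕ) + 1 = n then 1 else 2) at h
    simp only [IsRootCoord]
    split_ifs at h <;> omega
  | C n, _ =>
    change (1 : ℤ) * ∑ k ∈ Finset.range n, _ = 2 * (if (j : ℕ) + 1 = n then 2 else 1) at h
    have hj : (j : ℕ) < n := j.2
    by_cases hjn : (j : ℕ) + 1 = n
    · refine .inr ⟨fun k => if k = j then 1 else 0, fun k => ?_, ?_⟩
      · simp only [simpleCoord]
        split_ifs <;> omega
      · simp [ite_pow, hj]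
    · rw [if_neg hjn] at h
      left
      linarith
  | D n, _ =>
    change (1 : ℤ) * ∑ k ∈ Finset.range n, _ = 2 * 1 at h
    simp only [IsRootCoord]
    omega

theorem IsRootCoord.neg {β : ℕ → ℤ} (h : X.IsRootCoord β) : X.IsRootCoord fun k => -β k := by
  cases X with
  | C n =>
    rcases h with h | ⟨γ, h, h'⟩
    · exact .inl (by simpa using h)
    · exact .inr ⟨fun k => -γ k, fun k => by simp only [h]; ring, by simpa using h'⟩
  | B n => simpa [IsRootCoord] using h
  | D n => simpa [IsRootCoord] using h
  | _ => exact h.elim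

/-- Reflections in simple roots preserve squared lengths; the divisibility by `2` of the long roots
in type `C` is preserved by linearity. -/
theorem IsRootCoord.reflect {β : ℕ → ℤ} (h : X.IsRootCoord β) {j : ℕ}
    (hsq : ∑ k ∈ Finset.range X.rank, (β k - X.corootCoord β j * X.simpleCoord j k) ^ 2 =
      ∑ k ∈ Finset.range X.rank, β k ^ 2) :
    X.IsRootCoord fun k => β k - X.corootCoord β j * X.simpleCoord j k := by
  cases X with
  | C n =>
    rcases h with h | ⟨γ, h, h'⟩
    · exact .inl (hsq.trans h)
    · obtain rfl : β = fun k => 2 * γ k := funext h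
      refine .inr ⟨fun k => γ k - (C n).corootCoord γ j * (C n).simpleCoord j k, fun k => ?_, ?_⟩
      · rw [corootCoord_two_mul]
        ring
      · simp only [corootCoord_two_mul, mul_assoc, ← mul_sub, mul_pow, ← Finset.mul_sum] at hsq
        rw [← h']
        exact mul_left_cancel₀ (by norm_num) hsq
  | B n => exact h.imp hsq.trans hsq.trans
  | D n => exact hsq.trans h
  | _ => exact h.elim

theorem IsRootCoord.sum_sq_pos {β : ℕ → ℤ} (h : X.IsRootCoord β) :
    0 < ∑ k ∈ Finset.range X.rank, β k ^ 2 := by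
  cases X with
  | C n =>
    change 0 < ∑ k ∈ Finset.range n, β k ^ 2
    rcases h with h | ⟨γ, h, h'⟩
    · omega
    · simp only [h, mul_pow, ← Finset.mul_sum, h']
      norm_num
  | B n =>
    change 0 < ∑ k ∈ Finset.range n, β k ^ 2
    rcases h with h | h <;> omega
  | D n =>
    change 0 < ∑ k ∈ Finset.range n, β k ^ 2
    have : ∑ k ∈ Finset.range n, β k ^ 2 = 2 := h
    omega
  | _ => exact h.elim

theorem le_sum_sq_sub {n : ℕ} (β : ℕ → ℤ) {k : ℕ} (hk : k < n) :
    β k ^ 2 - β k ≤ ∑ k ∈ Finset.range n, β k ^ 2 - ∑ k ∈ Finset.range n, β k := by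
  rw [← Finset.sum_sub_distrib]
  refine Finset.single_le_sum (f := fun k => β k ^ 2 - β k) (fun i _ => ?_) (Finset.mem_range.2 hk)
  have := Int.le_self_sq (β i)
  linarith

theorem sum_le_sum_sq {n : ℕ} (β : ℕ → ℤ) :
    ∑ k ∈ Finset.range n, β k ≤ ∑ k ∈ Finset.range n, β k ^ 2 :=
  Finset.sum_le_sum fun i _ => Int.le_self_sq (β i)

/-- If a sum of integers is as large as the sum of their squares, all of them are `0` or `1`. -/
theorem nonneg_of_sum_sq_le {n : ℕ} {β : ℕ → ℤ}
    (h : ∑ k ∈ Finset.range n, β k ^ 2 ≤ ∑ k ∈ Finset.range n, β k) {k : ℕ} (hk : k < n) :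
    0 ≤ β k := by
  have := le_sum_sq_sub β hk
  nlinarith [sq_nonneg (β k)]

theorem IsRootCoord.sum_le_two {β : ℕ → ℤ} (h : X.IsRootCoord β) :
    ∑ k ∈ Finset.range X.rank, β k ≤ 2 := by
  cases X with
  | C n =>
    change ∑ k ∈ Finset.range n, β k ≤ 2
    rcases h with h | ⟨γ, h, h'⟩
    · exact (sum_le_sum_sq β).trans h.le
    · have := sum_le_sum_sq (n := n) γ
      simp only [h, ← Finset.mul_sum]
      omega
  | B n =>
    refine (sum_le_sum_sq β).trans ?_
    rcases h with h | h <;> exact h.le.trans (by norm_num)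
  | D n => exact (sum_le_sum_sq β).trans (le_of_eq h)
  | _ => exact h.elim

theorem IsRootCoord.nonneg_of_sum_eq_two {β : ℕ → ℤ} (h : X.IsRootCoord β)
    (hβ : ∑ k ∈ Finset.range X.rank, β k = 2) {k : ℕ} (hk : k < X.rank) : 0 ≤ β k := by
  cases X with
  | C n =>
    change ∑ k ∈ Finset.range n, β k = 2 at hβ
    rcases h with h | ⟨γ, h, h'⟩
    · exact nonneg_of_sum_sq_le (n := n) (by omega) hk
    · simp only [h, ← Finset.mul_sum] at hβ ⊢
      have := nonneg_of_sum_sq_le (n := n) (β := γ) (by omega) hk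
      omega
  | B n =>
    change ∑ k ∈ Finset.range n, β k = 2 at hβ
    exact nonneg_of_sum_sq_le (n := n) (by rcases h with h | h <;> omega) hk
  | D n =>
    change ∑ k ∈ Finset.range n, β k = 2 at hβ
    exact nonneg_of_sum_sq_le (n := n) (le_of_eq (Eq.trans h hβ.symm)) hk
  | _ => exact h.elim

end DynkinType

variable {ι V N : Type*} [AddCommGroup V] [Module ℝ V] [AddCommGroup N] [Module ℝ N]
  {P : RootPairing ι ℝ V N} [P.IsRootSystem]

namespace Labelling

variable {b : P.Base} {X : DynkinType} (ν : Labelling b X)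

theorem root_eq_of_coord (hX : X.IsClassical) {i j : ι}
    (h : ∀ k < X.rank, ν.coord k (P.root i) = ν.coord k (P.root j)) : i = j := by
  refine P.root.injective (ν.ext_coord hX fun k => ?_)
  by_cases hk : k < X.rank
  · exact h k hk
  · simp [ν.coord_eq_zero hX (not_lt.1 hk)]

variable [Fintype ι]

/-- The pairing with the coroot of a root with coordinates `β`. -/
theorem sum_sq_mul_coroot (hX : X.IsClassical) {i : ι} {β : ℕ → ℤ}
    (hβ : ∀ k, ν.coord k (P.root i) = β k) (x : V) :
    (∑ k ∈ Finset.range X.rank, β k ^ 2 : ℤ) * P.coroot' i x =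
      2 * ∑ k ∈ Finset.range X.rank, β k * ν.coord k x := by
  obtain ⟨c, hc, hform⟩ := ν.exists_rootForm_eq_coord hX
  have h := rootForm_self_mul_coroot (P := P) i x
  rw [hform, hform] at h
  simp only [hβ, ← pow_two] at h
  apply mul_left_cancel₀ hc.ne'
  push_cast
  linarith

/-- Every root is obtained from a simple one by simple reflections, and the condition on its
coordinates is preserved by these. -/
theorem exists_rootCoord [P.IsCrystallographic] [P.IsReduced] (hX : X.IsClassical) (i : ι) :
    ∃ β : ℕ → ℤ, (∀ k, ν.coord k (P.root i) = β k) ∧ X.IsRootCoord β := by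
  refine b.induction_reflect i
    (p := fun i => ∃ β : ℕ → ℤ, (∀ k, ν.coord k (P.root i) = β k) ∧ X.IsRootCoord β) ?_ ?_ ?_
  · rintro i ⟨β, h, h'⟩
    refine ⟨fun k => -β k, fun k => ?_, h'.neg⟩
    rw [P.root_reflectionPerm, P.reflection_apply_self, map_neg, h]
    push_cast
    rfl
  · intro i hi
    obtain ⟨j, rfl⟩ := ν.exists_node hi
    exact ⟨X.simpleCoord j, ν.coord_node j, DynkinType.isRootCoord_simpleCoord hX j⟩
  · rintro i j ⟨β, h, h'⟩ hj
    obtain ⟨j, rfl⟩ := ν.exists_node hj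
    have hc : ∀ k, ν.coord k (P.root (P.reflectionPerm (ν.node j) i)) =
        (β k - X.corootCoord β j * X.simpleCoord j k : ℤ) := by
      intro k
      rw [P.root_reflectionPerm, P.reflection_apply, map_sub, map_smul, smul_eq_mul, coord_node, h,
        ν.coroot_eq_corootCoord hX]
      simp only [h, ← DynkinType.corootCoord_intCast]
      push_cast
      rfl
    refine ⟨_, hc, h'.reflect ?_⟩
    obtain ⟨c, hc0, hform⟩ := ν.exists_rootForm_eq_coord hX
    have h₁ := P.rootForm_reflection_reflection_apply (ν.node j) (P.root i) (P.root i)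
    rw [← P.root_reflectionPerm, hform, hform] at h₁
    have h₂ := mul_left_cancel₀ hc0.ne' h₁
    simp only [hc, h, ← pow_two] at h₂
    exact_mod_cast h₂

end Labelling

end SmallWeights

namespace SmallWeights

namespace DynkinType

variable {X : DynkinType}

theorem simpleCoord_of_lt (hX : X.IsClassical) {j : ℕ} (hj : j + 1 < X.rank) (k : ℕ) :
    X.simpleCoord j k = (if k = j then 1 else 0) - (if k = j + 1 then 1 else 0) := by
  match X, hX with
  | B n, _ =>
    change j + 1 < n at hj
    simp only [simpleCoord]
    split_ifs <;> omega
  | C n, _ =>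
    change j + 1 < n at hj
    simp only [simpleCoord]
    split_ifs <;> omega
  | D n, _ =>
    change j + 1 < n at hj
    simp only [simpleCoord]
    split_ifs <;> omega

theorem corootCoord_of_lt {R : Type*} [Ring R] (hX : X.IsClassical) {j : ℕ} (hj : j + 1 < X.rank)
    (x : ℕ → R) : X.corootCoord x j = x j - x (j + 1) := by
  match X, hX with
  | B n, _ => simp only [corootCoord, if_neg (show ¬ j + 1 = n from hj.ne)]
  | C n, _ => simp only [corootCoord, if_neg (show ¬ j + 1 = n from hj.ne)]
  | D n, _ => simp only [corootCoord, if_neg (show ¬ j + 1 = n from hj.ne)]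

/-- Twice the pairing of the first unit vector with the sum `ρ^∨` of the fundamental coweights. -/
def topHeight : DynkinType → ℤ
  | B n => 2 * n
  | C n => 2 * n - 1
  | D n => 2 * n - 2
  | _ => 0

/-- The vector with `k`-th coordinate `X.topHeight - 2 * k` is `2ρ^∨`: its scalar product with every
simple root is `2`. -/
theorem sum_topHeight_mul (hX : X.IsClassical) (j : Fin X.rank) :
    ∑ k ∈ Finset.range X.rank, (X.topHeight - 2 * k) * X.simpleCoord j k = 2 := by
  have h := sum_simpleCoord_mul hX (fun k => ((X.topHeight - 2 * k : ℤ) : ℝ)) j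
  rw [← corootCoord_intCast] at h
  have h' : X.normRatio * ∑ k ∈ Finset.range X.rank, X.simpleCoord j k * (X.topHeight - 2 * k) =
      X.halfNorm j * X.corootCoord (fun k => X.topHeight - 2 * k) j := by exact_mod_cast h
  rw [Finset.sum_congr rfl fun k _ => mul_comm _ _]
  generalize ∑ k ∈ Finset.range X.rank, X.simpleCoord j k * (X.topHeight - 2 * k) = S at h'
  match X, hX with
  | B n, _ =>
    change 2 * S = (if (j : ℕ) + 1 = n then 1 else 2) * (B n).corootCoord _ j at h'
    simp only [corootCoord, topHeight] at h'
    have := j.2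
    split_ifs at h' <;> push_cast at h' <;> omega
  | C n, _ =>
    change 1 * S = (if (j : ℕ) + 1 = n then 2 else 1) * (C n).corootCoord _ j at h'
    simp only [corootCoord, topHeight] at h'
    have := j.2
    split_ifs at h' <;> push_cast at h' <;> omega
  | D n, (hn : 4 ≤ n) =>
    change 1 * S = 1 * (D n).corootCoord _ j at h'
    simp only [corootCoord, topHeight] at h'
    have := j.2
    split_ifs at h' <;> push_cast at h' <;> omega

end DynkinType

variable {ι V N : Type*} [AddCommGroup V] [Module ℝ V] [AddCommGroup N] [Module ℝ N]
  {P : RootPairing ι ℝ V N}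

theorem inParabolic_of_mem {C : Set ι} {i : ι} (hi : i ∈ C) : InParabolic P C i :=
  Submodule.subset_span ⟨i, hi, rfl⟩

theorem InParabolic.mono {C C' : Set ι} (h : C ⊆ C') {i : ι} (hi : InParabolic P C i) :
    InParabolic P C' i :=
  Submodule.span_mono (Set.image_mono h) hi

theorem InParabolic.reflectionPerm {C : Set ι} {i j : ι} (hi : InParabolic P C i)
    (hj : InParabolic P C j) : InParabolic P C (P.reflectionPerm j i) := by
  rw [InParabolic, P.root_reflectionPerm, P.reflection_apply]
  exact Submodule.sub_mem _ hi (Submodule.smul_mem _ _ hj)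

namespace Labelling

variable {b : P.Base} {X : DynkinType} (ν : Labelling b X)

/-- The simple roots with numbers `p` and higher. -/
def tail (p : ℕ) : Set ι := {i | ∃ j : Fin X.rank, p ≤ j ∧ ν.node j = i}

theorem tail_anti {p q : ℕ} (h : p ≤ q) : ν.tail q ⊆ ν.tail p := by
  rintro _ ⟨j, hj, rfl⟩
  exact ⟨j, h.trans hj, rfl⟩

theorem node_mem_tail {p : ℕ} {j : Fin X.rank} (h : p ≤ j) : ν.node j ∈ ν.tail p := ⟨j, h, rfl⟩

theorem tail_zero : ν.tail 0 = b.support := by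
  simp [tail, ← ν.range_eq, Set.range]

variable [P.IsRootSystem]

theorem coord_reflectionPerm (i j : ι) (k : ℕ) : ν.coord k (P.root (P.reflectionPerm j i)) =
    ν.coord k (P.root i) - P.pairing i j * ν.coord k (P.root j) := by
  rw [P.root_reflectionPerm, P.reflection_apply_root, map_sub, map_smul, smul_eq_mul]

theorem pairing_node (hX : X.IsClassical) {i : ι} {β : ℕ → ℤ}
    (hβ : ∀ k, ν.coord k (P.root i) = β k) (j : Fin X.rank) :
    P.pairing i (ν.node j) = (X.corootCoord β j : ℤ) := by
  rw [← P.root_coroot'_eq_pairing, ν.coroot_eq_corootCoord hX, DynkinType.corootCoord_intCast]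
  simp only [hβ]

theorem two_mul_height [P.IsCrystallographic] (hX : X.IsClassical) {i : ι} {β : ℕ → ℤ}
    (hβ : ∀ k, ν.coord k (P.root i) = β k) :
    2 * b.height i = ∑ k ∈ Finset.range X.rank, (X.topHeight - 2 * k) * β k := by
  have h := apply_eq_height (b := b)
    ((2 : ℝ)⁻¹ • ∑ k ∈ Finset.range X.rank, ((X.topHeight - 2 * k : ℤ) : ℝ) • ν.coord k) (by
      intro j hj
      obtain ⟨j, rfl⟩ := ν.exists_node hj
      simp only [LinearMap.smul_apply, LinearMap.sum_apply, smul_eq_mul, coord_node]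
      have h : (∑ k ∈ Finset.range X.rank,
          ((X.topHeight - 2 * k : ℤ) : ℝ) * (X.simpleCoord j k : ℝ)) = 2 := by
        exact_mod_cast DynkinType.sum_topHeight_mul hX j
      rw [h]
      norm_num) i
  simp only [LinearMap.smul_apply, LinearMap.sum_apply, smul_eq_mul, hβ] at h
  have h' : (2 * b.height i : ℝ) =
      ∑ k ∈ Finset.range X.rank, ((X.topHeight - 2 * k : ℤ) : ℝ) * β k := by
    rw [← h]
    ring
  exact_mod_cast h'

/-- In types `B` and `C` there is a root which is a multiple of a given unit vector. -/
theorem exists_root_single {s : ℕ} (hX : X.IsClassical)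
    (hs : (∃ n, X = .B n ∧ s = 1) ∨ ∃ n, X = .C n ∧ s = 2) {p : ℕ} (hp : p < X.rank) :
    ∃ i, (∀ k, ν.coord k (P.root i) = ((if k = p then s else 0 : ℤ) : ℝ)) ∧
      InParabolic P (ν.tail p) i := by
  induction hm : X.rank - 1 - p generalizing p with
  | zero =>
    refine ⟨ν.node ⟨p, hp⟩, fun k => ?_, inParabolic_of_mem (ν.node_mem_tail le_rfl)⟩
    rw [coord_node]
    norm_cast
    rcases hs with ⟨n, rfl, rfl⟩ | ⟨n, rfl, rfl⟩
    · change p < n at hp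
      change n - 1 - p = 0 at hm
      simp only [DynkinType.simpleCoord]
      split_ifs <;> omega
    · change p < n at hp
      change n - 1 - p = 0 at hm
      simp only [DynkinType.simpleCoord]
      split_ifs <;> omega
  | succ m ih =>
    obtain ⟨i, hi, hi'⟩ := ih (p := p + 1) (by omega) (by omega)
    have hp' : p + 1 < X.rank := by omega
    refine ⟨P.reflectionPerm (ν.node ⟨p, hp⟩) i, fun k => ?_,
      (hi'.mono (ν.tail_anti (Nat.le_succ p))).reflectionPerm
        (inParabolic_of_mem (ν.node_mem_tail le_rfl))⟩
    rw [coord_reflectionPerm, ν.pairing_node hX hi, coord_node, hi,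
      DynkinType.corootCoord_of_lt hX hp', DynkinType.simpleCoord_of_lt hX hp']
    rw [← Int.cast_mul, ← Int.cast_sub, Int.cast_inj]
    simp only [Nat.left_eq_add, one_ne_zero, if_false, if_true]
    split_ifs <;> omega

variable [Fintype ι]

/-- The sum of two consecutive unit vectors is a root; so is, in type `D`, the sum of two unit
vectors at distance two. -/
theorem exists_root_pair (hX : X.IsClassical) {p : ℕ} (hp : p + 2 ≤ X.rank) :
    (∃ i, (∀ k, ν.coord k (P.root i) = ((if k = p ∨ k = p + 1 then 1 else 0 : ℤ) : ℝ)) ∧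
      InParabolic P (ν.tail p) i) ∧
    ((∃ n, X = .D n) → p + 3 ≤ X.rank →
      ∃ i, (∀ k, ν.coord k (P.root i) = ((if k = p ∨ k = p + 2 then 1 else 0 : ℤ) : ℝ)) ∧
        InParabolic P (ν.tail p) i) := by
  -- In types `B` and `C`, reflect `e_p - e_{p+1}` in a multiple of `e_{p+1}`.
  have key : ∀ s, ((∃ n, X = .B n ∧ s = 1) ∨ ∃ n, X = .C n ∧ s = 2) →
      ∃ i, (∀ k, ν.coord k (P.root i) = ((if k = p ∨ k = p + 1 then 1 else 0 : ℤ) : ℝ)) ∧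
      InParabolic P (ν.tail p) i := by
    intro s hs
    obtain ⟨i, hi, hi'⟩ := ν.exists_root_single hX hs (p := p + 1) (by omega)
    have hp' : p + 1 < X.rank := by omega
    have hs0 : (s : ℝ) ≠ 0 := by rcases hs with ⟨n, -, rfl⟩ | ⟨n, -, rfl⟩ <;> norm_num
    obtain ⟨j, hj⟩ : ∃ j : Fin X.rank, (j : ℕ) = p := ⟨⟨p, by omega⟩, rfl⟩
    refine ⟨P.reflectionPerm i (ν.node j), fun k => ?_,
      (inParabolic_of_mem (ν.node_mem_tail hj.ge)).reflectionPerm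
        (hi'.mono (ν.tail_anti (Nat.le_succ p)))⟩
    have h := ν.sum_sq_mul_coroot hX hi (P.root (ν.node j))
    have h₁ : ∑ k ∈ Finset.range X.rank, (if k = p + 1 then (s : ℤ) else 0) ^ 2 = s ^ 2 := by
      simp [ite_pow, hp']
    have h₂ : ∑ k ∈ Finset.range X.rank, ((if k = p + 1 then (s : ℤ) else 0 : ℤ) : ℝ) *
        ν.coord k (P.root (ν.node j)) = -s := by
      simp only [coord_node, hj, DynkinType.simpleCoord_of_lt hX hp']
      rw [Finset.sum_eq_single (p + 1)]
      · simp
      · intro k _ hk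
        simp [hk]
      · simp [hp']
    rw [h₁, h₂, P.root_coroot'_eq_pairing] at h
    have h₃ : P.pairing (ν.node j) i * s = -2 := by
      apply mul_left_cancel₀ hs0
      push_cast at h
      linarith
    rw [coord_reflectionPerm, coord_node, hi, hj, DynkinType.simpleCoord_of_lt hX hp']
    rcases eq_or_ne k (p + 1) with rfl | hk
    · simp only [if_true, or_true]
      push_cast
      rw [h₃]
      norm_num
    · simp [hk]
  match X, hX with
  | .B n, _ => exact ⟨key 1 (.inl ⟨n, rfl, rfl⟩), by simp⟩
  | .C n, _ => exact ⟨key 2 (.inr ⟨n, rfl, rfl⟩), by simp⟩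
  | .D n, hX =>
    clear key
    change p + 2 ≤ n at hp
    -- In type `D`, apply alternately the reflections which turn `e_{p+1} + e_{p+2}` into
    -- `e_p + e_{p+2}`, and this into `e_p + e_{p+1}`.
    have step : ∀ p, p + 3 ≤ n →
        (∃ i, (∀ k, ν.coord k (P.root i) =
          ((if k = p + 1 ∨ k = p + 1 + 1 then 1 else 0 : ℤ) : ℝ)) ∧
          InParabolic P (ν.tail (p + 1)) i) →
        ∃ i, (∀ k, ν.coord k (P.root i) = ((if k = p ∨ k = p + 2 then 1 else 0 : ℤ) : ℝ)) ∧
          InParabolic P (ν.tail p) i := by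
      rintro p hp ⟨i, hi, hi'⟩
      have hp' : p + 1 < (DynkinType.D n).rank := by change _ < n; omega
      refine ⟨P.reflectionPerm (ν.node ⟨p, by omega⟩) i, fun k => ?_,
        (hi'.mono (ν.tail_anti (Nat.le_succ p))).reflectionPerm
          (inParabolic_of_mem (ν.node_mem_tail le_rfl))⟩
      rw [coord_reflectionPerm, ν.pairing_node hX hi, coord_node, hi,
        DynkinType.corootCoord_of_lt hX hp', DynkinType.simpleCoord_of_lt hX hp']
      rw [← Int.cast_mul, ← Int.cast_sub, Int.cast_inj]
      simp only [true_or, if_true]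
      split_ifs <;> omega
    have pair : ∀ p, p + 2 ≤ n → ∃ i, (∀ k, ν.coord k (P.root i) =
        ((if k = p ∨ k = p + 1 then 1 else 0 : ℤ) : ℝ)) ∧ InParabolic P (ν.tail p) i := by
      intro p hp
      induction hm : n - 2 - p generalizing p with
      | zero =>
        refine ⟨ν.node ⟨p + 1, by change _ < n; omega⟩, fun k => ?_,
          inParabolic_of_mem (ν.node_mem_tail (Nat.le_succ p))⟩
        rw [coord_node]
        norm_cast
        simp only [DynkinType.simpleCoord]
        split_ifs <;> omega
      | succ m ih =>
        obtain ⟨i, hi, hi'⟩ := step p (by omega) (ih (p + 1) (by omega) (by omega))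
        have hp' : p + 1 + 1 < (DynkinType.D n).rank := by change _ < n; omega
        refine ⟨P.reflectionPerm (ν.node ⟨p + 1, by omega⟩) i, fun k => ?_,
          hi'.reflectionPerm (inParabolic_of_mem (ν.node_mem_tail (Nat.le_succ p)))⟩
        rw [coord_reflectionPerm, ν.pairing_node hX hi, coord_node, hi,
          DynkinType.corootCoord_of_lt hX hp', DynkinType.simpleCoord_of_lt hX hp']
        rw [← Int.cast_mul, ← Int.cast_sub, Int.cast_inj]
        simp only [or_true, if_true]
        split_ifs <;> omega
    exact ⟨pair p hp, fun _ hp3 => step p hp3 (pair (p + 1) (by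
      have : p + 3 ≤ n := hp3
      omega))⟩

end Labelling

end SmallWeights

namespace SmallWeights

/-! ### Canonical block decompositions in the classical types -/

theorem sum_mul_pair {n p q : ℕ} (g : ℕ → ℤ) (hpq : p ≠ q) (hp : p < n) (hq : q < n) :
    ∑ k ∈ Finset.range n, g k * (if k = p ∨ k = q then 1 else 0) = g p + g q := by
  have : ∀ k, g k * (if k = p ∨ k = q then 1 else 0) =
      (if k = p then g k else 0) + if k = q then g k else 0 := by
    intro k
    split_ifs <;> omega
  simp only [this, Finset.sum_add_distrib, Finset.sum_ite_eq', Finset.mem_range]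
  rw [if_pos hp, if_pos hq]

/-- Let `lam` vanish from `q + 2` on and be at most `1` at `q` and `q + 1`. Among the non-negative
vectors below `lam` with coordinate sum `2`, the lowest one is `e_q + e_{q+1}`. Heights are measured
by `h - 2 * k` at the `k`-th coordinate. -/
theorem single_or_lt_of_le {n q : ℕ} {h : ℤ} {β lam : ℕ → ℤ} (hq : q + 2 ≤ n)
    (h₀ : ∀ k < n, 0 ≤ β k) (h₁ : ∀ k < n, β k ≤ lam k)
    (hsum : ∑ k ∈ Finset.range n, β k = 2)
    (hlam : ∀ k < n, q ≤ k → lam k ≤ if k < q + 2 then 1 else 0) :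
    (∀ k < n, β k = if k = q ∨ k = q + 1 then 1 else 0) ∨
      (h - 2 * q) + (h - 2 * (q + 1)) < ∑ k ∈ Finset.range n, (h - 2 * k) * β k := by
  have hterm : ∀ k ∈ Finset.range n,
      ((k : ℤ) - q) * β k ≤ if k = q + 1 then 1 else 0 := by
    intro k hk
    rw [Finset.mem_range] at hk
    have h0 := h₀ k hk
    have h1 := h₁ k hk
    rcases lt_or_ge k q with hkq | hkq
    · rw [if_neg (by omega)]
      exact mul_nonpos_of_nonpos_of_nonneg (by omega) h0
    · have h2 := hlam k hk hkq
      rcases eq_or_ne k q with rfl | hk1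
      · rw [sub_self, zero_mul, if_neg (by omega)]
      rcases eq_or_ne k (q + 1) with rfl | hk2
      · rw [if_pos (by omega)] at h2
        rw [if_pos rfl, show ((q + 1 : ℕ) : ℤ) - q = 1 by omega, one_mul]
        omega
      · rw [if_neg (by omega)] at h2
        rw [if_neg hk2, show β k = 0 by omega, mul_zero]
  have hone : ∑ k ∈ Finset.range n, (if k = q + 1 then (1 : ℤ) else 0) = 1 := by
    simp [show q + 1 < n by omega]
  have hexp : ∑ k ∈ Finset.range n, (h - 2 * k) * β k =
      2 * (h - 2 * q) - 2 * ∑ k ∈ Finset.range n, ((k : ℤ) - q) * β k := by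
    rw [← hsum, Finset.sum_mul, Finset.mul_sum, ← Finset.sum_sub_distrib]
    exact Finset.sum_congr rfl fun k _ => by ring
  have hle := Finset.sum_le_sum hterm
  rw [hone] at hle
  rcases hle.lt_or_eq with hlt | heq
  · right
    rw [hexp]
    omega
  · left
    rw [← hone, Finset.sum_eq_sum_iff_of_le hterm] at heq
    have hother : ∀ k < n, k ≠ q → β k = if k = q + 1 then 1 else 0 := by
      intro k hk hkq
      have := heq k (Finset.mem_range.2 hk)
      split_ifs at this ⊢ with h3
      · rw [show (k : ℤ) - q = 1 by omega, one_mul] at this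
        exact this
      · exact (mul_eq_zero.1 this).resolve_left (by omega)
    have hβq : β q = 1 := by
      rw [← Finset.sum_erase_add _ _ (Finset.mem_range.2 (show q < n by omega)),
        Finset.sum_congr rfl fun k hk => hother k (Finset.mem_range.1 (Finset.mem_erase.1 hk).2)
          (Finset.mem_erase.1 hk).1] at hsum
      have : ∑ k ∈ (Finset.range n).erase q, (if k = q + 1 then (1 : ℤ) else 0) = 1 := by
        rw [Finset.sum_ite_eq', if_pos]
        simp
        omega
      omega
    intro k hk
    rcases eq_or_ne k q with rfl | hkq
    · simp [hβq]
    · rw [hother k hk hkq]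
      simp [hkq]

variable {ι V N : Type*} [AddCommGroup V] [Module ℝ V] [AddCommGroup N] [Module ℝ N]
  {P : RootPairing ι ℝ V N} [P.IsRootSystem]

namespace Labelling

variable {b : P.Base} {X : DynkinType} (ν : Labelling b X)

/-- The weight with coordinates `lam` is a sum of `m` but not fewer roots, and `L` is its only
canonical block decomposition. -/
structure HasDecomposition (l : V) (lam : ℕ → ℤ) (m : ℕ) (L : List (Finset ι)) : Prop where
  coord_eq : ∀ k, ν.coord k l = lam k
  hasLength : HasLength P l m
  isCanonical_iff : ∀ M, IsCanonical b l M ↔ M = L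
  mem_rootSpan : l ∈ P.rootSpan ℤ

theorem hasDecomposition_zero : ν.HasDecomposition 0 0 0 [] :=
  ⟨fun k => by simp, hasLength_zero, isCanonical_zero_iff, Submodule.zero_mem _⟩

variable {ν}

theorem HasDecomposition.coord_add_root {l : V} {lam : ℕ → ℤ} {m : ℕ} {L : List (Finset ι)}
    (h : ν.HasDecomposition l lam m L) {i : ι} {β : ℕ → ℤ}
    (hβ : ∀ k, ν.coord k (P.root i) = β k) (k : ℕ) :
    ν.coord k (l + P.root i) = ((lam k + β k : ℤ) : ℝ) := by
  rw [map_add, h.coord_eq, hβ, Int.cast_add]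

theorem HasDecomposition.exists_expression {l : V} {lam : ℕ → ℤ} {m : ℕ} {L : List (Finset ι)}
    (h : ν.HasDecomposition l lam m L) (i : ι) :
    ∃ e, IsExpression P (l + P.root i) e ∧ e.card = m + 1 := by
  obtain ⟨e, he, hcard⟩ := h.hasLength
  exact ⟨i ::ₘ e, by rw [IsExpression, Multiset.map_cons, Multiset.sum_cons, he.1, add_comm],
    by rw [Multiset.card_cons, hcard]⟩

variable (ν) [Fintype ι] [P.IsCrystallographic] [P.IsReduced]

theorem sum_coord_root_le (hX : X.IsClassical) (i : ι) :
    (∑ k ∈ Finset.range X.rank, ν.coord k) (P.root i) ≤ 2 := by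
  obtain ⟨β, hβ, h⟩ := ν.exists_rootCoord hX i
  simp only [LinearMap.sum_apply, hβ]
  exact_mod_cast h.sum_le_two

/-- The coordinates of a root sum to at most `2`, so the coordinate sum gives a lower bound for the
length. -/
theorem hasLength_of_sum_coord (hX : X.IsClassical) {l : V} {e : Multiset ι}
    (he : IsExpression P l e) {lam : ℕ → ℤ} (hlam : ∀ k, ν.coord k l = lam k)
    (h : 2 * ((e.card : ℤ) - 1) < ∑ k ∈ Finset.range X.rank, lam k) : HasLength P l e.card := by
  refine hasLength_of_functional he (∑ k ∈ Finset.range X.rank, ν.coord k) zero_le_two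
    (ν.sum_coord_root_le hX) ?_
  simp only [LinearMap.sum_apply, hlam]
  have : (((2 * ((e.card : ℤ) - 1) : ℤ)) : ℝ) < (∑ k ∈ Finset.range X.rank, lam k : ℤ) := by
    exact_mod_cast h
  push_cast at this
  linarith

/-- If the coordinates of a weight of length `k` sum to `2k`, the roots in its minimal expressions
have non-negative coordinates, which therefore do not exceed those of the weight. -/
theorem coord_le_of_tight (hX : X.IsClassical) {l : V} {m : ℕ} (hm : HasLength P l m)
    {lam : ℕ → ℤ} (hlam : ∀ k, ν.coord k l = lam k)
    (hsum : ∑ k ∈ Finset.range X.rank, lam k = 2 * m) {e : Multiset ι}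
    (he : IsMinimalExpression P l e) {i : ι} (hi : i ∈ e) :
    ∃ β : ℕ → ℤ, (∀ k, ν.coord k (P.root i) = β k) ∧ X.IsRootCoord β ∧
      ∑ k ∈ Finset.range X.rank, β k = 2 ∧ ∀ k < X.rank, 0 ≤ β k ∧ β k ≤ lam k := by
  classical
  have key : ∀ j ∈ e, ∃ β : ℕ → ℤ, (∀ k, ν.coord k (P.root j) = β k) ∧ X.IsRootCoord β ∧
      ∑ k ∈ Finset.range X.rank, β k = 2 ∧ ∀ k < X.rank, 0 ≤ β k := by
    intro j hj
    obtain ⟨β, hβ, hshape⟩ := ν.exists_rootCoord hX j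
    have h := he.1.apply_eq_of_mem (ν.sum_coord_root_le hX) (by
      rw [hm.card_eq he]
      simp only [LinearMap.sum_apply, hlam]
      rw [mul_comm]
      exact_mod_cast hsum) hj
    simp only [LinearMap.sum_apply, hβ] at h
    have h2 : ∑ k ∈ Finset.range X.rank, β k = 2 := by exact_mod_cast h
    exact ⟨β, hβ, hshape, h2, fun k hk => hshape.nonneg_of_sum_eq_two h2 hk⟩
  obtain ⟨β, hβ, hshape, h2, h0⟩ := key i hi
  refine ⟨β, hβ, hshape, h2, fun k hk => ⟨h0 k hk, ?_⟩⟩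
  have h := he.1.map_sum (ν.coord k)
  rw [← Multiset.cons_erase hi, Multiset.map_cons, Multiset.sum_cons, hlam, hβ] at h
  have hnn : 0 ≤ ((e.erase i).map fun i => ν.coord k (P.root i)).sum := by
    refine Multiset.sum_nonneg fun x hx => ?_
    obtain ⟨j, hj, rfl⟩ := Multiset.mem_map.1 hx
    obtain ⟨β', hβ', -, -, h0'⟩ := key j (Multiset.mem_of_mem_erase hj)
    rw [hβ']
    exact_mod_cast h0' k hk
  have : (β k : ℝ) ≤ lam k := by linarith
  exact_mod_cast this

variable {ν}

theorem HasDecomposition.hasLength_add_root (hX : X.IsClassical) {l : V} {lam : ℕ → ℤ} {m : ℕ}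
    {L : List (Finset ι)} (h : ν.HasDecomposition l lam m L) {i : ι} {β : ℕ → ℤ}
    (hβ : ∀ k, ν.coord k (P.root i) = β k)
    (hlen : 2 * (m : ℤ) < ∑ k ∈ Finset.range X.rank, (lam k + β k)) :
    HasLength P (l + P.root i) (m + 1) := by
  obtain ⟨e, he, hcard⟩ := h.exists_expression i
  rw [← hcard]
  refine ν.hasLength_of_sum_coord hX he (h.coord_add_root hβ) ?_
  rw [hcard]
  push_cast
  linarith

/-- Adjoining a block with one root: the criterion in coordinates. -/
theorem HasDecomposition.snoc (hX : X.IsClassical) {l : V} {lam : ℕ → ℤ} {m : ℕ}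
    {L : List (Finset ι)} (h : ν.HasDecomposition l lam m L) {i : ι} {β : ℕ → ℤ}
    (hβ : ∀ k, ν.coord k (P.root i) = β k)
    (horth : ∑ k ∈ Finset.range X.rank, β k * lam k = 0)
    (hlen : HasLength P (l + P.root i) (m + 1))
    (hpos : 0 < ∑ k ∈ Finset.range X.rank, (X.topHeight - 2 * k) * β k)
    (hlow : ∀ e, IsMinimalExpression P (l + P.root i) e → ∀ j ∈ e, ∃ β' : ℕ → ℤ,
      (∀ k, ν.coord k (P.root j) = β' k) ∧ ((∀ k < X.rank, β' k = β k) ∨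
        ∑ k ∈ Finset.range X.rank, (X.topHeight - 2 * k) * β k <
          ∑ k ∈ Finset.range X.rank, (X.topHeight - 2 * k) * β' k)) :
    ν.HasDecomposition (l + P.root i) (fun k => lam k + β k) (m + 1) (L ++ [{i}]) := by
  have hsub : l + P.root i - P.root i = l := add_sub_cancel_right _ _
  have hht := ν.two_mul_height hX hβ
  refine ⟨h.coord_add_root hβ, hlen, isCanonical_snoc_singleton_iff (k := m) ?_ ?_ hlen ?_ ?_ ?_,
    Submodule.add_mem _ h.mem_rootSpan (Submodule.subset_span ⟨i, rfl⟩)⟩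
  · rw [hsub]
    have hc := ν.sum_sq_mul_coroot hX hβ l
    simp only [h.coord_eq] at hc
    have h0 : ∑ k ∈ Finset.range X.rank, (β k : ℝ) * lam k = 0 := by exact_mod_cast horth
    rw [h0, mul_zero] at hc
    refine (mul_eq_zero.1 hc).resolve_left ?_
    obtain ⟨β', hβ', hshape⟩ := ν.exists_rootCoord hX i
    obtain rfl : β = β' := funext fun k => by exact_mod_cast (hβ k).symm.trans (hβ' k)
    exact_mod_cast hshape.sum_sq_pos.ne'
  · rw [hsub]
    exact h.hasLength
  · omega
  · intro e' he' j hj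
    obtain ⟨β', hβ', heq | hlt⟩ := hlow e' he' j hj
    · exact .inl (ν.root_eq_of_coord hX fun k hk => by rw [hβ', hβ, heq k hk])
    · right
      have := ν.two_mul_height hX hβ'
      omega
  · rw [hsub]
    exact h.isCanonical_iff

theorem two_mul_rank_le (hX : X.IsClassical) : 2 * (X.rank : ℤ) - 2 ≤ X.topHeight := by
  match X, hX with
  | .B n, _ => change 2 * (n : ℤ) - 2 ≤ 2 * n; omega
  | .C n, _ => change 2 * (n : ℤ) - 2 ≤ 2 * n - 1; omega
  | .D n, _ => exact le_rfl

/-- Adjoining to a weight in the first `q` coordinates the sum of the next two unit vectors. -/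
theorem HasDecomposition.snoc_pair (hX : X.IsClassical) {l : V} {lam : ℕ → ℤ} {m : ℕ}
    {L : List (Finset ι)} (h : ν.HasDecomposition l lam m L) {q : ℕ} (hq : q + 2 ≤ X.rank)
    (hlam : ∀ k, q ≤ k → lam k = 0) (hsum : ∑ k ∈ Finset.range X.rank, lam k = 2 * m) {i : ι}
    (hi : ∀ k, ν.coord k (P.root i) = ((if k = q ∨ k = q + 1 then 1 else 0 : ℤ) : ℝ)) :
    ν.HasDecomposition (l + P.root i) (fun k => lam k + if k = q ∨ k = q + 1 then 1 else 0) (m + 1)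
      (L ++ [{i}]) ∧ ∑ k ∈ Finset.range X.rank, (lam k + if k = q ∨ k = q + 1 then 1 else 0) =
        2 * (m + 1) := by
  have hsplit : ∀ g : ℕ → ℤ, ∑ k ∈ Finset.range X.rank,
      g k * (if k = q ∨ k = q + 1 then 1 else 0) = g q + g (q + 1) := fun g =>
    sum_mul_pair g (by omega) (by omega) (by omega)
  have hsum' : ∑ k ∈ Finset.range X.rank, (lam k + if k = q ∨ k = q + 1 then 1 else 0) =
      2 * (m + 1) := by
    have := hsplit fun _ => 1
    simp only [one_mul] at this
    rw [Finset.sum_add_distrib, hsum, this]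
    ring
  have hlen := h.hasLength_add_root hX hi (by rw [hsum']; omega)
  refine ⟨h.snoc hX hi ?_ hlen ?_ ?_, hsum'⟩
  · simp only [mul_comm _ (lam _)]
    rw [hsplit, hlam q le_rfl, hlam (q + 1) (by omega)]
    rfl
  · rw [hsplit fun k => X.topHeight - 2 * k]
    have := two_mul_rank_le hX
    push_cast
    omega
  · intro e he j hj
    obtain ⟨β, hβ, -, h2, hle⟩ := ν.coord_le_of_tight hX hlen (h.coord_add_root hi)
      (by rw [hsum']; push_cast; rfl) he hj
    refine ⟨β, hβ, ?_⟩
    rw [hsplit fun k => X.topHeight - 2 * k]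
    have := single_or_lt_of_le (h := X.topHeight) hq (fun k hk => (hle k hk).1)
      (fun k hk => (hle k hk).2) h2 (fun k hk hkq => by
        rw [hlam k hkq]
        split_ifs <;> omega)
    exact_mod_cast this

/-- Adjoining the sums of the `t` pairs of unit vectors which follow the first `p` ones. -/
theorem HasDecomposition.append_pairs (hX : X.IsClassical) {l : V} {lam : ℕ → ℤ} {m : ℕ}
    {L : List (Finset ι)} (h : ν.HasDecomposition l lam m L) {p t : ℕ} (hp : p + 2 * t ≤ X.rank)
    (hlam : ∀ k, p ≤ k → lam k = 0) (hsum : ∑ k ∈ Finset.range X.rank, lam k = 2 * m)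
    {r : ℕ → ι} (hr : ∀ q, q + 2 ≤ X.rank →
      ∀ k, ν.coord k (P.root (r q)) = ((if k = q ∨ k = q + 1 then 1 else 0 : ℤ) : ℝ)) :
    ∃ l', ν.HasDecomposition l' (fun k => lam k + if p ≤ k ∧ k < p + 2 * t then 1 else 0) (m + t)
      (L ++ (List.range t).map fun j => {r (p + 2 * j)}) ∧
      ∑ k ∈ Finset.range X.rank, (lam k + if p ≤ k ∧ k < p + 2 * t then 1 else 0) =
        2 * (m + t) := by
  induction t with
  | zero =>
    refine ⟨l, ?_, ?_⟩
    · have : (fun k => lam k + if p ≤ k ∧ k < p + 2 * 0 then 1 else 0) = lam := by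
        funext k
        rw [if_neg (by omega), add_zero]
      rw [this]
      simpa using h
    · rw [Finset.sum_congr rfl fun k _ => by rw [if_neg (by omega), add_zero], hsum]
      push_cast
      ring
  | succ t ih =>
    obtain ⟨l', h', hsum'⟩ := ih (by omega)
    obtain ⟨h₁, h₂⟩ := h'.snoc_pair hX (q := p + 2 * t) (by omega) (fun k hk => by
      rw [hlam k (by omega), if_neg (by omega)]
      rfl) (by rw [hsum']; push_cast; rfl) (hr (p + 2 * t) (by omega))
    have hfun : (fun k => (lam k + if p ≤ k ∧ k < p + 2 * t then 1 else 0) +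
        if k = p + 2 * t ∨ k = p + 2 * t + 1 then 1 else 0) =
        fun k => lam k + if p ≤ k ∧ k < p + 2 * (t + 1) then 1 else 0 := by
      funext k
      split_ifs <;> omega
    have hfun' := fun k => congrFun hfun k
    refine ⟨l' + P.root (r (p + 2 * t)), ?_, ?_⟩
    · rw [List.range_succ, List.map_append, ← List.append_assoc, ← hfun]
      exact h₁
    · rw [← Finset.sum_congr rfl fun k _ => hfun' k, h₂]
      push_cast
      ring

end Labelling

end SmallWeights

namespace SmallWeights

/-! ### Cascades in the classical types -/

namespace DynkinType

/-- The type of the component which remains after removal of the first `p` nodes. -/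
def tailType : DynkinType → ℕ → DynkinType
  | B n, p => typeB (n - p)
  | C n, p => typeC (n - p)
  | D n, p => typeD (n - p)
  | X, _ => X

end DynkinType

variable {ι V N : Type*} [AddCommGroup V] [Module ℝ V] [AddCommGroup N] [Module ℝ N]
  {P : RootPairing ι ℝ V N}

namespace Labelling

variable {b : P.Base} {X : DynkinType} (ν : Labelling b X)

/-- The component of the diagram with nodes `ν.tail p` used by the cascade. This is the whole
diagram, unless it is `D_2 = A_1 + A_1`, where the last node is chosen. -/
def component (p : ℕ) : Set ι :=
  {i | ∃ j : Fin X.rank, (p ≤ j ∧ ((∃ n, X = .D n ∧ p + 2 = n) → p < j)) ∧ ν.node j = i}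

theorem component_subset_tail (p : ℕ) : ν.component p ⊆ ν.tail p := by
  rintro _ ⟨j, h, rfl⟩
  exact ν.node_mem_tail h.1

theorem component_eq_tail {p : ℕ} (h : ¬ ∃ n, X = .D n ∧ p + 2 = n) :
    ν.component p = ν.tail p := by
  refine (ν.component_subset_tail p).antisymm ?_
  rintro _ ⟨j, hj, rfl⟩
  exact ⟨j, ⟨hj, fun h' => absurd h' h⟩, rfl⟩

theorem node_mem_tail_iff {p : ℕ} {j : Fin X.rank} : ν.node j ∈ ν.tail p ↔ p ≤ j := by
  refine ⟨?_, fun h => ν.node_mem_tail h⟩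
  rintro ⟨k, hk, h⟩
  rwa [← ν.injective h]

theorem node_mem_component_iff {p : ℕ} {j : Fin X.rank} : ν.node j ∈ ν.component p ↔
    p ≤ j ∧ ((∃ n, X = .D n ∧ p + 2 = n) → p < j) := by
  refine ⟨?_, fun h => ⟨j, h, rfl⟩⟩
  rintro ⟨k, hk, h⟩
  rwa [← ν.injective h]

variable [P.IsCrystallographic]

/-- The type of the component, from an enumeration `g` of the numbers of its nodes. -/
theorem hasType_component_of {p : ℕ} {Y : DynkinType} (hY : Y.IsProper) (g : ℕ → ℕ)
    (hg : ∀ k < Y.rank, g k < X.rank) (hinj : ∀ k < Y.rank, ∀ k' < Y.rank, g k = g k' → k = k')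
    (h : ∀ (i : ℕ) (hi : i < Y.rank) (j : ℕ) (hj : j < Y.rank),
      X.cartan ⟨g i, hg i hi⟩ ⟨g j, hg j hj⟩ = Y.cartan ⟨i, hi⟩ ⟨j, hj⟩)
    (hC : ∀ j < X.rank, (∃ k < Y.rank, g k = j) ↔
      p ≤ j ∧ ((∃ n, X = .D n ∧ p + 2 = n) → p < j)) :
    HasType P (ν.component p) Y := by
  have : ν.component p = Set.range fun k : Fin Y.rank => ν.node ⟨g k, hg k k.2⟩ := by
    ext i
    constructor
    · rintro ⟨j, hj, rfl⟩
      obtain ⟨k, hk, hkj⟩ := (hC j j.2).2 hj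
      exact ⟨⟨k, hk⟩, congrArg ν.node (Fin.ext hkj)⟩
    · rintro ⟨k, rfl⟩
      exact ⟨_, (hC _ (hg k k.2)).1 ⟨k, k.2, rfl⟩, rfl⟩
  rw [this]
  refine ν.hasType_range hY (fun i j hij => Fin.ext (hinj i i.2 j j.2 (Fin.mk.inj hij)))
    fun i j => h i i.2 j j.2

/-- In type `D` at least two nodes have to remain: the last node alone does not occur in the
cascades, and `typeD 1` has no meaning. -/
theorem hasType_component (hX : X.IsClassical) {p : ℕ} (hp : p < X.rank)
    (hD : (∃ n, X = .D n) → p + 2 ≤ X.rank) : HasType P (ν.component p) (X.tailType p) := by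
  match X, hX with
  | .B n, (hn : 2 ≤ n) =>
    change p < n at hp
    have hs : ¬ ∃ m, DynkinType.B n = .D m ∧ p + 2 = m := by simp
    change HasType P _ (DynkinType.typeB (n - p))
    rcases (show n - p = 1 ∨ 2 ≤ n - p by omega) with h1 | h2
    · rw [h1]
      refine ν.hasType_component_of (Y := .A 1) le_rfl (fun _ => p) (fun _ _ => hp) ?_ ?_ ?_
      · intro k (hk : k < 1) k' (hk' : k' < 1) _
        omega
      · intro i (hi : i < 1) j (hj : j < 1)
        obtain rfl : i = j := by omega
        exact (CartanMatrix.B_diag n _).trans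
          (show 2 = CartanMatrix.A 1 ⟨i, hi⟩ ⟨i, hi⟩ by simp [CartanMatrix.A])
      · intro j (hj : j < n)
        simp only [hs, false_imp_iff, and_true]
        exact ⟨fun ⟨_, _, h⟩ => h.le, fun h => ⟨0, one_pos, by omega⟩⟩
    · rw [DynkinType.typeB, if_neg (by omega)]
      refine ν.hasType_component_of (Y := .B (n - p)) h2 (fun k => p + k)
        (fun k (hk : k < n - p) => (show p + k < n by omega)) ?_ ?_ ?_
      · intro k _ k' _ h
        exact Nat.add_left_cancel h
      · intro i (hi : i < n - p) j (hj : j < n - p)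
        change CartanMatrix.B n ⟨_, _⟩ ⟨_, _⟩ = CartanMatrix.B (n - p) ⟨i, hi⟩ ⟨j, hj⟩
        simp only [CartanMatrix.B, Matrix.of_apply, Fin.mk.injEq]
        split_ifs <;> omega
      · intro j (hj : j < n)
        simp only [hs, false_imp_iff, and_true]
        exact ⟨fun ⟨_, _, h⟩ => by omega, fun h => ⟨j - p, show j - p < n - p by omega, by omega⟩⟩
  | .C n, (hn : 3 ≤ n) =>
    change p < n at hp
    have hs : ¬ ∃ m, DynkinType.C n = .D m ∧ p + 2 = m := by simp
    change HasType P _ (DynkinType.typeC (n - p))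
    rcases (show n - p = 1 ∨ n - p = 2 ∨ 3 ≤ n - p by omega) with h1 | h2 | h3
    · rw [h1]
      refine ν.hasType_component_of (Y := .A 1) le_rfl (fun _ => p) (fun _ _ => hp) ?_ ?_ ?_
      · intro k (hk : k < 1) k' (hk' : k' < 1) _
        omega
      · intro i (hi : i < 1) j (hj : j < 1)
        obtain rfl : i = j := by omega
        exact (CartanMatrix.C_diag n _).trans
          (show 2 = CartanMatrix.A 1 ⟨i, hi⟩ ⟨i, hi⟩ by simp [CartanMatrix.A])
      · intro j (hj : j < n)
        simp only [hs, false_imp_iff, and_true]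
        exact ⟨fun ⟨_, _, h⟩ => h.le, fun h => ⟨0, one_pos, by omega⟩⟩
    · -- The two nodes of `C_2` in reverse order form `B_2`.
      rw [h2]
      refine ν.hasType_component_of (Y := .B 2) le_rfl (fun k => p + 1 - k)
        (fun k (hk : k < 2) => (show p + 1 - k < n by omega)) ?_ ?_ ?_
      · intro k (hk : k < 2) k' (hk' : k' < 2) h
        omega
      · intro i (hi : i < 2) j (hj : j < 2)
        change CartanMatrix.C n ⟨_, _⟩ ⟨_, _⟩ = CartanMatrix.B 2 ⟨i, hi⟩ ⟨j, hj⟩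
        simp only [CartanMatrix.B, CartanMatrix.C, Matrix.of_apply, Fin.mk.injEq]
        split_ifs <;> omega
      · intro j (hj : j < n)
        simp only [hs, false_imp_iff, and_true]
        refine ⟨fun ⟨k, (hk : k < 2), h⟩ => by omega, fun h => ⟨p + 1 - j, ?_, by omega⟩⟩
        change p + 1 - j < 2
        omega
    · rw [DynkinType.typeC, if_neg (by omega), if_neg (by omega)]
      refine ν.hasType_component_of (Y := .C (n - p)) h3 (fun k => p + k)
        (fun k (hk : k < n - p) => (show p + k < n by omega)) ?_ ?_ ?_
      · intro k _ k' _ h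
        exact Nat.add_left_cancel h
      · intro i (hi : i < n - p) j (hj : j < n - p)
        change CartanMatrix.C n ⟨_, _⟩ ⟨_, _⟩ = CartanMatrix.C (n - p) ⟨i, hi⟩ ⟨j, hj⟩
        simp only [CartanMatrix.C, Matrix.of_apply, Fin.mk.injEq]
        split_ifs <;> omega
      · intro j (hj : j < n)
        simp only [hs, false_imp_iff, and_true]
        exact ⟨fun ⟨_, _, h⟩ => by omega, fun h => ⟨j - p, show j - p < n - p by omega, by omega⟩⟩
  | .D n, (hn : 4 ≤ n) =>
    have hp2 : p + 2 ≤ n := hD ⟨n, rfl⟩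
    clear hD hp
    have hs : (∃ m, DynkinType.D n = .D m ∧ p + 2 = m) ↔ p + 2 = n := by
      simp [eq_comm]
    change HasType P _ (DynkinType.typeD (n - p))
    rcases (show n - p = 2 ∨ n - p = 3 ∨ 4 ≤ n - p by omega) with h2 | h3 | h4
    · rw [h2]
      refine ν.hasType_component_of (Y := .A 1) le_rfl (fun _ => p + 1)
        (fun _ _ => show p + 1 < n by omega) ?_ ?_ ?_
      · intro k (hk : k < 1) k' (hk' : k' < 1) _
        omega
      · intro i (hi : i < 1) j (hj : j < 1)
        obtain rfl : i = j := by omega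
        exact (CartanMatrix.D_diag n _).trans
          (show 2 = CartanMatrix.A 1 ⟨i, hi⟩ ⟨i, hi⟩ by simp [CartanMatrix.A])
      · intro j (hj : j < n)
        simp only [hs]
        exact ⟨fun ⟨_, _, h⟩ => by omega, fun h => ⟨0, one_pos, by omega⟩⟩
    · -- In `D_3 = A_3` the branch node is in the middle.
      rw [h3]
      have hg : ∀ k < 3, (if k = 0 then p + 1 else if k = 1 then p else p + 2) < n := by
        intro k hk
        split_ifs <;> omega
      refine ν.hasType_component_of (Y := .A 3) (show 1 ≤ 3 by norm_num)
        (fun k => if k = 0 then p + 1 else if k = 1 then p else p + 2) hg ?_ ?_ ?_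
      · intro k (hk : k < 3) k' (hk' : k' < 3) h
        split_ifs at h <;> omega
      · intro i (hi : i < 3) j (hj : j < 3)
        change CartanMatrix.D n ⟨_, _⟩ ⟨_, _⟩ = CartanMatrix.A 3 ⟨i, hi⟩ ⟨j, hj⟩
        simp only [CartanMatrix.D, CartanMatrix.A, Matrix.of_apply, Fin.mk.injEq]
        interval_cases i <;> interval_cases j <;> simp <;> omega
      · intro j (hj : j < n)
        simp only [hs]
        refine ⟨fun ⟨k, _, h⟩ => ?_, fun h => ?_⟩
        · split_ifs at h <;> omega
        · rcases (show j = p + 1 ∨ j = p ∨ j = p + 2 by omega) with h | h | h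
          · exact ⟨0, show 0 < 3 by norm_num, by simp [h]⟩
          · exact ⟨1, show 1 < 3 by norm_num, by simp [h]⟩
          · exact ⟨2, show 2 < 3 by norm_num, by simp [h]⟩
    · rw [DynkinType.typeD, if_neg (by omega), if_neg (by omega)]
      refine ν.hasType_component_of (Y := .D (n - p)) h4 (fun k => p + k)
        (fun k (hk : k < n - p) => (show p + k < n by omega)) ?_ ?_ ?_
      · intro k _ k' _ h
        exact Nat.add_left_cancel h
      · intro i (hi : i < n - p) j (hj : j < n - p)
        change CartanMatrix.D n ⟨_, _⟩ ⟨_, _⟩ = CartanMatrix.D (n - p) ⟨i, hi⟩ ⟨j, hj⟩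
        simp only [CartanMatrix.D, Matrix.of_apply, Fin.mk.injEq]
        clear hs hX hn
        grind (splits := 30)
      · intro j (hj : j < n)
        simp only [hs]
        exact ⟨fun ⟨_, _, h⟩ => by omega, fun h => ⟨j - p, show j - p < n - p by omega, by omega⟩⟩

end Labelling

end SmallWeights

namespace SmallWeights

variable {ι V N : Type*} [AddCommGroup V] [Module ℝ V] [AddCommGroup N] [Module ℝ N]
  {P : RootPairing ι ℝ V N}

namespace Labelling

variable {b : P.Base} {X : DynkinType} (ν : Labelling b X)

/-- The diagram with nodes `ν.tail p` is a union of components of the diagram with nodes `Γ`. -/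
def Splits (Γ : Set ι) (p : ℕ) : Prop :=
  ν.tail p ⊆ Γ ∧ ∀ i ∈ ν.tail p, ∀ j ∈ Γ \ ν.tail p, P.pairing i j = 0

/-- A cascade which has arrived at the diagram with nodes `Γ` can be continued with the coordinates
from `p` on. In type `D` this is no condition on `Γ` if fewer than two coordinates are left. -/
def Continues (Γ : Set ι) (p : ℕ) : Prop :=
  ν.Splits Γ p ∨ ∃ n, X = .D n ∧ n ≤ p + 1

theorem splits_zero : ν.Splits b.support 0 := by
  rw [Splits, tail_zero, Set.sdiff_self]
  exact ⟨subset_rfl, fun _ _ _ h => h.elim⟩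

theorem isComponent_component [P.IsCrystallographic] (hX : X.IsClassical) {p : ℕ}
    (hp : p < X.rank) (hD : (∃ n, X = .D n) → p + 2 ≤ X.rank) {Γ : Set ι} (hΓ : ν.Splits Γ p) :
    IsComponent P Γ (ν.component p) := by
  refine (ν.hasType_component hX hp hD).isComponent ((ν.component_subset_tail p).trans hΓ.1) ?_ ?_
  · by_cases h : ∃ n, X = .D n ∧ p + 2 = n
    · obtain ⟨n, rfl, rfl⟩ := h
      exact ⟨_, ν.node_mem_component_iff (j := ⟨p + 1, Nat.lt_succ_self _⟩).2
        ⟨Nat.le_succ p, fun _ => Nat.lt_succ_self p⟩⟩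
    · exact ⟨_, ν.node_mem_component_iff (j := ⟨p, hp⟩).2 ⟨le_rfl, fun h' => absurd h' h⟩⟩
  · rintro i hi j ⟨hj, hjC⟩
    by_cases hjt : j ∈ ν.tail p
    · obtain ⟨i, ⟨hi, hi'⟩, rfl⟩ := hi
      obtain ⟨j, hj', rfl⟩ := hjt
      rw [node_mem_component_iff, not_and, Classical.not_imp] at hjC
      obtain ⟨⟨n, rfl, hn⟩, hjp⟩ := hjC hj'
      have hi' := hi' ⟨_, rfl, hn⟩
      refine ν.pairing_eq_zero ?_
      obtain ⟨i, hi2⟩ := i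
      obtain ⟨j, hj2⟩ := j
      change i < n at hi2
      change j < n at hj2
      change p < i at hi'
      change p ≤ j at hj'
      change ¬ p < j at hjp
      change CartanMatrix.D n ⟨i, hi2⟩ ⟨j, hj2⟩ = 0
      simp only [CartanMatrix.D, Matrix.of_apply, Fin.mk.injEq]
      split_ifs <;> omega
    · exact hΓ.2 i (ν.component_subset_tail p hi) j ⟨hj, hjt⟩

variable [P.IsRootSystem]

theorem mem_orthogonalNodes_iff (hX : X.IsClassical) {C : Set ι} {i : ι} {β : ℕ → ℤ}
    (hβ : ∀ k, ν.coord k (P.root i) = β k) (j : Fin X.rank) :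
    ν.node j ∈ orthogonalNodes P C {i} ↔ ν.node j ∈ C ∧ X.corootCoord β j = 0 := by
  rw [orthogonalNodes, Set.mem_ofPred_eq]
  simp only [Finset.mem_singleton, forall_eq]
  rw [P.pairing_eq_zero_iff, ν.pairing_node hX hβ, Int.cast_eq_zero]

theorem isDominantRoot_of_coord (hX : X.IsClassical) {C : Set ι} {i : ι} (hi : InParabolic P C i)
    {β : ℕ → ℤ} (hβ : ∀ k, ν.coord k (P.root i) = β k)
    (h : ∀ j : Fin X.rank, ν.node j ∈ C → 0 ≤ X.corootCoord β j) (hC : C ⊆ ν.tail 0) :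
    IsDominantRoot P C i := by
  refine ⟨hi, fun j hj => ?_⟩
  obtain ⟨j, -, rfl⟩ := hC hj
  rw [ν.pairing_node hX hβ]
  exact_mod_cast h j hj

variable [P.IsCrystallographic]

variable [Fintype ι]

/-- A step of the cascade with a single root, in coordinates. -/
theorem isCascade_cons (hX : X.IsClassical) {p : ℕ} (hp : p < X.rank)
    (hD : (∃ n, X = .D n) → p + 2 ≤ X.rank) {Γ : Set ι} (hΓ : ν.Splits Γ p) {i : ι}
    (hi : InParabolic P (ν.component p) i) {β : ℕ → ℤ} (hβ : ∀ k, ν.coord k (P.root i) = β k)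
    (h : ∀ j : Fin X.rank, p ≤ j → 0 ≤ X.corootCoord β j) {a : Mark} (ha : a.LengthMark P i)
    {L : List (Finset ι)} {s : Symbol}
    (hL : IsCascade P (orthogonalNodes P (ν.component p) {i}) L s) :
    IsCascade P Γ ({i} :: L) ((a, X.tailType p) :: s) :=
  .cons (ν.isComponent_component hX hp hD hΓ) (ν.hasType_component hX hp hD)
    (.inl ⟨i, ν.isDominantRoot_of_coord hX hi hβ (fun j hj => h j (ν.node_mem_component_iff.1 hj).1)
      ((ν.component_subset_tail p).trans (ν.tail_anti (Nat.zero_le p))), ha, rfl⟩) hL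

end Labelling

namespace DynkinType

variable {X : DynkinType}

/-- The vector `e_p + e_{p+1}` is dominant for the simple roots from number `p` on, and orthogonal
to those among them different from number `p + 1` and, in `D_3`, the last one. -/
theorem corootCoord_pair (hX : X.IsClassical) {p j : ℕ} (hj : j < X.rank) (hpj : p ≤ j)
    (hp : p + 2 ≤ X.rank) :
    0 ≤ X.corootCoord (fun k => if k = p ∨ k = p + 1 then (1 : ℤ) else 0) j ∧
      (X.corootCoord (fun k => if k = p ∨ k = p + 1 then (1 : ℤ) else 0) j = 0 ↔
        j ≠ p + 1 ∧ ¬ ((∃ n, X = .D n ∧ p + 3 = n) ∧ j = p + 2)) := by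
  match X, hX with
  | .B n, (hn : 2 ≤ n) =>
    change j < n at hj
    change p + 2 ≤ n at hp
    simp only [corootCoord, reduceCtorEq, false_and, exists_false, not_false_iff, and_true]
    split_ifs <;> omega
  | .C n, (hn : 3 ≤ n) =>
    change j < n at hj
    change p + 2 ≤ n at hp
    simp only [corootCoord, reduceCtorEq, false_and, exists_false, not_false_iff, and_true]
    split_ifs <;> omega
  | .D n, (hn : 4 ≤ n) =>
    change j < n at hj
    change p + 2 ≤ n at hp
    have hs : (∃ m, DynkinType.D n = .D m ∧ p + 3 = m) ↔ p + 3 = n := by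
      simp [eq_comm]
    simp only [corootCoord, hs]
    clear hs
    split_ifs <;> omega

end DynkinType

namespace Labelling

variable {b : P.Base} {X : DynkinType} (ν : Labelling b X) [P.IsRootSystem]

/-- The nodes orthogonal to `e_p + e_{p+1}` are the isolated node number `p` and those from number
`p + 2` on. -/
theorem continues_orthogonalNodes (hX : X.IsClassical) {p : ℕ} (hp : p + 2 ≤ X.rank) {i : ι}
    (hi : ∀ k, ν.coord k (P.root i) = ((if k = p ∨ k = p + 1 then 1 else 0 : ℤ) : ℝ)) :
    ν.Continues (orthogonalNodes P (ν.component p) {i}) (p + 2) := by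
  by_cases hs : ∃ n, X = .D n ∧ n ≤ p + 3
  · exact .inr hs
  left
  have hC : ν.component p = ν.tail p := ν.component_eq_tail fun ⟨n, h, h'⟩ => hs ⟨n, h, by omega⟩
  have hs3 : ¬ ∃ n, X = .D n ∧ p + 3 = n := fun ⟨n, h, h'⟩ => hs ⟨n, h, h'.ge⟩
  have hmem : ∀ j : Fin X.rank, ν.node j ∈ orthogonalNodes P (ν.component p) {i} ↔
      p ≤ j ∧ (j : ℕ) ≠ p + 1 := by
    intro j
    rw [ν.mem_orthogonalNodes_iff hX hi, hC, node_mem_tail_iff]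
    refine and_congr_right fun hj => ?_
    rw [(DynkinType.corootCoord_pair hX j.2 hj hp).2]
    rw [and_iff_left fun h => hs3 h.1]
  constructor
  · rintro _ ⟨j, hj, rfl⟩
    exact (hmem j).2 ⟨by omega, by omega⟩
  · rintro _ ⟨j, hj, rfl⟩ i' ⟨hi', hit⟩
    have hi0 := hi'.1
    rw [hC] at hi0
    obtain ⟨k, -, rfl⟩ := hi0
    rw [hmem] at hi'
    rw [node_mem_tail_iff] at hit
    have hk : (k : ℕ) = p := by omega
    refine ν.pairing_eq_zero ?_
    rw [DynkinType.cartan_eq_corootCoord hX,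
      DynkinType.corootCoord_of_lt hX (show (k : ℕ) + 1 < X.rank by omega)]
    have hj2 := j.2
    match X, hX with
    | .B n, _ =>
      simp only [DynkinType.simpleCoord]
      split_ifs <;> omega
    | .C n, _ =>
      simp only [DynkinType.simpleCoord]
      split_ifs <;> omega
    | .D n, _ =>
      have : ¬ n ≤ p + 3 := fun h => hs ⟨n, rfl, h⟩
      simp only [DynkinType.simpleCoord]
      split_ifs <;> omega

variable [Fintype ι]

theorem exists_rootForm_root (hX : X.IsClassical) : ∃ c : ℝ, 0 < c ∧ ∀ (i : ι) (β : ℕ → ℤ),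
    (∀ k, ν.coord k (P.root i) = β k) →
      P.RootForm (P.root i) (P.root i) = c * (∑ k ∈ Finset.range X.rank, β k ^ 2 : ℤ) := by
  obtain ⟨c, hc, h⟩ := ν.exists_rootForm_eq_coord hX
  refine ⟨c, hc, fun i β hβ => ?_⟩
  rw [h]
  simp only [hβ]
  push_cast
  simp only [sq]

theorem not_oneLength (hX : X.IsClassical) {i j : ι} {β γ : ℕ → ℤ}
    (hi : ∀ k, ν.coord k (P.root i) = β k) (hj : ∀ k, ν.coord k (P.root j) = γ k)
    (h : ∑ k ∈ Finset.range X.rank, β k ^ 2 ≠ ∑ k ∈ Finset.range X.rank, γ k ^ 2) :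
    ¬ OneLength P := by
  obtain ⟨c, hc, hform⟩ := ν.exists_rootForm_root hX
  intro hone
  have := hone i j
  rw [hform i β hi, hform j γ hj] at this
  exact h (by exact_mod_cast mul_left_cancel₀ hc.ne' this)

variable [P.IsCrystallographic]

/-- The cascade through the sums of consecutive pairs of unit vectors. -/
theorem isCascade_pairs [P.IsReduced] (hX : X.IsClassical) {r : ℕ → ι}
    (hr : ∀ q, q + 2 ≤ X.rank →
      (∀ k, ν.coord k (P.root (r q)) = ((if k = q ∨ k = q + 1 then 1 else 0 : ℤ) : ℝ)) ∧
      InParabolic P (ν.tail q) (r q))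
    {a : Mark} (ha : ∀ q, q + 2 ≤ X.rank → a.LengthMark P (r q)) {p t : ℕ}
    (hp : p + 2 * t ≤ X.rank) {L : List (Finset ι)} {s : Symbol}
    (hL : ∀ Γ, ν.Continues Γ (p + 2 * t) → IsCascade P Γ L s) {Γ : Set ι} (hΓ : ν.Continues Γ p) :
    IsCascade P Γ (((List.range t).map fun j => {r (p + 2 * j)}) ++ L)
      (((List.range t).map fun j => (a, X.tailType (p + 2 * j))) ++ s) := by
  induction t generalizing p Γ with
  | zero => exact hL Γ hΓ
  | succ t ih =>
    have hp2 : p + 2 ≤ X.rank := by omega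
    obtain ⟨hβ, hpar⟩ := hr p hp2
    have hshift : ∀ j, p + 2 * (j + 1) = p + 2 + 2 * j := fun j => by ring
    simp only [List.range_succ_eq_map, List.map_cons, List.map_map, Function.comp_def,
      Nat.succ_eq_add_one, hshift, mul_zero, add_zero, List.cons_append]
    have hsplit : ν.Splits Γ p := by
      refine hΓ.resolve_right ?_
      rintro ⟨n, rfl, hn⟩
      change p + 2 ≤ n at hp2
      omega
    refine ν.isCascade_cons hX (by omega) (fun _ => hp2) hsplit ?_ hβ
      (fun j hj => (DynkinType.corootCoord_pair hX j.2 hj hp2).1) (ha p hp2)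
      (ih (by omega) (fun Γ h => hL Γ (by rwa [hshift])) (ν.continues_orthogonalNodes hX hp2 hβ))
    by_cases hs : ∃ n, X = .D n ∧ p + 2 = n
    · -- In `D_2` the root in question is the last simple root.
      obtain ⟨n, rfl, hn⟩ := hs
      have hcoord : ∀ k, (if k = p ∨ k = p + 1 then 1 else 0 : ℤ) =
          (DynkinType.D n).simpleCoord (p + 1) k := by
        intro k
        simp only [DynkinType.simpleCoord]
        split_ifs <;> omega
      have hp1 : p + 1 < (DynkinType.D n).rank := hp2
      have : r p = ν.node ⟨p + 1, hp1⟩ := ν.root_eq_of_coord hX fun k _ => by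
        rw [hβ, coord_node, hcoord]
      rw [this]
      exact inParabolic_of_mem (ν.node_mem_component_iff.2
        ⟨Nat.le_succ p, fun _ => Nat.lt_succ_self p⟩)
    · rwa [ν.component_eq_tail hs]

variable [P.IsReduced]

theorem isShort_of_sum_sq (hX : X.IsClassical) {i : ι} {β : ℕ → ℤ}
    (hi : ∀ k, ν.coord k (P.root i) = β k) (h : ∀ γ, X.IsRootCoord γ →
      ∑ k ∈ Finset.range X.rank, β k ^ 2 ≤ ∑ k ∈ Finset.range X.rank, γ k ^ 2) : IsShort P i := by
  obtain ⟨c, hc, hform⟩ := ν.exists_rootForm_root hX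
  intro j
  obtain ⟨γ, hγ, hγ'⟩ := ν.exists_rootCoord hX j
  rw [hform i β hi, hform j γ hγ]
  exact mul_le_mul_of_nonneg_left (by exact_mod_cast h γ hγ') hc.le

theorem isLong_of_sum_sq (hX : X.IsClassical) {i : ι} {β : ℕ → ℤ}
    (hi : ∀ k, ν.coord k (P.root i) = β k) (h : ∀ γ, X.IsRootCoord γ →
      ∑ k ∈ Finset.range X.rank, γ k ^ 2 ≤ ∑ k ∈ Finset.range X.rank, β k ^ 2) : IsLong P i := by
  obtain ⟨c, hc, hform⟩ := ν.exists_rootForm_root hX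
  intro j
  obtain ⟨γ, hγ, hγ'⟩ := ν.exists_rootCoord hX j
  rw [hform i β hi, hform j γ hγ]
  exact mul_le_mul_of_nonneg_left (by exact_mod_cast h γ hγ') hc.le

theorem sum_sq_pair {n p : ℕ} (hp : p + 2 ≤ n) :
    ∑ k ∈ Finset.range n, (if k = p ∨ k = p + 1 then (1 : ℤ) else 0) ^ 2 = 2 := by
  have h := sum_mul_pair (n := n) (fun k => if k = p ∨ k = p + 1 then 1 else 0)
    (show p ≠ p + 1 by omega) (by omega) (by omega)
  simp only [true_or, or_true, if_true, ← sq] at h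
  exact h

theorem sum_sq_single {n p : ℕ} (hp : p < n) (s : ℤ) :
    ∑ k ∈ Finset.range n, (if k = p then s else 0) ^ 2 = s ^ 2 := by
  simp [ite_pow, hp]

theorem oneLength_D {n : ℕ} {ν : Labelling b (.D n)} (hn : 4 ≤ n) : OneLength P := by
  obtain ⟨c, hc, hform⟩ := ν.exists_rootForm_root hn
  have : ∀ i, P.RootForm (P.root i) (P.root i) = c * 2 := by
    intro i
    obtain ⟨β, hβ, h⟩ := ν.exists_rootCoord hn i
    rw [hform i β hβ, show ∑ k ∈ Finset.range (DynkinType.D n).rank, β k ^ 2 = 2 from h]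
    norm_num
  exact fun i j => (this i).trans (this j).symm

theorem _root_.SmallWeights.DynkinType.IsRootCoord.sum_sq_B {n : ℕ} {γ : ℕ → ℤ}
    (h : (DynkinType.B n).IsRootCoord γ) :
    1 ≤ ∑ k ∈ Finset.range n, γ k ^ 2 ∧ ∑ k ∈ Finset.range n, γ k ^ 2 ≤ 2 := by
  rcases h with h | h <;> omega

theorem _root_.SmallWeights.DynkinType.IsRootCoord.sum_sq_C {n : ℕ} {γ : ℕ → ℤ}
    (h : (DynkinType.C n).IsRootCoord γ) :
    2 ≤ ∑ k ∈ Finset.range n, γ k ^ 2 ∧ ∑ k ∈ Finset.range n, γ k ^ 2 ≤ 4 := by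
  rcases h with h | ⟨δ, h, h'⟩
  · omega
  · simp only [h, mul_pow, ← Finset.mul_sum, h']
    norm_num

end Labelling

end SmallWeights

namespace SmallWeights

/-! ### Small dominant weights in coordinates -/

theorem sum_indicator {m n : ℕ} (h : m ≤ n) :
    ∑ k ∈ Finset.range n, (if k < m then (1 : ℤ) else 0) = m := by
  have : (Finset.range n).filter (· < m) = Finset.range m := by
    ext k
    simp only [Finset.mem_filter, Finset.mem_range]
    omega
  rw [Finset.sum_boole, this, Finset.card_range]

theorem antitone_of_step {n : ℕ} {lam : ℕ → ℤ} (h : ∀ k, k + 1 < n → lam (k + 1) ≤ lam k)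
    {i j : ℕ} (hij : i ≤ j) (hj : j < n) : lam j ≤ lam i := by
  induction j, hij using Nat.le_induction with
  | base => exact le_rfl
  | succ j _ ih => exact (h j hj).trans (ih (by omega))

theorem exists_eq_indicator {n : ℕ} {lam : ℕ → ℤ} (h : ∀ k, k + 1 < n → lam (k + 1) ≤ lam k)
    (h₀ : ∀ k < n, 0 ≤ lam k) (h₁ : ∀ k < n, lam k ≤ 1) :
    ∃ m ≤ n, ∀ k < n, lam k = if k < m then 1 else 0 := by
  induction n with
  | zero => exact ⟨0, le_rfl, fun k hk => by omega⟩
  | succ n ih =>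
    obtain ⟨m, hm, hlam⟩ := ih (fun k hk => h k (by omega)) (fun k hk => h₀ k (by omega))
      fun k hk => h₁ k (by omega)
    have hn0 := h₀ n (Nat.lt_succ_self n)
    have hn1 := h₁ n (Nat.lt_succ_self n)
    rcases (show lam n = 0 ∨ lam n = 1 by omega) with hn | hn
    · refine ⟨m, by omega, fun k hk => ?_⟩
      rcases Nat.lt_succ_iff_lt_or_eq.1 hk with hk | rfl
      · exact hlam k hk
      · rw [hn, if_neg (by omega)]
    · refine ⟨n + 1, le_rfl, fun k hk => ?_⟩
      have := antitone_of_step h (show k ≤ n by omega) (Nat.lt_succ_self n)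
      have := h₁ k hk
      rw [if_pos hk]
      omega

namespace DynkinType

variable {X : DynkinType}

theorem two_dvd_sum_simpleCoord (hX : X.IsClassical) (hB : ∀ n, X ≠ .B n) (i : Fin X.rank) :
    2 ∣ ∑ k ∈ Finset.range X.rank, X.simpleCoord i k := by
  have hi := i.2
  by_cases h : (i : ℕ) + 1 < X.rank
  · simp only [simpleCoord_of_lt hX h, Finset.sum_sub_distrib, Finset.sum_ite_eq', Finset.mem_range]
    rw [if_pos hi, if_pos h]
    norm_num
  · match X, hX with
    | B n, _ => exact absurd rfl (hB n)
    | C n, (hn : 3 ≤ n) =>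
      change (i : ℕ) < n at hi
      change ¬ (i : ℕ) + 1 < n at h
      refine Finset.dvd_sum fun k hk => ?_
      have := Finset.mem_range.1 hk
      change k < n at this
      simp only [simpleCoord]
      split_ifs <;> omega
    | D n, (hn : 4 ≤ n) =>
      change (i : ℕ) < n at hi
      change ¬ (i : ℕ) + 1 < n at h
      have : ∀ k ∈ Finset.range n, (D n).simpleCoord i k =
          (if k = i then 1 else 0) + if k = i - 1 then 1 else 0 := by
        intro k hk
        have := Finset.mem_range.1 hk
        simp only [simpleCoord]
        split_ifs <;> omega
      change 2 ∣ ∑ k ∈ Finset.range n, _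
      rw [Finset.sum_congr rfl this, Finset.sum_add_distrib, Finset.sum_ite_eq', Finset.sum_ite_eq']
      simp only [Finset.mem_range]
      rw [if_pos hi, if_pos (by omega)]
      norm_num

end DynkinType

variable {ι V N : Type*} [AddCommGroup V] [Module ℝ V] [AddCommGroup N] [Module ℝ N]
  {P : RootPairing ι ℝ V N} [P.IsRootSystem]

namespace Labelling

variable {b : P.Base} {X : DynkinType} (ν : Labelling b X)

/-- Elements of the root lattice have integral coordinates, with even sum in types `C` and `D`. -/
theorem exists_coord_eq (hX : X.IsClassical) {l : V} (hl : l ∈ P.rootSpan ℤ) :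
    ∃ lam : ℕ → ℤ, (∀ k, ν.coord k l = lam k) ∧
      ((∀ n, X ≠ .B n) → 2 ∣ ∑ k ∈ Finset.range X.rank, lam k) := by
  obtain ⟨z, hz⟩ := ν.exists_int_coord hl
  refine ⟨fun k => ∑ i, z i * X.simpleCoord i k, fun k => ?_, fun hB => ?_⟩
  · simp [hz, coord_node]
  · rw [Finset.sum_comm]
    refine Finset.dvd_sum fun i _ => ?_
    rw [← Finset.mul_sum]
    exact (DynkinType.two_dvd_sum_simpleCoord hX hB i).mul_left _

theorem corootCoord_nonneg (hX : X.IsClassical) {l : V} (hl : IsDominant b l) {lam : ℕ → ℤ}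
    (hlam : ∀ k, ν.coord k l = lam k) (j : Fin X.rank) : 0 ≤ X.corootCoord lam j := by
  have := ν.isDominant_iff.1 hl j
  rw [ν.coroot_eq_corootCoord hX] at this
  simp only [hlam] at this
  rw [← DynkinType.corootCoord_intCast] at this
  exact_mod_cast this

theorem step_of_isDominant (hX : X.IsClassical) {l : V} (hl : IsDominant b l) {lam : ℕ → ℤ}
    (hlam : ∀ k, ν.coord k l = lam k) {k : ℕ} (hk : k + 1 < X.rank) : lam (k + 1) ≤ lam k := by
  have := ν.corootCoord_nonneg hX hl hlam ⟨k, by omega⟩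
  rw [DynkinType.corootCoord_of_lt hX hk] at this
  omega

variable [Fintype ι] [P.IsCrystallographic]

/-- The bound `(l, β^∨) ≤ 3` for a small weight `l` in coordinates. It requires `β` to be a multiple
of a fundamental weight. -/
theorem sum_le_of_isSmall (hX : X.IsClassical) {l : V} (hl : IsSmall P l) {lam : ℕ → ℤ}
    (hlam : ∀ k, ν.coord k l = lam k) {i : ι} {β : ℕ → ℤ} (hβ : ∀ k, ν.coord k (P.root i) = β k)
    (j₀ : Fin X.rank) (h : ∀ j : Fin X.rank, j ≠ j₀ → X.corootCoord β j = 0) :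
    2 * ∑ k ∈ Finset.range X.rank, β k * lam k ≤ 3 * ∑ k ∈ Finset.range X.rank, β k ^ 2 := by
  have h3 : P.coroot' i l ≤ 3 := by
    refine hl.coroot_le_three b (j₀ := ν.node j₀) fun j hj hne => ?_
    obtain ⟨j, rfl⟩ := ν.exists_node hj
    rw [ν.pairing_node hX hβ, h j fun h => hne (by rw [h]), Int.cast_zero]
  have hc := ν.sum_sq_mul_coroot hX hβ l
  simp only [hlam] at hc
  have hnn : (0 : ℝ) ≤ (∑ k ∈ Finset.range X.rank, β k ^ 2 : ℤ) := by
    exact_mod_cast Finset.sum_nonneg fun k _ => sq_nonneg (β k)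
  have : 2 * ∑ k ∈ Finset.range X.rank, (β k : ℝ) * (lam k : ℝ) ≤
      3 * (∑ k ∈ Finset.range X.rank, β k ^ 2 : ℤ) := by nlinarith
  exact_mod_cast this

/-- The weight with coordinates `lam` has a unique canonical block decomposition, and this arises
from the symbol `s` by the cascade construction. -/
def Realizes (lam : ℕ → ℤ) (s : Symbol) : Prop :=
  ∃ l m L, ν.HasDecomposition l lam m L ∧ IsCascade P b.support L s

variable {ν} in
theorem HasDecomposition.realizes {l : V} {lam lam' : ℕ → ℤ} {m : ℕ} {L : List (Finset ι)}
    (h : ν.HasDecomposition l lam m L) (hlam : ∀ k, lam k = lam' k) {s : Symbol}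
    (hc : IsCascade P b.support L s) : ν.Realizes lam' s :=
  ⟨l, m, L, ⟨fun k => by rw [h.coord_eq, hlam], h.hasLength, h.isCanonical_iff, h.mem_rootSpan⟩, hc⟩

end Labelling

/-- The classification for a classical type, from a list of the small dominant weights in
coordinates. The inequality `small` says that these weights pair to at most `3` with all coroots. -/
theorem classification_of_coord [Fintype ι] [P.IsCrystallographic] [P.IsReduced] {b : P.Base}
    {X : DynkinType} (hX : X.IsClassical) {T : Type} (lam : T → ℕ → ℤ) (sym : T → Symbol)
    (lam_pos : ∀ t, 0 < lam t 0) (dom : ∀ t (j : Fin X.rank), 0 ≤ X.corootCoord (lam t) j)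
    (small : ∀ t β, X.IsRootCoord β →
      2 * ∑ k ∈ Finset.range X.rank, β k * lam t k ≤ 3 * ∑ k ∈ Finset.range X.rank, β k ^ 2)
    (realizes : ∀ (ν : Labelling b X) t, ν.Realizes (lam t) (sym t))
    (complete : ∀ l : V, IsDominant b l → IsSmall P l → l ≠ 0 →
      ∃ (ν : Labelling b X) (t : T), ∀ k < X.rank, ν.coord k l = lam t k)
    (range_sym : Set.range sym = X.symbols) (ν₀ : Labelling b X)
    (conj : ∀ t t', sym t = sym t' → ∃ τ : Equiv.Perm (Fin X.rank),
      (∀ i j, X.cartan (τ i) (τ j) = X.cartan i j) ∧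
      ∀ j, X.corootCoord (lam t') (τ j) = X.corootCoord (lam t) j) :
    IsClassified b X := by
  have hlabel : ∀ (ν : Labelling b X) {l : V} {x : ℕ → ℤ} (_ : ∀ k, ν.coord k l = x k) j,
      P.coroot' (ν.node j) l = (X.corootCoord x j : ℤ) := by
    intro ν l x h j
    rw [ν.coroot_eq_corootCoord hX, DynkinType.corootCoord_intCast]
    simp only [h]
  refine classification_of_family (fun t j => X.corootCoord (lam t) j) sym dom (fun t => ?_)
    (fun ν t => ?_) (fun l hl hs h0 => ?_) range_sym ν₀ conj
  · by_contra! h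
    obtain ⟨l, m, L, hd, -⟩ := realizes ν₀ t
    have : l = 0 := ν₀.ext_coroot fun j => by
      rw [hlabel ν₀ hd.coord_eq, h, map_zero, Int.cast_zero]
    have h0 := hd.coord_eq 0
    rw [this, map_zero] at h0
    exact (lam_pos t).ne (by exact_mod_cast h0)
  · obtain ⟨l, m, L, hd, hc⟩ := realizes ν t
    refine ⟨l, L, hlabel ν hd.coord_eq, hd.mem_rootSpan, fun i => ?_, hd.isCanonical_iff, hc⟩
    obtain ⟨β, hβ, hβ'⟩ := ν.exists_rootCoord hX i
    have h := ν.sum_sq_mul_coroot hX hβ l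
    simp only [hd.coord_eq] at h
    have hsq : (0 : ℝ) < (∑ k ∈ Finset.range X.rank, β k ^ 2 : ℤ) := by
      exact_mod_cast hβ'.sum_sq_pos
    have hle : 2 * ∑ k ∈ Finset.range X.rank, (β k : ℝ) * (lam t k : ℝ) ≤
        3 * (∑ k ∈ Finset.range X.rank, β k ^ 2 : ℤ) := by exact_mod_cast small t β hβ'
    rw [← h] at hle
    exact le_of_mul_le_mul_left (by linarith) hsq
  · obtain ⟨ν, t, h⟩ := complete l hl hs h0
    refine ⟨ν, t, fun j => ?_⟩
    obtain ⟨x, hx, -⟩ := ν.exists_coord_eq hX hs.1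
    rw [hlabel ν hx]
    congr 1
    exact DynkinType.eq_of_corootCoord_eq hX
      (fun k hk => by exact_mod_cast (hx k).symm.trans (h k hk)) j

/-! ### Type `B` -/

theorem small_of_le_one {n : ℕ} {lam β : ℕ → ℤ} (h₀ : ∀ k < n, 0 ≤ lam k)
    (h₁ : ∀ k < n, lam k ≤ 1) :
    2 * ∑ k ∈ Finset.range n, β k * lam k ≤ 3 * ∑ k ∈ Finset.range n, β k ^ 2 := by
  rw [Finset.mul_sum, Finset.mul_sum]
  refine Finset.sum_le_sum fun k hk => ?_
  have h0 := h₀ k (Finset.mem_range.1 hk)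
  have h1 := h₁ k (Finset.mem_range.1 hk)
  have := Int.le_self_sq (β k)
  have := sq_nonneg (β k)
  rcases (show lam k = 0 ∨ lam k = 1 by omega) with h | h <;> rw [h] <;> linarith

namespace Labelling

variable [Fintype ι] [P.IsCrystallographic] [P.IsReduced] {b : P.Base} {n : ℕ}

/-- Adjoining in type `B` to the sum of the first `q` unit vectors the next one. -/
theorem HasDecomposition.snoc_single_B (hn : 2 ≤ n) {ν : Labelling b (.B n)} {l : V}
    {lam : ℕ → ℤ} {m q : ℕ} {L : List (Finset ι)} (h : ν.HasDecomposition l lam m L) (hq : q < n)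
    (hqm : q = 2 * m)
    (hlam : ∀ k, lam k = if k < q then 1 else 0) {i : ι}
    (hi : ∀ k, ν.coord k (P.root i) = ((if k = q then 1 else 0 : ℤ) : ℝ)) :
    ν.HasDecomposition (l + P.root i) (fun k => lam k + if k = q then 1 else 0) (m + 1)
      (L ++ [{i}]) := by
  have hsum : ∀ c : ℕ → ℤ, ∑ k ∈ Finset.range n, c k * (if k = q then 1 else 0) = c q := by
    intro c
    simp [hq]
  have hind : ∀ k, lam k + (if k = q then 1 else 0) = if k < q + 1 then 1 else 0 := by
    intro k
    rw [hlam]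
    split_ifs <;> omega
  have hlen := h.hasLength_add_root (X := .B n) hn hi (by
    change _ < ∑ k ∈ Finset.range n, _
    simp only [hind]
    rw [sum_indicator (by omega)]
    push_cast
    omega)
  refine h.snoc (X := .B n) hn hi ?_ hlen ?_ ?_
  · change ∑ k ∈ Finset.range n, _ = _
    simp only [mul_comm _ (lam _)]
    rw [hsum, hlam, if_neg (lt_irrefl q)]
  · change _ < ∑ k ∈ Finset.range n, (2 * (n : ℤ) - 2 * k) * _
    rw [hsum fun k => 2 * (n : ℤ) - 2 * k]
    omega
  · intro e he j hj
    obtain ⟨β, hβ, hshape⟩ := ν.exists_rootCoord (X := .B n) hn j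
    refine ⟨β, hβ, ?_⟩
    change _ ∨ ∑ k ∈ Finset.range n, (2 * (n : ℤ) - 2 * k) * _ <
      ∑ k ∈ Finset.range n, (2 * (n : ℤ) - 2 * k) * _
    rw [hsum fun k => 2 * (n : ℤ) - 2 * k]
    -- As the pairing with the coroot is at least `2`, every coordinate of the root is `0` or `1`.
    have hle : ∑ k ∈ Finset.range n, β k ^ 2 ≤
        ∑ k ∈ Finset.range n, β k * (if k < q + 1 then 1 else 0) := by
      have h2 := he.two_le_coroot hj
      have hc := ν.sum_sq_mul_coroot (X := .B n) hn hβ (l + P.root i)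
      simp only [h.coord_add_root hi, hind] at hc
      have hpos : (0 : ℝ) < (∑ k ∈ Finset.range n, β k ^ 2 : ℤ) := by
        exact_mod_cast hshape.sum_sq_pos
      change ((∑ k ∈ Finset.range n, β k ^ 2 : ℤ) : ℝ) * _ = 2 * ∑ k ∈ Finset.range n, _ at hc
      have : ((∑ k ∈ Finset.range n, β k ^ 2 : ℤ) : ℝ) ≤
          ∑ k ∈ Finset.range n, (β k : ℝ) * ((if k < q + 1 then 1 else 0 : ℤ) : ℝ) := by
        nlinarith
      exact_mod_cast this
    have hterm : ∀ k ∈ Finset.range n, β k * (if k < q + 1 then 1 else 0) ≤ β k ^ 2 := by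
      intro k _
      have := Int.le_self_sq (β k)
      have := sq_nonneg (β k)
      split_ifs <;> linarith
    have heq := (Finset.sum_eq_sum_iff_of_le hterm).1 ((Finset.sum_le_sum hterm).antisymm hle)
    have h01 : ∀ k < n, β k = 0 ∨ (β k = 1 ∧ k ≤ q) := by
      intro k hk
      have := heq k (Finset.mem_range.2 hk)
      split_ifs at this with hkq
      · rcases eq_or_ne (β k) 0 with h0 | h0
        · exact .inl h0
        · right
          refine ⟨?_, by omega⟩
          rw [sq] at this
          exact (mul_left_cancel₀ h0 this).symm
      · left
        simpa using this.symm
    by_cases hall : ∀ k < n, k ≠ q → β k = 0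
    · left
      intro k hk
      by_cases hkq : k = q
      · subst hkq
        rw [if_pos rfl]
        refine ((h01 k hk).resolve_left fun h0 => ?_).1
        refine hshape.sum_sq_pos.ne' (Finset.sum_eq_zero fun k' hk' => ?_)
        by_cases h' : k' = k
        · rw [h', h0]
          rfl
        · rw [hall k' (Finset.mem_range.1 hk') h']
          rfl
      · rw [if_neg hkq, hall k hk hkq]
    · right
      push Not at hall
      obtain ⟨k, hk, hkq, hk0⟩ := hall
      obtain ⟨hk1, hkle⟩ := (h01 k hk).resolve_left hk0
      have hs := Finset.single_le_sum (f := fun k => (2 * (n : ℤ) - 2 * k) * β k) (fun k' hk' => by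
        have hk' := Finset.mem_range.1 hk'
        refine mul_nonneg (by omega) ?_
        rcases h01 k' hk' with h' | h' <;> omega) (Finset.mem_range.2 hk)
      simp only [hk1, mul_one] at hs
      refine lt_of_lt_of_le ?_ hs
      omega

end Labelling

end SmallWeights

namespace SmallWeights

variable {ι V N : Type*} [AddCommGroup V] [Module ℝ V] [AddCommGroup N] [Module ℝ N]
  {P : RootPairing ι ℝ V N} [P.IsRootSystem] [Fintype ι]

namespace Labelling

variable {b : P.Base} {X : DynkinType} (ν : Labelling b X)

/-- A choice of roots `e_q + e_{q+1}` for all `q`. -/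
theorem exists_pairs (hX : X.IsClassical) : ∃ r : ℕ → ι, ∀ q, q + 2 ≤ X.rank →
    (∀ k, ν.coord k (P.root (r q)) = ((if k = q ∨ k = q + 1 then 1 else 0 : ℤ) : ℝ)) ∧
      InParabolic P (ν.tail q) (r q) := by
  have hr : 0 < X.rank := by
    match X, hX with
    | .B n, (hn : 2 ≤ n) => exact (show 0 < n by omega)
    | .C n, (hn : 3 ≤ n) => exact (show 0 < n by omega)
    | .D n, (hn : 4 ≤ n) => exact (show 0 < n by omega)
  have : ∀ q, ∃ i, q + 2 ≤ X.rank →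
      (∀ k, ν.coord k (P.root i) = ((if k = q ∨ k = q + 1 then 1 else 0 : ℤ) : ℝ)) ∧
      InParabolic P (ν.tail q) i := by
    intro q
    by_cases hq : q + 2 ≤ X.rank
    · obtain ⟨i, hi⟩ := (ν.exists_root_pair hX hq).1
      exact ⟨i, fun _ => hi⟩
    · exact ⟨ν.node ⟨0, hr⟩, fun h => absurd h hq⟩
  choose r hr using this
  exact ⟨r, hr⟩

end Labelling

open DynkinType Mark

theorem pairs_succ_eq_chain (a : Mark) (T : ℕ → DynkinType) (n p k : ℕ) :
    ((List.range (k + 1)).map fun j => (a, T (n - (p + 2 * j)))) = chain a T (n - p) k := by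
  simp only [chain, Nat.sub_sub]

theorem sum_map_mark (f : Mark → ℕ) (a : Mark) (T : ℕ → DynkinType) (k : ℕ) :
    (((List.range k).map fun j => (a, T j)).map fun x => f x.1).sum = k * f a := by
  simp [Function.comp_def]

namespace Labelling

variable {b : P.Base} {n : ℕ}

theorem not_oneLength_B (hn : 2 ≤ n) (ν : Labelling b (.B n)) : ¬ OneLength P := by
  obtain ⟨i, hi, -⟩ := ν.exists_root_single (X := .B n) hn (.inl ⟨n, rfl, rfl⟩)
    (show 0 < n by omega)
  obtain ⟨⟨j, hj, -⟩, -⟩ := ν.exists_root_pair (X := .B n) (p := 0) hn hn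
  refine ν.not_oneLength (X := .B n) hn hi hj ?_
  rw [show (B n).rank = n from rfl, sum_sq_pair hn, sum_sq_single (by omega)]
  norm_num

variable [P.IsCrystallographic] [P.IsReduced]

/-- The sum of the first `t + 1` unit vectors: pairs of consecutive unit vectors are split off from
the left, and if `t` is even, the last unit vector remains. -/
theorem realizes_B (hn : 2 ≤ n) (ν : Labelling b (.B n)) (t : Fin n) :
    ν.Realizes (fun k => if k < t + 1 then 1 else 0)
      (((List.range ((t + 1) / 2)).map fun j => (oneLong, typeB (n - 2 * j))) ++
        if (t : ℕ) % 2 = 0 then [(oneShort, typeB (n - t))] else []) := by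
  have ht := t.2
  have hX : (B n).IsClassical := hn
  obtain ⟨r, hr⟩ := ν.exists_pairs hX
  have hlong : ∀ q, q + 2 ≤ (B n).rank → oneLong.LengthMark P (r q) := by
    intro q hq
    refine ⟨ν.not_oneLength_B hn, ν.isLong_of_sum_sq hX (hr q hq).1 fun γ hγ => ?_⟩
    rw [sum_sq_pair hq]
    exact hγ.sum_sq_B.2
  obtain ⟨l, hd, -⟩ := ν.hasDecomposition_zero.append_pairs hX (p := 0) (t := (t + 1) / 2)
    (show 0 + 2 * ((t + 1) / 2) ≤ n by omega) (fun _ _ => rfl) (by simp) fun q hq => (hr q hq).1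
  have hcas : ∀ {L s}, (∀ Γ, ν.Continues Γ (0 + 2 * ((t + 1) / 2)) → IsCascade P Γ L s) → _ :=
    fun h => ν.isCascade_pairs hX hr hlong (p := 0) (t := (t + 1) / 2)
      (show 0 + 2 * ((t + 1) / 2) ≤ n by omega) h (.inl ν.splits_zero)
  simp only [zero_add, List.nil_append] at hd hcas
  by_cases hodd : (t : ℕ) % 2 = 0
  · obtain ⟨i, hi, hi'⟩ := ν.exists_root_single (X := .B n) hn (.inl ⟨n, rfl, rfl⟩) (p := t) ht
    have hd' := hd.snoc_single_B hn (q := t) ht (by omega) (fun k => by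
      simp only [Pi.zero_apply]
      split_ifs <;> omega) hi
    refine hd'.realizes (fun k => ?_) ?_
    · simp only [Pi.zero_apply]
      split_ifs <;> omega
    · rw [if_pos hodd]
      refine hcas (s := [(oneShort, typeB (n - t))]) fun Γ hΓ => ?_
      rw [show 2 * (((t : ℕ) + 1) / 2) = t by omega] at hΓ
      have hno : ∀ m, B n ≠ D m := by simp
      refine ν.isCascade_cons hX ht (fun ⟨m, h⟩ => absurd h (hno m))
        (hΓ.resolve_right fun ⟨m, h, _⟩ => hno m h) ?_ hi (fun j hj => ?_) ?_ .nil
      · rwa [ν.component_eq_tail fun ⟨m, h, _⟩ => hno m h]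
      · simp only [corootCoord]
        split_ifs <;> omega
      · refine ⟨ν.not_oneLength_B hn, ν.isShort_of_sum_sq hX hi fun γ hγ => ?_⟩
        rw [sum_sq_single (show (t : ℕ) < (B n).rank from ht)]
        exact hγ.sum_sq_B.1
  · refine hd.realizes (fun k => ?_) ?_
    · simp only [Pi.zero_apply]
      split_ifs <;> omega
    · rw [if_neg hodd]
      have h := hcas (L := []) (s := []) fun Γ _ => .nil
      rwa [List.append_nil] at h

end Labelling

/-- The first unit vector is a root and a multiple of a fundamental weight, hence a small weight has
first coordinate at most `1`. -/
theorem classification_B [P.IsCrystallographic] [P.IsReduced] {b : P.Base} {n : ℕ} (hn : 2 ≤ n)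
    (ν₀ : Labelling b (.B n)) : IsClassified b (B n) := by
  have hX : (B n).IsClassical := hn
  refine classification_of_coord hX (fun (t : Fin n) k => if k < t + 1 then 1 else 0)
    (fun t => ((List.range ((t + 1) / 2)).map fun j => (oneLong, typeB (n - 2 * j))) ++
      if (t : ℕ) % 2 = 0 then [(oneShort, typeB (n - t))] else [])
    (fun t => by simp) (fun t j => ?_) (fun t β _ => ?_) (fun ν t => ν.realizes_B hn t)
    (fun l hl hs h0 => ?_) ?_ ν₀ (fun t t' h => ?_)
  · simp only [corootCoord]
    split_ifs <;> omega
  · refine small_of_le_one (fun k _ => ?_) fun k _ => ?_ <;> split_ifs <;> norm_num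
  · obtain ⟨lam, hlam, -⟩ := ν₀.exists_coord_eq hX hs.1
    have hstep : ∀ k, k + 1 < n → lam (k + 1) ≤ lam k := fun k hk =>
      ν₀.step_of_isDominant hX hl hlam hk
    have hlast : 0 ≤ lam (n - 1) := by
      have := ν₀.corootCoord_nonneg hX hl hlam ⟨n - 1, show n - 1 < n by omega⟩
      simp only [corootCoord] at this
      rw [if_pos (by omega)] at this
      omega
    obtain ⟨i, hi, -⟩ := ν₀.exists_root_single (X := .B n) hn (.inl ⟨n, rfl, rfl⟩)
      (show 0 < n by omega)
    replace hi : ∀ k, ν₀.coord k (P.root i) = ((if k = 0 then 1 else 0 : ℤ) : ℝ) := hi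
    have hle := ν₀.sum_le_of_isSmall hX hs hlam hi ⟨0, show 0 < n by omega⟩ fun j hj => by
      have : (j : ℕ) ≠ 0 := fun h => hj (Fin.ext h)
      simp [corootCoord, this]
    change 2 * ∑ k ∈ Finset.range n, _ ≤ 3 * ∑ k ∈ Finset.range n, _ at hle
    rw [Labelling.sum_sq_single (show 0 < n by omega)] at hle
    have hle' : 2 * lam 0 ≤ 3 := by
      have : ∑ k ∈ Finset.range n, (if k = 0 then 1 else 0) * lam k = lam 0 := by
        simp [show 0 < n by omega]
      rw [this] at hle
      simpa using hle
    obtain ⟨m, hm, hind⟩ := exists_eq_indicator hstep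
      (fun k hk => hlast.trans (antitone_of_step hstep (by omega) (by omega)))
      (fun k hk => (antitone_of_step hstep (Nat.zero_le k) hk).trans (by omega))
    have hm0 : m ≠ 0 := by
      rintro rfl
      refine h0 (ν₀.ext_coord hX fun k => ?_)
      by_cases hk : k < n
      · rw [hlam, hind k hk, map_zero]
        norm_num
      · rw [ν₀.coord_eq_zero hX (not_lt.1 hk), LinearMap.zero_apply, LinearMap.zero_apply]
    refine ⟨ν₀, ⟨m - 1, by omega⟩, fun k hk => ?_⟩
    rw [hlam, hind k hk]
    simp only [show m - 1 + 1 = m by omega]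
  · ext s
    constructor
    · rintro ⟨⟨t, ht⟩, rfl⟩
      dsimp only
      by_cases hodd : t % 2 = 0
      · rw [if_pos hodd]
        obtain ⟨k, rfl⟩ : ∃ k, t = 2 * k := ⟨t / 2, by omega⟩
        rw [show (2 * k + 1) / 2 = k by omega]
        cases k with
        | zero => exact .inl rfl
        | succ k =>
          refine .inr (.inr ⟨k, by omega, ?_⟩)
          rw [Nat.sub_sub]
          rfl
      · rw [if_neg hodd, List.append_nil]
        obtain ⟨k, rfl⟩ : ∃ k, t = 2 * k + 1 := ⟨t / 2, by omega⟩
        rw [show (2 * k + 1 + 1) / 2 = k + 1 by omega]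
        exact .inr (.inl ⟨k, by omega, rfl⟩)
    · rintro (rfl | ⟨k, hk, rfl⟩ | ⟨k, hk, rfl⟩)
      · exact ⟨⟨0, by omega⟩, by simp⟩
      · refine ⟨⟨2 * k + 1, by omega⟩, ?_⟩
        dsimp only
        rw [if_neg (by omega), List.append_nil, show (2 * k + 1 + 1) / 2 = k + 1 by omega]
        rfl
      · refine ⟨⟨2 * k + 2, by omega⟩, ?_⟩
        dsimp only
        rw [if_pos (by omega), show (2 * k + 2 + 1) / 2 = k + 1 by omega, Nat.sub_sub]
        rfl
  · -- The symbol determines the weight: the long blocks count twice, the short one once.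
    have key : ∀ t : Fin n, ((((List.range ((t + 1) / 2)).map fun j =>
        (oneLong, typeB (n - 2 * j))) ++
        if (t : ℕ) % 2 = 0 then [(oneShort, typeB (n - t))] else []).map fun x =>
          (x.1.rec 1 1 2 1 : ℕ)).sum = (t : ℕ) + 1 := by
      intro t
      rw [List.map_append, List.sum_append, sum_map_mark fun a => (a.rec 1 1 2 1 : ℕ)]
      split_ifs with h
      · simp only [List.map_cons, List.map_nil, List.sum_singleton]
        omega
      · simp only [List.map_nil, List.sum_nil]
        omega
    have : t = t' := Fin.ext (Nat.succ_injective ((key t).symm.trans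
      ((congrArg (fun s : Symbol => (s.map fun x => (x.1.rec 1 1 2 1 : ℕ)).sum) h).trans (key t'))))
    subst this
    exact ⟨1, fun _ _ => rfl, fun _ => rfl⟩

end SmallWeights

namespace SmallWeights

/-! ### Type `C` -/

/-- Numbers for the small dominant weights in types `C_n` and `D_n`: `k` on the left stands for the
sum of the first `2k + 2` unit vectors, `k` on the right for twice the first unit vector plus
the sum of the next `2k` ones. -/
abbrev EvenIndex (n : ℕ) : Type := {k : ℕ // 2 * k + 2 ≤ n} ⊕ {k : ℕ // 2 * k + 1 ≤ n}

/-- The coordinates of the small dominant weights in types `C_n` and `D_n`. -/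
def evenCoord {n : ℕ} : EvenIndex n → ℕ → ℤ
  | .inl k, i => if i < 2 * k + 2 then 1 else 0
  | .inr k, i => if i = 0 then 2 else if i < 2 * k + 1 then 1 else 0

theorem evenCoord_pos {n : ℕ} (t : EvenIndex n) : 0 < evenCoord t 0 := by
  rcases t with t | t <;> simp [evenCoord]

theorem evenCoord_nonneg {n : ℕ} (t : EvenIndex n) (k : ℕ) : 0 ≤ evenCoord t k := by
  rcases t with t | t <;> simp only [evenCoord] <;> split_ifs <;> norm_num

theorem evenCoord_succ_le {n : ℕ} (t : EvenIndex n) (k : ℕ) :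
    evenCoord t (k + 1) ≤ evenCoord t k := by
  rcases t with t | t
  · simp only [evenCoord]
    split_ifs <;> omega
  · simp only [evenCoord, if_neg (Nat.succ_ne_zero k)]
    split_ifs <;> omega

/-- The first coordinate contributes at most `2 β_0² + 2` to the left hand side, the `k`-th one at
most `2 β_k²`; the additional `2` does not exceed the squared length of `β`. -/
theorem evenCoord_small {n : ℕ} (t : EvenIndex n) {β : ℕ → ℤ}
    (hβ : 2 ≤ ∑ k ∈ Finset.range n, β k ^ 2) :
    2 * ∑ k ∈ Finset.range n, β k * evenCoord t k ≤ 3 * ∑ k ∈ Finset.range n, β k ^ 2 := by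
  have hterm : ∀ k ∈ Finset.range n,
      2 * (β k * evenCoord t k) ≤ 2 * β k ^ 2 + if k = 0 then 2 else 0 := by
    intro k _
    have h1 : 1 ≤ k → evenCoord t k = 0 ∨ evenCoord t k = 1 := by
      intro hk
      rcases t with t | t
      · simp only [evenCoord]
        split_ifs <;> simp
      · simp only [evenCoord, if_neg (show k ≠ 0 by omega)]
        split_ifs <;> simp
    have h0 : evenCoord t 0 = 1 ∨ evenCoord t 0 = 2 := by
      rcases t with t | t <;> simp [evenCoord]
    have := Int.le_self_sq (β k)
    have := sq_nonneg (β k)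
    split_ifs with hk
    · subst hk
      rcases h0 with h | h <;> rw [h] <;> nlinarith [sq_nonneg (β 0 - 1)]
    · rcases h1 (by omega) with h | h <;> rw [h] <;> linarith
  have h := Finset.sum_le_sum hterm
  rw [← Finset.mul_sum, Finset.sum_add_distrib, ← Finset.mul_sum, Finset.sum_ite_eq'] at h
  have : (if 0 ∈ Finset.range n then (2 : ℤ) else 0) ≤ 2 := by split_ifs <;> norm_num
  linarith

theorem exists_eq_evenCoord {n : ℕ} (hn : 3 ≤ n) {lam : ℕ → ℤ}
    (hstep : ∀ k, k + 1 < n → lam (k + 1) ≤ lam k) (hlast : 0 ≤ lam (n - 1))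
    (heven : 2 ∣ ∑ k ∈ Finset.range n, lam k) (hsmall : lam 0 + lam 1 ≤ 3)
    (h0 : ∃ k < n, lam k ≠ 0) : ∃ t : EvenIndex n, ∀ k < n, lam k = evenCoord t k := by
  have hnn : ∀ k < n, 0 ≤ lam k := fun k hk =>
    hlast.trans (antitone_of_step hstep (by omega) (by omega))
  rcases (show lam 0 ≤ 1 ∨ 2 ≤ lam 0 by omega) with hlam | hlam
  · obtain ⟨m, hm, hind⟩ := exists_eq_indicator hstep hnn
      (fun k hk => (antitone_of_step hstep (Nat.zero_le k) hk).trans hlam)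
    rw [Finset.sum_congr rfl fun k hk => hind k (Finset.mem_range.1 hk), sum_indicator hm] at heven
    have hm0 : m ≠ 0 := by
      rintro rfl
      obtain ⟨k, hk, hk0⟩ := h0
      exact hk0 (by rw [hind k hk, if_neg (Nat.not_lt_zero k)])
    obtain ⟨k, rfl⟩ : ∃ k, m = 2 * k + 2 := ⟨m / 2 - 1, by omega⟩
    exact ⟨.inl ⟨k, hm⟩, hind⟩
  · have h1 := hnn 1 (by omega)
    obtain ⟨m, hm, hind⟩ := exists_eq_indicator (n := n - 1) (lam := fun k => lam (k + 1))
      (fun k hk => hstep (k + 1) (by omega)) (fun k hk => hnn (k + 1) (by omega))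
      (fun k hk => (antitone_of_step hstep (Nat.le_add_left 1 k) (by omega)).trans (by omega))
    obtain ⟨n, rfl⟩ : ∃ n', n = n' + 1 := ⟨n - 1, by omega⟩
    rw [add_tsub_cancel_right] at hm hind
    rw [Finset.sum_range_succ', Finset.sum_congr rfl fun k hk => hind k (Finset.mem_range.1 hk),
      sum_indicator hm] at heven
    have hm1 := hind 0 (by omega)
    have h2 : lam 0 = 2 := by
      rw [zero_add] at hm1
      split_ifs at hm1 <;> omega
    obtain ⟨k, rfl⟩ : ∃ k, m = 2 * k := ⟨m / 2, by omega⟩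
    refine ⟨.inr ⟨k, by omega⟩, fun i hi => ?_⟩
    simp only [evenCoord]
    rcases Nat.eq_zero_or_eq_succ_pred i with h | h
    · rw [h, h2, if_pos rfl]
    · rw [h, if_neg (Nat.succ_ne_zero _)]
      refine (hind _ (by omega)).trans ?_
      congr 1
      simp

variable {ι V N : Type*} [AddCommGroup V] [Module ℝ V] [AddCommGroup N] [Module ℝ N]
  {P : RootPairing ι ℝ V N} [P.IsRootSystem] [Fintype ι]

open DynkinType Mark

/-- The symbols in type `C`. -/
def symbolC (n : ℕ) : EvenIndex n → Symbol
  | .inl k => (List.range (k + 1)).map fun j => (oneShort, typeC (n - 2 * j))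
  | .inr k => (oneLong, typeC n) :: (List.range k).map fun j => (oneShort, typeC (n - (1 + 2 * j)))

namespace Labelling

variable {b : P.Base} {n : ℕ}

theorem not_oneLength_C (hn : 3 ≤ n) (ν : Labelling b (.C n)) : ¬ OneLength P := by
  obtain ⟨i, hi, -⟩ := ν.exists_root_single (X := .C n) hn (.inr ⟨n, rfl, rfl⟩)
    (show 0 < n by omega)
  obtain ⟨⟨j, hj, -⟩, -⟩ := ν.exists_root_pair (X := .C n) (p := 0) hn (show 0 + 2 ≤ n by omega)
  refine ν.not_oneLength (X := .C n) hn hi hj ?_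
  rw [show (C n).rank = n from rfl, sum_sq_pair (by omega), sum_sq_single (by omega)]
  norm_num

variable [P.IsCrystallographic]

/-- In types `C` and `D` the root `e_0 + e_1` is a multiple of a fundamental weight, hence the first
two coordinates of a small weight sum to at most `3`. -/
theorem exists_evenCoord_eq {X : DynkinType} (hX : X.IsClassical) (hB : ∀ n, X ≠ .B n)
    (hr : 3 ≤ X.rank) (hD : ∀ n, X = .D n → 4 ≤ n) (ν : Labelling b X) {l : V}
    (hl : IsDominant b l) (hs : IsSmall P l) (h0 : l ≠ 0)
    (hlast : 0 ≤ ν.coord (X.rank - 1) l) :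
    ∃ t : EvenIndex X.rank, ∀ k < X.rank, ν.coord k l = evenCoord t k := by
  obtain ⟨lam, hlam, heven⟩ := ν.exists_coord_eq hX hs.1
  rw [hlam] at hlast
  obtain ⟨⟨i, hi, -⟩, -⟩ := ν.exists_root_pair hX (p := 0) (by omega)
  have hle := ν.sum_le_of_isSmall hX hs hlam hi ⟨1, by omega⟩ fun j hj => by
    refine (corootCoord_pair hX j.2 (Nat.zero_le _) (by omega)).2.2 ⟨fun h => hj (Fin.ext h), ?_⟩
    rintro ⟨⟨n, rfl, h⟩, -⟩
    have := hD n rfl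
    omega
  rw [sum_sq_pair (show 0 + 2 ≤ X.rank by omega)] at hle
  have hsum : ∑ k ∈ Finset.range X.rank, (if k = 0 ∨ k = 0 + 1 then 1 else 0) * lam k =
      lam 0 + lam 1 := by
    simp only [mul_comm _ (lam _)]
    exact sum_mul_pair lam (by omega) (by omega) (by omega)
  rw [hsum] at hle
  obtain ⟨t, ht⟩ := exists_eq_evenCoord hr (fun k hk => ν.step_of_isDominant hX hl hlam hk)
    (by exact_mod_cast hlast) (heven hB) (by omega) (by
      by_contra! h
      refine h0 (ν.ext_coord hX fun k => ?_)
      by_cases hk : k < X.rank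
      · rw [hlam, h k hk, map_zero, Int.cast_zero]
      · rw [ν.coord_eq_zero hX (not_lt.1 hk), LinearMap.zero_apply, LinearMap.zero_apply])
  exact ⟨t, fun k hk => by rw [hlam, ht k hk]⟩

variable [P.IsReduced]

theorem realizes_C (hn : 3 ≤ n) (ν : Labelling b (.C n)) (t : EvenIndex n) :
    ν.Realizes (evenCoord t) (symbolC n t) := by
  have hX : (C n).IsClassical := hn
  have hno : ∀ m, C n ≠ D m := by simp
  obtain ⟨r, hr⟩ := ν.exists_pairs hX
  have hshort : ∀ q, q + 2 ≤ (C n).rank → oneShort.LengthMark P (r q) := by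
    intro q hq
    refine ⟨ν.not_oneLength_C hn, ν.isShort_of_sum_sq hX (hr q hq).1 fun γ hγ => ?_⟩
    rw [sum_sq_pair hq]
    exact hγ.sum_sq_C.1
  rcases t with ⟨k, hk⟩ | ⟨k, hk⟩
  · obtain ⟨l, hd, -⟩ := ν.hasDecomposition_zero.append_pairs hX (p := 0) (t := k + 1)
      (show 0 + 2 * (k + 1) ≤ n by omega) (fun _ _ => rfl) (by simp) fun q hq => (hr q hq).1
    have hc := ν.isCascade_pairs hX hr hshort (p := 0) (t := k + 1)
      (show 0 + 2 * (k + 1) ≤ n by omega) (L := []) (s := []) (fun _ _ => .nil) (.inl ν.splits_zero)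
    simp only [zero_add, List.nil_append, List.append_nil] at hd hc
    refine hd.realizes (fun i => ?_) hc
    simp only [evenCoord, Pi.zero_apply]
    split_ifs <;> omega
  · obtain ⟨i, hi, hi'⟩ := ν.exists_root_single (X := .C n) hn (.inr ⟨n, rfl, rfl⟩) (p := 0)
      (show 0 < n by omega)
    replace hi : ∀ k, ν.coord k (P.root i) = ((if k = 0 then 2 else 0 : ℤ) : ℝ) := hi
    -- The first block is the long root `2 e_0`; the remaining ones are `e_1 + e_2`, `e_3 + e_4`, ….
    have hsum : ∀ c : ℕ → ℤ,
        ∑ k ∈ Finset.range (C n).rank, c k * (if k = 0 then 2 else 0) = c 0 * 2 := by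
      intro c
      change ∑ k ∈ Finset.range n, _ = _
      simp [show 0 < n by omega]
    have hsum0 : ∑ k ∈ Finset.range (C n).rank, ((0 : ℕ → ℤ) k + if k = 0 then 2 else 0) = 2 := by
      have := hsum 1
      simpa using this
    have hlen := ν.hasDecomposition_zero.hasLength_add_root hX hi (by rw [hsum0]; norm_num)
    have hd := ν.hasDecomposition_zero.snoc hX hi (by simp) hlen (by
      rw [hsum fun k => (C n).topHeight - 2 * k]
      simp only [topHeight]
      omega) fun e he j hj => by
        obtain ⟨β, hβ, hshape, h2, hle⟩ := ν.coord_le_of_tight hX hlen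
          (ν.hasDecomposition_zero.coord_add_root hi) (by rw [hsum0]; norm_num) he hj
        have hz : ∀ k < (C n).rank, k ≠ 0 → β k = 0 := by
          intro k hk hk0
          have := hle k hk
          rw [if_neg hk0] at this
          simp only [Pi.zero_apply] at this
          omega
        refine ⟨β, hβ, .inl fun k hk => ?_⟩
        rw [Finset.sum_eq_single 0 (fun k hk hk0 => hz k (Finset.mem_range.1 hk) hk0) (by
          intro h
          exact absurd (Finset.mem_range.2 (show 0 < n by omega)) h)] at h2
        split_ifs with hk0
        · rw [hk0, h2]
        · exact hz k hk hk0
    obtain ⟨l, hd, -⟩ := hd.append_pairs hX (p := 1) (t := k) (show 1 + 2 * k ≤ n by omega)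
      (fun k hk => by simp [show k ≠ 0 by omega]) (by rw [hsum0]; norm_num) fun q hq => (hr q hq).1
    have hcoroot : ∀ j : Fin n, 1 ≤ (j : ℕ) →
        (C n).corootCoord (fun k => if k = 0 then (2 : ℤ) else 0) j = 0 := by
      intro j hj
      simp [corootCoord, show (j : ℕ) ≠ 0 by omega]
    have hcoroot0 : (C n).corootCoord (fun k => if k = 0 then (2 : ℤ) else 0) 0 = 2 := by
      simp [corootCoord, show 1 ≠ n by omega]
    have hC : ν.component 0 = ν.tail 0 := ν.component_eq_tail fun ⟨m, h, _⟩ => hno m h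
    have hmem : orthogonalNodes P (ν.component 0) {i} = ν.tail 1 := by
      ext j
      constructor
      · intro hj
        have hj' := hj.1
        rw [hC] at hj'
        obtain ⟨j, -, rfl⟩ := hj'
        rw [ν.mem_orthogonalNodes_iff hX hi] at hj
        refine ν.node_mem_tail (Nat.one_le_iff_ne_zero.2 fun h => ?_)
        rw [h, hcoroot0] at hj
        exact absurd hj.2 two_ne_zero
      · rintro ⟨j, hj, rfl⟩
        rw [ν.mem_orthogonalNodes_iff hX hi, hC]
        exact ⟨ν.node_mem_tail (Nat.zero_le _), hcoroot j hj⟩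
    have hc := ν.isCascade_pairs hX hr hshort (p := 1) (t := k) (show 1 + 2 * k ≤ n by omega)
      (L := []) (s := []) (fun _ _ => .nil) (Γ := ν.tail 1)
      (.inl ⟨subset_rfl, fun _ _ _ h => absurd h.1 h.2⟩)
    simp only [List.append_nil] at hc
    refine hd.realizes (fun i => ?_) (ν.isCascade_cons hX (show 0 < n by omega)
      (fun ⟨m, h⟩ => absurd h (hno m)) ν.splits_zero (by rwa [hC]) hi (fun j _ => ?_)
      (a := oneLong) ?_ (hmem ▸ hc))
    · simp only [evenCoord, Pi.zero_apply]
      split_ifs <;> omega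
    · by_cases hj : (j : ℕ) = 0
      · rw [hj, hcoroot0]
        exact zero_le_two
      · exact (hcoroot j (by omega)).ge
    · refine ⟨ν.not_oneLength_C hn, ν.isLong_of_sum_sq hX hi fun γ hγ => ?_⟩
      rw [sum_sq_single (show 0 < (C n).rank from (show 0 < n by omega))]
      exact hγ.sum_sq_C.2

end Labelling

theorem classification_C [P.IsCrystallographic] [P.IsReduced] {b : P.Base} {n : ℕ} (hn : 3 ≤ n)
    (ν₀ : Labelling b (.C n)) : IsClassified b (C n) := by
  have hX : (C n).IsClassical := hn
  refine classification_of_coord hX evenCoord (symbolC n) evenCoord_pos (fun t j => ?_)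
    (fun t β hβ => evenCoord_small t hβ.sum_sq_C.1) (fun ν t => ν.realizes_C hn t)
    (fun l hl hs h0 => ?_) ?_ ν₀ (fun t t' h => ?_)
  · have := evenCoord_nonneg t j
    have := evenCoord_succ_le t j
    simp only [corootCoord]
    split_ifs <;> omega
  · have hlast : 0 ≤ ν₀.coord (n - 1) l := by
      have := ν₀.isDominant_iff.1 hl ⟨n - 1, show n - 1 < n by omega⟩
      rw [ν₀.coroot_eq_corootCoord hX] at this
      simp only [corootCoord] at this
      rwa [if_pos (by omega)] at this
    obtain ⟨t, ht⟩ := ν₀.exists_evenCoord_eq hX (by simp) hn (by simp) hl hs h0 hlast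
    exact ⟨ν₀, t, ht⟩
  · ext s
    constructor
    · rintro ⟨⟨k, hk⟩ | ⟨k, hk⟩, rfl⟩
      · exact .inr (.inl ⟨k, hk, rfl⟩)
      · cases k with
        | zero => exact .inl rfl
        | succ k => exact .inr (.inr ⟨k, by omega, congrArg _ (pairs_succ_eq_chain _ _ _ _ _)⟩)
    · rintro (rfl | ⟨k, hk, rfl⟩ | ⟨k, hk, rfl⟩)
      · exact ⟨.inr ⟨0, by omega⟩, rfl⟩
      · exact ⟨.inl ⟨k, hk⟩, rfl⟩
      · exact ⟨.inr ⟨k + 1, by omega⟩, congrArg _ (pairs_succ_eq_chain _ _ _ _ _)⟩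
  · -- The symbol determines the weight: short blocks count twice, the long one once.
    have key : ∀ t : EvenIndex n, ((symbolC n t).map fun x => (x.1.rec 1 2 1 1 : ℕ)).sum =
        t.elim (fun k => 2 * k.1 + 2) fun k => 2 * k.1 + 1 := by
      rintro (k | k)
      · refine (sum_map_mark (fun a => (a.rec 1 2 1 1 : ℕ)) _ _ _).trans ?_
        simp only [Sum.elim_inl]
        ring
      · refine (congrArg (1 + ·) (sum_map_mark (fun a => (a.rec 1 2 1 1 : ℕ)) _ _ _)).trans ?_
        simp only [Sum.elim_inr]
        ring
    have h' := (key t).symm.trans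
      ((congrArg (fun s : Symbol => (s.map fun x => (x.1.rec 1 2 1 1 : ℕ)).sum) h).trans (key t'))
    have : t = t' := by
      rcases t with ⟨k, hk⟩ | ⟨k, hk⟩ <;> rcases t' with ⟨k', hk'⟩ | ⟨k', hk'⟩ <;>
        simp only [Sum.elim_inl, Sum.elim_inr] at h'
      · obtain rfl : k = k' := by omega
        rfl
      · omega
      · omega
      · obtain rfl : k = k' := by omega
        rfl
    subst this
    exact ⟨1, fun _ _ => rfl, fun _ => rfl⟩

end SmallWeights

namespace SmallWeights

/-! ### Type `D` -/

theorem sum_range_eq_of_three_le {n : ℕ} (hn : 3 ≤ n) {f : ℕ → ℤ}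
    (h : ∀ k < n, 3 ≤ k → f k = 0) : ∑ k ∈ Finset.range n, f k = f 0 + f 1 + f 2 := by
  rw [← Finset.sum_subset (Finset.range_subset_range.2 hn) fun k hk hk' =>
    h k (Finset.mem_range.1 hk) (by simpa using hk')]
  simp [Finset.sum_range_succ]

/-- Among the vectors `e_0 ± e_k`, the simple root `e_0 - e_1` of type `D_n` is the lowest. -/
theorem sub_or_lt_of_sum_sq {n : ℕ} (hn : 3 ≤ n) {β : ℕ → ℤ} (h0 : β 0 = 1)
    (hsq : ∑ k ∈ Finset.range n, β k ^ 2 = 2) :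
    (∀ k < n, β k = (if k = 0 then 1 else 0) - if k = 1 then 1 else 0) ∨
      2 < ∑ k ∈ Finset.range n, (2 * (n : ℤ) - 2 - 2 * k) * β k := by
  -- For `k ≠ 0` the coefficient of `β k` lies between `0` and `2n - 4`, and equals `2n - 4` for
  -- `k = 1` only.
  have hterm : ∀ k ∈ Finset.range n, -(2 * (n : ℤ) - 4) * β k ^ 2 +
      (if k = 0 then 4 * (n : ℤ) - 6 else 0) ≤ (2 * (n : ℤ) - 2 - 2 * k) * β k := by
    intro k hk
    have hk := Finset.mem_range.1 hk
    split_ifs with hk0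
    · rw [hk0, h0]
      push_cast
      linarith
    · have h1 : (1 : ℤ) ≤ k := by omega
      have h2 : (k : ℤ) + 1 ≤ n := by omega
      have h3 : (3 : ℤ) ≤ n := by omega
      rcases le_or_gt 0 (β k) with hβ | hβ
      · have := mul_nonneg (show (0 : ℤ) ≤ 2 * (n : ℤ) - 2 - 2 * k by linarith) hβ
        have := mul_nonneg (show (0 : ℤ) ≤ 2 * (n : ℤ) - 4 by linarith) (sq_nonneg (β k))
        linarith
      · have := mul_nonneg (show (0 : ℤ) ≤ 2 * (k : ℤ) - 2 by linarith)
          (show (0 : ℤ) ≤ -β k by linarith)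
        have := mul_nonneg (show (0 : ℤ) ≤ 2 * (n : ℤ) - 4 by linarith)
          (mul_nonneg (show (0 : ℤ) ≤ -β k by linarith) (show (0 : ℤ) ≤ -β k - 1 by linarith))
        linarith
  have hsum : ∑ k ∈ Finset.range n, (-(2 * (n : ℤ) - 4) * β k ^ 2 +
      (if k = 0 then 4 * (n : ℤ) - 6 else 0)) = 2 := by
    rw [Finset.sum_add_distrib, ← Finset.mul_sum, hsq, Finset.sum_ite_eq',
      if_pos (Finset.mem_range.2 (by omega))]
    ring
  have hle := Finset.sum_le_sum hterm
  rcases hle.lt_or_eq with hlt | heq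
  · exact .inr (hsum.symm.trans_lt hlt)
  left
  rw [Finset.sum_eq_sum_iff_of_le hterm] at heq
  have hother : ∀ k < n, k ≠ 0 → β k = 0 ∨ (k = 1 ∧ β k = -1) := by
    intro k hk hk0
    have h := heq k (Finset.mem_range.2 hk)
    rw [if_neg hk0, add_zero, sq, ← mul_assoc] at h
    rcases eq_or_ne (β k) 0 with hβ | hβ
    · exact .inl hβ
    · right
      have h := mul_right_cancel₀ hβ h
      have hneg : β k < 0 ∨ 0 < β k := lt_or_gt_of_ne hβ
      rcases hneg with hneg | hneg
      · have := mul_nonneg (show (0 : ℤ) ≤ 2 * (n : ℤ) - 4 by omega)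
          (show (0 : ℤ) ≤ -β k - 1 by omega)
        have hk1 : k = 1 := by
          have : 2 * (n : ℤ) - 4 ≤ 2 * (n : ℤ) - 2 - 2 * k := by linarith
          omega
        refine ⟨hk1, ?_⟩
        subst hk1
        have : (2 * (n : ℤ) - 4) * (β 1 + 1) = 0 := by push_cast at h; linarith
        rcases mul_eq_zero.1 this with h' | h' <;> omega
      · have := mul_pos (show (0 : ℤ) < 2 * (n : ℤ) - 4 by omega) hneg
        have : (0 : ℤ) ≤ 2 * (n : ℤ) - 2 - 2 * k := by omega
        linarith
  have h1 : β 1 = -1 := by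
    refine ((hother 1 (by omega) one_ne_zero).resolve_left fun h1 => ?_).2
    rw [sum_range_eq_of_three_le hn fun k hk hk3 => by
      rw [(hother k hk (by omega)).resolve_right fun h => by omega]; rfl, h0, h1,
      (hother 2 (by omega) two_ne_zero).resolve_right fun h => by omega] at hsq
    norm_num at hsq
  intro k hk
  rcases eq_or_ne k 0 with rfl | hk0
  · simp [h0]
  rcases eq_or_ne k 1 with rfl | hk1
  · simp [h1]
  · rw [(hother k hk hk0).resolve_right fun h => hk1 h.1]
    simp [hk0, hk1]

/-- Exchanging the last two nodes is an automorphism of the diagram. -/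
theorem cartan_D_swap {n : ℕ} (hn : 4 ≤ n) (i j : Fin n) :
    CartanMatrix.D n (Equiv.swap ⟨n - 2, by omega⟩ ⟨n - 1, by omega⟩ i)
      (Equiv.swap ⟨n - 2, by omega⟩ ⟨n - 1, by omega⟩ j) = CartanMatrix.D n i j := by
  obtain ⟨i, hi⟩ := i
  obtain ⟨j, hj⟩ := j
  have hn2 : n - 2 < n := by omega
  have hn1 : n - 1 < n := by omega
  have key : ∀ k (hk : k < n), ∃ k', ∃ hk' : k' < n,
      (Equiv.swap ⟨n - 2, hn2⟩ ⟨n - 1, hn1⟩ (⟨k, hk⟩ : Fin n)) = (⟨k', hk'⟩ : Fin n) ∧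
      (k + 2 < n ∧ k' = k ∨ k = n - 2 ∧ k' = n - 1 ∨ k = n - 1 ∧ k' = n - 2) := by
    intro k hk
    rw [Equiv.swap_apply_def]
    split_ifs with h1 h2
    · exact ⟨_, hn1, rfl, .inr (.inl ⟨Fin.mk.inj h1, rfl⟩)⟩
    · exact ⟨_, hn2, rfl, .inr (.inr ⟨Fin.mk.inj h2, rfl⟩)⟩
    · rw [Fin.mk.injEq] at h1 h2
      exact ⟨_, hk, rfl, .inl ⟨by omega, rfl⟩⟩
  obtain ⟨i', hi', ei, h⟩ := key i hi
  obtain ⟨j', hj', ej, h'⟩ := key j hj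
  rw [ei, ej]
  simp only [CartanMatrix.D, Matrix.of_apply, Fin.mk.injEq]
  exact if_congr (by omega) rfl <| if_congr Iff.rfl rfl <| if_congr (by omega) rfl <|
    if_congr (by omega) rfl <| if_congr (by omega) rfl <| if_congr (by omega) rfl rfl

theorem cartan_D_zero {n : ℕ} (hn : 4 ≤ n) {j : ℕ} (hj : j < n) (hj0 : j ≠ 0) (hj1 : j ≠ 1) :
    CartanMatrix.D n ⟨0, by omega⟩ ⟨j, hj⟩ = 0 := by
  have h : ¬ (⟨0, by omega⟩ : Fin n) = ⟨j, hj⟩ := fun h => hj0 (Fin.mk.inj h).symm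
  simp only [CartanMatrix.D, Matrix.of_apply, if_neg h]
  split_ifs <;> first | omega | tauto

variable {ι V N : Type*} [AddCommGroup V] [Module ℝ V] [AddCommGroup N] [Module ℝ N]
  {P : RootPairing ι ℝ V N} [P.IsRootSystem] [Fintype ι] [P.IsCrystallographic] [P.IsReduced]

open DynkinType Mark

/-- The symbols in type `D`. -/
def symbolD (n : ℕ) : EvenIndex n → Symbol
  | .inl k => (List.range (k + 1)).map fun j => (one, typeD (n - 2 * j))
  | .inr ⟨0, _⟩ => [(one, typeD n), (one, A 1)]
  | .inr ⟨k + 1, _⟩ =>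
    (two, typeD n) :: (List.range k).map fun j => (one, typeD (n - (3 + 2 * j)))

namespace Labelling

variable {b : P.Base} {n : ℕ}

theorem coord_root_le_one (hn : 4 ≤ n) (ν : Labelling b (.D n)) (i : ι) :
    ν.coord 0 (P.root i) ≤ 1 := by
  obtain ⟨β, hβ, h⟩ := ν.exists_rootCoord (X := .D n) hn i
  rw [hβ]
  have h1 := Finset.single_le_sum (f := fun k => β k ^ 2) (fun k _ => sq_nonneg (β k))
    (Finset.mem_range.2 (show 0 < n by omega))
  rw [show ∑ k ∈ Finset.range n, β k ^ 2 = 2 from h] at h1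
  have : β 0 ≤ 1 := by
    nlinarith
  exact_mod_cast this

/-- If the first coordinate of a weight of length two is `2`, then that of the roots in its minimal
expressions is `1`. -/
theorem coord_eq_one_of_mem (hn : 4 ≤ n) (ν : Labelling b (.D n)) {l : V} (hl : HasLength P l 2)
    (h2 : ν.coord 0 l = 2) {e : Multiset ι} (he : IsMinimalExpression P l e) {i : ι} (hi : i ∈ e) :
    ν.coord 0 (P.root i) = 1 := by
  have h := he.1.apply_le_add (ν.coord_root_le_one hn) hi
  rw [hl.card_eq he, h2] at h
  have := ν.coord_root_le_one hn i
  norm_num at h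
  linarith

theorem realizes_D_pairs (hn : 4 ≤ n) (ν : Labelling b (.D n)) {k : ℕ} (hk : 2 * k + 2 ≤ n) :
    ν.Realizes (evenCoord (n := n) (.inl ⟨k, hk⟩)) (symbolD n (.inl ⟨k, hk⟩)) := by
  have hX : (D n).IsClassical := hn
  obtain ⟨r, hr⟩ := ν.exists_pairs hX
  obtain ⟨l, hd, -⟩ := ν.hasDecomposition_zero.append_pairs hX (p := 0) (t := k + 1)
    (show 0 + 2 * (k + 1) ≤ n by omega) (fun _ _ => rfl) (by simp) fun q hq => (hr q hq).1
  have hc := ν.isCascade_pairs hX hr (a := one) (fun _ _ => oneLength_D (ν := ν) hn) (p := 0)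
    (t := k + 1) (show 0 + 2 * (k + 1) ≤ n by omega) (L := []) (s := []) (fun _ _ => .nil)
    (.inl ν.splits_zero)
  simp only [zero_add, List.nil_append, List.append_nil] at hd hc
  refine hd.realizes (fun i => ?_) hc
  simp only [evenCoord, Pi.zero_apply]
  split_ifs <;> omega

/-- The weight `2 e_0` is the sum of the blocks `e_0 + e_1` and `e_0 - e_1`. -/
theorem realizes_D_single (hn : 4 ≤ n) (ν : Labelling b (.D n)) (h : 2 * 0 + 1 ≤ n) :
    ν.Realizes (evenCoord (n := n) (.inr ⟨0, h⟩)) [(one, typeD n), (one, A 1)] := by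
  have hX : (D n).IsClassical := hn
  have hn0 : 0 < (D n).rank := show 0 < n by omega
  have hn2 : 0 + 2 ≤ (D n).rank := show 2 ≤ n by omega
  obtain ⟨⟨i, hi, hi'⟩, -⟩ := ν.exists_root_pair hX hn2
  have hd := (ν.hasDecomposition_zero.snoc_pair hX hn2 (fun _ _ => rfl) (by simp) hi).1
  have hα : ∀ k, ν.coord k (P.root (ν.node ⟨0, hn0⟩)) =
      (((if k = 0 then 1 else 0) - if k = 1 then 1 else 0 : ℤ) : ℝ) := fun k => by
    rw [coord_node, simpleCoord_of_lt hX (show 0 + 1 < n by omega)]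
  have hlen : HasLength P (0 + P.root i + P.root (ν.node ⟨0, hn0⟩)) (0 + 1 + 1) := by
    obtain ⟨e, he, hcard⟩ := hd.exists_expression (ν.node ⟨0, hn0⟩)
    rw [← hcard]
    refine hasLength_of_functional he (ν.coord 0) zero_le_one (ν.coord_root_le_one hn) ?_
    rw [hcard, hd.coord_add_root hα]
    norm_num
  have h2 : ν.coord 0 (0 + P.root i + P.root (ν.node ⟨0, hn0⟩)) = 2 := by
    rw [hd.coord_add_root hα]
    norm_num
  have hheight : ∑ k ∈ Finset.range n, (2 * (n : ℤ) - 2 - 2 * k) *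
      ((if k = 0 then 1 else 0) - if k = 1 then 1 else 0) = 2 := by
    rw [sum_range_eq_of_three_le (by omega) fun k hk h3 => by
      rw [if_neg (by omega), if_neg (by omega), sub_zero, mul_zero]]
    norm_num
  have hd' := hd.snoc hX hα (by
      change ∑ k ∈ Finset.range n, _ = _
      rw [sum_range_eq_of_three_le (by omega) fun k hk h3 => by
        rw [if_neg (by omega), if_neg (by omega), sub_zero, zero_mul]]
      norm_num) hlen (hheight.symm ▸ two_pos) fun e he j hj => by
    obtain ⟨β, hβ, hshape⟩ := ν.exists_rootCoord hX j
    have h1 := ν.coord_eq_one_of_mem hn hlen h2 he hj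
    rw [hβ] at h1
    refine ⟨β, hβ, ?_⟩
    refine (sub_or_lt_of_sum_sq (by omega) (by exact_mod_cast h1) hshape).imp id fun h => ?_
    exact hheight.trans_lt h
  have hC : ν.component 0 = ν.tail 0 := ν.component_eq_tail fun ⟨m, h, h'⟩ => by
    cases h
    omega
  have hone : ∀ {i}, one.LengthMark P i := oneLength_D (ν := ν) hn
  have hmem : ∀ j : Fin (D n).rank,
      ν.node j ∈ orthogonalNodes P (ν.component 0) {i} ↔ (j : ℕ) ≠ 1 := by
    intro j
    rw [ν.mem_orthogonalNodes_iff hX hi, hC,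
      (corootCoord_pair hX j.2 (Nat.zero_le _) hn2).2]
    refine ⟨fun h => h.2.1, fun h => ⟨ν.node_mem_tail (Nat.zero_le _), h, ?_⟩⟩
    rintro ⟨⟨m, h, h'⟩, -⟩
    cases h
    omega
  have hT : HasType P {ν.node ⟨0, hn0⟩} (A 1) := by
    have := ν.hasType_range (Y := A 1) le_rfl (g := fun _ => ⟨0, hn0⟩)
      (fun _ _ _ => Subsingleton.elim (α := Fin 1) _ _) fun i j => by
        obtain rfl : i = j := Subsingleton.elim (α := Fin 1) _ _
        exact (CartanMatrix.D_diag n _).trans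
          (congrFun (CartanMatrix.A_diag 1) i).symm
    have hne : Nonempty (Fin (A 1).rank) := ⟨(0 : Fin 1)⟩
    rwa [Set.range_const] at this
  have hlast : IsCascade P (orthogonalNodes P (ν.component 0) {i}) [{ν.node ⟨0, hn0⟩}]
      [(one, A 1)] := by
    refine .cons (hT.isComponent ?_ ⟨_, rfl⟩ ?_) hT
      (.inl ⟨_, ⟨inParabolic_of_mem rfl, ?_⟩, hone, rfl⟩) .nil
    · rintro _ rfl
      exact (hmem ⟨0, hn0⟩).2 zero_ne_one
    · rintro _ rfl j ⟨hj, hj0⟩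
      have hjt := hj.1
      rw [hC] at hjt
      obtain ⟨⟨j, hjn⟩, -, rfl⟩ := hjt
      have hj1 : j ≠ 1 := (hmem ⟨j, hjn⟩).1 hj
      have hj2 : j ≠ 0 := by
        rintro rfl
        exact hj0 rfl
      refine ν.pairing_eq_zero ?_
      exact cartan_D_zero hn hjn hj2 hj1
    · rintro _ rfl
      rw [P.pairing_same]
      exact zero_le_two
  refine hd'.realizes (fun k => ?_) (ν.isCascade_cons hX hn0 (fun _ => hn2) ν.splits_zero
    (by rwa [hC]) hi (fun j _ => (corootCoord_pair hX j.2 (Nat.zero_le _) hn2).1) hone hlast)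
  simp only [evenCoord, Pi.zero_apply]
  split_ifs <;> omega

/-- The weight `2 e_0 + e_1 + e_2` is the sum of the block `e_0 + e_2, e_0 + e_1`. These are the
only roots with first coordinate `1` which are non-negative and bounded by the weight. -/
theorem hasDecomposition_pair_D [DecidableEq ι] (hn : 4 ≤ n) {ν : Labelling b (.D n)} {i₁ i₂ : ι}
    (h₁ : ∀ k, ν.coord k (P.root i₁) = ((if k = 0 ∨ k = 2 then 1 else 0 : ℤ) : ℝ))
    (h₂ : ∀ k, ν.coord k (P.root i₂) = ((if k = 0 ∨ k = 1 then 1 else 0 : ℤ) : ℝ)) :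
    ν.HasDecomposition (P.root i₁ + P.root i₂)
      (fun k => if k = 0 then 2 else if k < 3 then 1 else 0) 2 [{i₁, i₂}] := by
  have hX : (D n).IsClassical := hn
  have hcoord : ∀ k, ν.coord k (P.root i₁ + P.root i₂) =
      ((if k = 0 then 2 else if k < 3 then 1 else 0 : ℤ) : ℝ) := by
    intro k
    rw [map_add, h₁, h₂, ← Int.cast_add]
    congr 1
    split_ifs <;> omega
  have hsum : ∑ k ∈ Finset.range (D n).rank,
      (if k = 0 then 2 else if k < 3 then 1 else 0 : ℤ) = 2 * (2 : ℕ) := by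
    change ∑ k ∈ Finset.range n, _ = _
    rw [sum_range_eq_of_three_le (by omega) fun k hk h3 => by
      rw [if_neg (by omega), if_neg (by omega)]]
    norm_num
  have hlen : HasLength P (P.root i₁ + P.root i₂) 2 := by
    refine ν.hasLength_of_sum_coord hX (e := {i₁, i₂}) (by simp [IsExpression]) hcoord ?_
    rw [hsum]
    simp
  have hne : i₁ ≠ i₂ := by
    rintro rfl
    have := (h₁ 1).symm.trans (h₂ 1)
    norm_num at this
  have hht₁ := ν.two_mul_height hX h₁
  have hht₂ := ν.two_mul_height hX h₂
  change _ = ∑ k ∈ Finset.range n, _ at hht₁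
  change _ = ∑ k ∈ Finset.range n, _ at hht₂
  rw [sum_mul_pair _ (by omega) (show 0 < n by omega) (show 2 < n by omega)] at hht₁
  rw [sum_mul_pair _ (by omega) (show 0 < n by omega) (show 1 < n by omega)] at hht₂
  simp only [topHeight] at hht₁ hht₂
  push_cast at hht₁ hht₂
  refine ⟨hcoord, hlen, fun M => ?_, Submodule.add_mem _ (Submodule.subset_span ⟨i₁, rfl⟩)
    (Submodule.subset_span ⟨i₂, rfl⟩)⟩
  refine isCanonical_snoc_pair_iff (k := 0) (L := []) hne ?_ (by simp) (by simp)
    (by rw [sub_self]; exact hasLength_zero) hlen (by omega) (by omega) (fun e he i hi => ?_)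
    (by rw [sub_self]; exact isCanonical_zero_iff) M
  · have h := ν.sum_sq_mul_coroot hX h₂ (P.root i₁)
    simp only [h₁] at h
    have h1 : ∑ k ∈ Finset.range (D n).rank, (if k = 0 ∨ k = 1 then (1 : ℤ) else 0) *
        (if k = 0 ∨ k = 2 then 1 else 0) = 1 :=
      sum_mul_pair (n := n) (fun k => if k = 0 ∨ k = 1 then 1 else 0) (by omega)
        (show 0 < n by omega) (show 2 < n by omega)
    have h1' : ∑ k ∈ Finset.range (D n).rank, ((if k = 0 ∨ k = 1 then 1 else 0 : ℤ) : ℝ) *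
        ((if k = 0 ∨ k = 2 then 1 else 0 : ℤ) : ℝ) = 1 := by exact_mod_cast h1
    rw [h1', show ∑ k ∈ Finset.range (D n).rank, (if k = 0 ∨ k = 1 then (1 : ℤ) else 0) ^ 2 = 2 from
      sum_sq_pair (p := 0) (show 0 + 2 ≤ n by omega), P.root_coroot'_eq_pairing] at h
    push_cast at h
    linarith
  · obtain ⟨β, hβ, hshape, h2, hle⟩ := ν.coord_le_of_tight hX hlen hcoord hsum he hi
    have hβ0 : β 0 = 1 := by
      have := ν.coord_eq_one_of_mem hn hlen (by rw [hcoord]; norm_num) he hi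
      rw [hβ] at this
      exact_mod_cast this
    have hz : ∀ k < n, 3 ≤ k → β k = 0 := by
      intro k hk h3
      have := hle k hk
      rw [if_neg (by omega), if_neg (by omega)] at this
      omega
    have h12 : β 1 + β 2 = 1 := by
      change ∑ k ∈ Finset.range n, _ = _ at h2
      rw [sum_range_eq_of_three_le (by omega) hz] at h2
      omega
    have hnn1 := (hle 1 (show 1 < n by omega)).1
    have hnn2 := (hle 2 (show 2 < n by omega)).1
    constructor
    · have h := ν.sum_sq_mul_coroot hX hβ (P.root i₁ + P.root i₂)
      simp only [hcoord] at h
      have h3 : ∑ k ∈ Finset.range (D n).rank, β k *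
          (if k = 0 then 2 else if k < 3 then 1 else 0) = 3 := by
        change ∑ k ∈ Finset.range n, _ = _
        rw [sum_range_eq_of_three_le (by omega) fun k hk h3 => by rw [hz k hk h3, zero_mul]]
        simp only [hβ0]
        norm_num
        omega
      have h3' : ∑ k ∈ Finset.range (D n).rank, (β k : ℝ) *
          ((if k = 0 then 2 else if k < 3 then 1 else 0 : ℤ) : ℝ) = 3 := by exact_mod_cast h3
      rw [h3', show ∑ k ∈ Finset.range (D n).rank, β k ^ 2 = 2 from hshape] at h
      push_cast at h
      linarith
    · have heq : ∀ {j : ι} {a c : ℕ}, a < 3 → c < 3 → 1 ≤ a → 1 ≤ c → a ≠ c → β a = 1 → β c = 0 →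
          (∀ k, ν.coord k (P.root j) = ((if k = 0 ∨ k = a then 1 else 0 : ℤ) : ℝ)) → i = j := by
        intro j a c ha3 hc3 ha hc hac hβa hβc hj
        refine ν.root_eq_of_coord hX fun k hk => ?_
        rw [hβ, hj]
        congr 1
        rcases lt_or_ge k 3 with hk3 | hk3
        · rcases (show k = 0 ∨ k = a ∨ k = c by omega) with rfl | rfl | rfl
          · simp [hβ0]
          · simp [hβa]
          · rw [hβc, if_neg (by omega)]
        · rw [hz k hk hk3, if_neg (by omega)]
      rcases (show β 1 = 1 ∧ β 2 = 0 ∨ β 2 = 1 ∧ β 1 = 0 by omega) with h | h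
      · exact .inr (.inl (heq (by omega) (by omega) le_rfl one_le_two (by omega) h.1 h.2 h₂))
      · exact .inl (heq (by omega) (by omega) one_le_two le_rfl (by omega) h.1 h.2 h₁)

/-- The weights `2 e_0 + e_1 + ⋯ + e_{2k+2}`: after the block `e_0 + e_2, e_0 + e_1`, the simple
roots from number `3` on remain. -/
theorem realizes_D_two (hn : 4 ≤ n) (ν : Labelling b (.D n)) {k : ℕ} (hk : 2 * (k + 1) + 1 ≤ n) :
    ν.Realizes (evenCoord (n := n) (.inr ⟨k + 1, hk⟩)) (symbolD n (.inr ⟨k + 1, hk⟩)) := by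
  classical
  have hX : (D n).IsClassical := hn
  have hn0 : 0 < (D n).rank := show 0 < n by omega
  have hn2 : 0 + 2 ≤ (D n).rank := show 2 ≤ n by omega
  have hn1 : 1 + 1 < (D n).rank := show 2 < n by omega
  have htype : typeD n = D n := by
    rw [typeD, if_neg (by omega), if_neg (by omega)]
  obtain ⟨r, hr⟩ := ν.exists_pairs hX
  obtain ⟨⟨i₂, h₂, hi₂⟩, hpair⟩ := ν.exists_root_pair hX hn2
  obtain ⟨i₁, h₁, -⟩ := hpair ⟨n, rfl⟩ (show 3 ≤ n by omega)
  obtain ⟨l, hd, -⟩ := (hasDecomposition_pair_D hn h₁ h₂).append_pairs hX (p := 3) (t := k)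
    (show 3 + 2 * k ≤ n by omega) (fun k hk => by rw [if_neg (by omega), if_neg (by omega)]) (by
      change ∑ k ∈ Finset.range n, _ = _
      rw [sum_range_eq_of_three_le (by omega) fun k hk h3 => by
        rw [if_neg (by omega), if_neg (by omega)]]
      norm_num) fun q hq => (hr q hq).1
  have hC : ν.component 0 = ν.tail 0 := ν.component_eq_tail fun ⟨m, h, h'⟩ => by
    cases h
    omega
  have hcont : ν.Continues (orthogonalNodes P (ν.component 0) {i₁, i₂}) 3 := by
    rcases le_or_gt n 4 with hn4 | hn4
    · exact .inr ⟨n, rfl, hn4⟩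
    have hmem : orthogonalNodes P (ν.component 0) {i₁, i₂} = ν.tail 3 := by
      have hiff : ∀ j : Fin (D n).rank, ν.node j ∈ orthogonalNodes P (ν.component 0) {i₁, i₂} ↔
          3 ≤ (j : ℕ) := by
        intro j
        have hj : (j : ℕ) < n := j.2
        have : ν.node j ∈ orthogonalNodes P (ν.component 0) {i₁, i₂} ↔
            ν.node j ∈ orthogonalNodes P (ν.component 0) {i₁} ∧
            ν.node j ∈ orthogonalNodes P (ν.component 0) {i₂} := by
          simp [orthogonalNodes]
        rw [this, ν.mem_orthogonalNodes_iff hX h₁, ν.mem_orthogonalNodes_iff hX h₂, hC,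
          node_mem_tail_iff]
        simp only [corootCoord]
        grind
      ext i
      constructor
      · intro hi
        have hi' := hi.1
        rw [hC] at hi'
        obtain ⟨j, -, rfl⟩ := hi'
        exact ν.node_mem_tail ((hiff j).1 hi)
      · rintro ⟨j, hj, rfl⟩
        exact (hiff j).2 hj
    rw [hmem]
    exact .inl ⟨subset_rfl, fun _ _ _ h => absurd h.1 h.2⟩
  have hc := ν.isCascade_pairs hX hr (a := one) (fun _ _ => oneLength_D (ν := ν) hn) (p := 3)
    (t := k) (show 3 + 2 * k ≤ n by omega) (L := []) (s := []) (fun _ _ => .nil) hcont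
  simp only [List.append_nil] at hc
  have hblock : IsDominantBlock P (ν.component 0) (typeD n) two {i₁, i₂} := by
    rw [htype]
    refine .inr ⟨rfl, CartanMatrix.isSimplyLaced_D n, i₂, i₁,
      ν.isDominantRoot_of_coord hX (by rwa [hC]) h₂
        (fun j _ => (corootCoord_pair hX j.2 (Nat.zero_le _) hn2).1) (ν.component_subset_tail 0),
      ⟨ν.node ⟨1, by omega⟩, ?_, ?_, ?_⟩, ?_⟩
    · rw [hC]
      exact ν.node_mem_tail (Nat.zero_le _)
    · rw [ν.pairing_node hX h₂, Int.cast_ne_zero]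
      exact fun h => ((corootCoord_pair hX (show 1 < (D n).rank by omega) (Nat.zero_le _) hn2).2.1
        h).1 rfl
    · refine ν.ext_coord hX fun k => ?_
      rw [map_sub, h₁, h₂, coord_node, simpleCoord_of_lt hX hn1, ← Int.cast_sub]
      congr 1
      split_ifs <;> omega
    · rw [Finset.coe_pair, Set.pair_comm]
  refine hd.realizes (fun i => ?_) (.cons (ν.isComponent_component hX hn0 (fun _ => hn2)
    ν.splits_zero) (ν.hasType_component hX hn0 fun _ => hn2) hblock hc)
  simp only [evenCoord]
  grind

end Labelling

theorem classification_D {b : P.Base} {n : ℕ} (hn : 4 ≤ n) (ν₀ : Labelling b (.D n)) :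
    IsClassified b (D n) := by
  have hX : (D n).IsClassical := hn
  refine classification_of_coord hX evenCoord (symbolD n) evenCoord_pos (fun t j => ?_)
    (fun t β hβ => evenCoord_small t (show ∑ k ∈ Finset.range n, β k ^ 2 = 2 from hβ).ge)
    (fun ν t => ?_) (fun l hl hs h0 => ?_) ?_ ν₀ (fun t t' h => ?_)
  · have := evenCoord_nonneg t j
    have := evenCoord_nonneg t (j - 1)
    have := evenCoord_succ_le t j
    simp only [corootCoord]
    split_ifs <;> omega
  · rcases t with ⟨k, hk⟩ | ⟨_ | k, hk⟩
    · exact ν.realizes_D_pairs hn hk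
    · exact ν.realizes_D_single hn hk
    · exact ν.realizes_D_two hn hk
  · -- The automorphism exchanging the last two nodes changes the sign of the last coordinate.
    have key : ∀ ν : Labelling b (D n), 0 ≤ ν.coord (n - 1) l →
        ∃ (ν : Labelling b (D n)) (t : EvenIndex n), ∀ k < n, ν.coord k l = evenCoord t k := by
      intro ν hlast
      obtain ⟨t, ht⟩ := ν.exists_evenCoord_eq hX (by simp) (show 3 ≤ n by omega)
        (fun m h => by cases h; exact hn) hl hs h0 hlast
      exact ⟨ν, t, ht⟩
    rcases le_or_gt 0 (ν₀.coord (n - 1) l) with hlast | hlast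
    · exact key ν₀ hlast
    have hn1 : n - 1 < n := by omega
    have hn2 : n - 2 < n := by omega
    let ν : Labelling b (D n) := ν₀.comp _ (cartan_D_swap hn)
    have hlabels : ∀ ν : Labelling b (D n),
        P.coroot' (ν.node ⟨n - 1, hn1⟩) l - P.coroot' (ν.node ⟨n - 2, hn2⟩) l =
          2 * ν.coord (n - 1) l := by
      intro ν
      rw [ν.coroot_eq_corootCoord hX, ν.coroot_eq_corootCoord hX]
      simp only [corootCoord]
      rw [if_pos (by omega), if_neg (by omega), show n - 1 - 1 = n - 2 by omega,
        show n - 2 + 1 = n - 1 by omega]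
      ring
    refine key ν ?_
    have h := hlabels ν
    have h₀ := hlabels ν₀
    have e1 : ν.node ⟨n - 1, hn1⟩ = ν₀.node ⟨n - 2, hn2⟩ :=
      congrArg ν₀.node (Equiv.swap_apply_right _ _)
    have e2 : ν.node ⟨n - 2, hn2⟩ = ν₀.node ⟨n - 1, hn1⟩ :=
      congrArg ν₀.node (Equiv.swap_apply_left _ _)
    rw [e1, e2] at h
    linarith
  · ext s
    constructor
    · rintro ⟨⟨k, hk⟩ | ⟨_ | k, hk⟩, rfl⟩
      · exact .inr (.inr (.inl ⟨k, hk, rfl⟩))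
      · exact .inl rfl
      · cases k with
        | zero => exact .inr (.inl rfl)
        | succ k =>
          exact .inr (.inr (.inr ⟨k, by omega, congrArg _ (pairs_succ_eq_chain _ _ _ _ _)⟩))
    · rintro (rfl | rfl | ⟨k, hk, rfl⟩ | ⟨k, hk, rfl⟩)
      · exact ⟨.inr ⟨0, by omega⟩, rfl⟩
      · exact ⟨.inr ⟨1, by omega⟩, rfl⟩
      · exact ⟨.inl ⟨k, hk⟩, rfl⟩
      · exact ⟨.inr ⟨k + 2, by omega⟩, congrArg _ (pairs_succ_eq_chain _ _ _ _ _)⟩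
  · -- Counting the blocks, single roots twice, leaves one pair of weights to be told apart.
    let f : Mark → ℕ := fun a => a.rec 2 1 1 1
    have key : ∀ t : EvenIndex n, ((symbolD n t).map fun x => f x.1).sum =
        t.elim (fun k => 2 * k.1 + 2) fun k => if k.1 = 0 then 4 else 2 * k.1 - 1 := by
      rintro (k | ⟨_ | k, hk⟩)
      · refine (sum_map_mark f _ _ _).trans ?_
        simp only [Sum.elim_inl, f]
        ring
      · rfl
      · refine (congrArg (1 + ·) (sum_map_mark f _ _ _)).trans ?_
        simp only [Sum.elim_inr, f, if_neg (Nat.succ_ne_zero k)]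
        omega
    have h' := (key t).symm.trans
      ((congrArg (fun s : Symbol => (s.map fun x => f x.1).sum) h).trans (key t'))
    -- The two weights with two blocks have the same symbol for `n = 4` only.
    have hfour : ∀ {h1 h2}, symbolD n (.inl ⟨1, h1⟩) = symbolD n (.inr ⟨0, h2⟩) → n = 4 := by
      intro h1 h2 h
      have h : typeD (n - 2) = A 1 := by
        injection h with _ h
        injection h with h _
        exact congrArg Prod.snd h
      rw [typeD] at h
      split_ifs at h with h2 h3
      · omega
      · cases h
    have hcartan : ∀ i j : Fin 4, CartanMatrix.D 4 (Equiv.swap 0 3 i) (Equiv.swap 0 3 j : Fin 4) =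
        CartanMatrix.D 4 i j := by
      simp only [CartanMatrix.D, Matrix.of_apply]
      decide
    have hlabel₀ : ∀ h1 h2, ∀ j : Fin 4,
        (D 4).corootCoord (evenCoord (n := 4) (.inr ⟨0, h2⟩)) (Equiv.swap 0 3 j : Fin 4) =
        (D 4).corootCoord (evenCoord (n := 4) (.inl ⟨1, h1⟩)) j := by
      simp only [corootCoord, evenCoord]
      decide
    have hlabel₁ : ∀ h1 h2, ∀ j : Fin 4,
        (D 4).corootCoord (evenCoord (n := 4) (.inl ⟨1, h1⟩)) (Equiv.swap 0 3 j : Fin 4) =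
        (D 4).corootCoord (evenCoord (n := 4) (.inr ⟨0, h2⟩)) j := by
      simp only [corootCoord, evenCoord]
      decide
    rcases t with ⟨k, hk⟩ | ⟨k, hk⟩ <;> rcases t' with ⟨k', hk'⟩ | ⟨k', hk'⟩ <;>
      simp only [Sum.elim_inl, Sum.elim_inr] at h'
    · obtain rfl : k = k' := by omega
      exact ⟨1, fun _ _ => rfl, fun _ => rfl⟩
    · obtain ⟨rfl, rfl⟩ : k = 1 ∧ k' = 0 := by split_ifs at h' <;> omega
      obtain rfl := hfour h
      exact ⟨(Equiv.swap 0 3 : Equiv.Perm (Fin 4)), hcartan, hlabel₀ _ _⟩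
    · obtain ⟨rfl, rfl⟩ : k = 0 ∧ k' = 1 := by split_ifs at h' <;> omega
      obtain rfl := hfour h.symm
      exact ⟨(Equiv.swap 0 3 : Equiv.Perm (Fin 4)), hcartan, hlabel₁ _ _⟩
    · obtain rfl : k = k' := by split_ifs at h' <;> omega
      exact ⟨1, fun _ _ => rfl, fun _ => rfl⟩

end SmallWeights

open SmallWeights in
theorem mainTheorem1 {ι V N : Type*} [Fintype ι] [AddCommGroup V] [Module ℝ V]
    [AddCommGroup N] [Module ℝ N] (P : RootPairing ι ℝ V N) [P.IsRootSystem]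
    [P.IsCrystallographic] [P.IsReduced] [P.IsIrreducible] (b : P.Base)
    (X : DynkinType) (hX : HasType P b.support X) (hA : ∀ n, X ≠ DynkinType.A n) :
    (∀ l : V, IsDominant b l → IsSmall P l →
      (∃! L, IsCanonical b l L) ∧ (∃! s, HasSymbol b l s)) ∧
    {s | ∃ l : V, l ≠ 0 ∧ IsDominant b l ∧ IsSmall P l ∧ HasSymbol b l s} = X.symbols ∧
    (∀ (l : V) (L : List (Finset ι)) (s : Symbol), IsDominant b l → IsSmall P l →
      IsCanonical b l L → IsSymbol P b.support L s →
      IsCascade P b.support L s ∧ l = (L.map (blockSum P)).sum) ∧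
    (∀ (l m : V) (s : Symbol), IsDominant b l → IsSmall P l → IsDominant b m → IsSmall P m →
      HasSymbol b l s → HasSymbol b m s → DiagramConjugate b l m) := by
  obtain ⟨ν⟩ := hX.exists_labelling
  cases X with
  | A n => exact absurd rfl (hA n)
  | B n => exact classification_B hX.1 ν
  | C n => exact classification_C hX.1 ν
  | D n => exact classification_D hX.1 ν
  | E6 =>
    exact classification_of_certificate hX.1 ν DynkinType.certificateE6 DynkinType.isRootList_E6
      DynkinType.isComplete_E6 DynkinType.isValidCascade_E6 DynkinType.symbols_E6
      DynkinType.nodup_E6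
  | E7 =>
    exact classification_of_certificate hX.1 ν DynkinType.certificateE7 DynkinType.isRootList_E7
      DynkinType.isComplete_E7 DynkinType.isValidCascade_E7 DynkinType.symbols_E7
      DynkinType.nodup_E7
  | E8 =>
    exact classification_of_certificate hX.1 ν DynkinType.certificateE8 DynkinType.isRootList_E8
      DynkinType.isComplete_E8 DynkinType.isValidCascade_E8 DynkinType.symbols_E8
      DynkinType.nodup_E8
  | F4 =>
    exact classification_of_certificate hX.1 ν DynkinType.certificateF4 DynkinType.isRootList_F4
      DynkinType.isComplete_F4 DynkinType.isValidCascade_F4 DynkinType.symbols_F4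
      DynkinType.nodup_F4
  | G2 =>
    exact classification_of_certificate hX.1 ν DynkinType.certificateG2 DynkinType.isRootList_G2
      DynkinType.isComplete_G2 DynkinType.isValidCascade_G2 DynkinType.symbols_G2
      DynkinType.nodup_G2
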